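/- Let $d,N,M\ge 1$ be integers, $\beta>0$, and $\lambda_S,\lambda_R,\mu\ge 0$. Let $\rho$ be a probability measure on the unit sphere $\mathbb S^{d-1}\subset\mathbb R^d$ with $\int \sigma\otimes\sigma\,d\rho(\sigma)=\frac1d\,\mathbb 1$. For $\boldsymbol u=(u_1,\dots,u_{N+M})\in\mathbb R^{d(N+M)}$ and $i<j$, let $M^{(ij)}_\sigma\boldsymbol u$ be the vector obtained from $\boldsymbol u$ by replacing $u_i$ with $u_i-\langle\sigma,u_i-u_j\rangle\sigma$ and $u_j$ with $u_j+\langle\sigma,u_i-u_j\rangle\sigma$, and put $R_{ij}F(\boldsymbol u)=\int F(M^{(ij)}_\sigma\boldsymbol u)\,d\rho(\sigma)$ and $$\mathcal L=\frac{\lambda_S}{N-1}\sum_{1\le i<j\le N}(R_{ij}-\mathbb 1)+\frac{\lambda_R}{M-1}\sum_{N<i<j\le N+M}(R_{ij}-\mathbb 1)+\frac{\mu}{M}\sum_{i=1}^{N}\sum_{j=N+1}^{N+M}(R_{ij}-\mathbb 1)$$ (the first sum is absent if $N=1$, the second if $M=1$). On $\mathbb R^{dk}$ let $\gamma(\boldsymbol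 x)=(\beta/2\pi)^{dk/2}e^{-\beta|\boldsymbol x|^2/2}$. Let $f_0$ be a probability density on $\mathbb R^{dN}$ with $\sqrt{f_0}\in H^1(\mathbb R^{dN})$, and let $(F_t)_{t\ge0}$ be a solution in $L^1(\mathbb R^{d(N+M)})$ of the Kac master equation $\frac{d}{dt}F_t=\mathcal L F_t$ with $F_0(\boldsymbol v,\boldsymbol w)=f_0(\boldsymbol v)\gamma(\boldsymbol w)$, $\boldsymbol v\in\mathbb R^{dN}$, $\boldsymbol w\in\mathbb R^{dM}$, such that the initial kinetic energy $\frac12\int|\boldsymbol u|^2F_0(\boldsymbol u)\,d\boldsymbol u$ is finite. Let $f_t(\boldsymbol v)=\int_{\mathbb R^{dM}}F_t(\boldsymbol v,\boldsymbol w)\,d\boldsymbol w$ be the marginal of the Kac system, and $S(f|\gamma)=\int_{\mathbb R^{dN}}f\ln(f/\gamma)\,d\boldsymbol v$. Then for every $t\ge0$ the integrals $S(f_0|\gamma)$ and $S(f_t|\gamma)$ converge absolutely, and $$S(f_t|\gamma)\le\left[\frac{N}{N+M}+\frac{M}{N+M}\,e^{-\frac{\mu}{d}\frac{N+M}{M}t}\right]S(f_0|\gamma).$$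 -/

import Mathlib

open MeasureTheory

noncomputable section

namespace KacReservoir

/-- The velocity space `ℝ^d` of one particle, with the Euclidean norm. -/
abbrev Vel (d : ℕ) : Type := EuclideanSpace ℝ (Fin d)

/-- Master vectors `u = (u_i)` of particles with labels in `ι`, i.e. `ℝ^{d |ι|}`, with Lebesgue
measure. Squared lengths are always written out as `energySq` (the norm of a function type is
the supremum norm). -/
abbrev Config (ι : Type) (d : ℕ) : Type := ι → Vel d

/-- Labels of all particles: the `N` particles of the Kac system, then the `M` particles of the
heat reservoir. -/
abbrev Label (N M : ℕ) : Type := Fin N ⊕ Fin M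

/-- The unit sphere `S^{d-1}` of scattering angles. -/
abbrev Angle (d : ℕ) : Type := Metric.sphere (0 : Vel d) 1

section Basic

variable {ι : Type} [Fintype ι] {d : ℕ}

/-- The squared Euclidean length `|u|² = ∑ i, |u_i|²` of a master vector. -/
def energySq (u : Config ι d) : ℝ := ∑ i, ‖u i‖ ^ 2

/-- The Maxwellian `γ(u) = (β / 2π)^{d |ι| / 2} exp (-β |u|² / 2)`. -/
def maxwellian (β : ℝ) (u : Config ι d) : ℝ :=
  (β / (2 * Real.pi)) ^ (((d : ℝ) * (Fintype.card ι : ℝ)) / 2) *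
    Real.exp (-(β / 2) * energySq u)

/-- A probability density with respect to Lebesgue measure. -/
structure IsProbDensity (f : Config ι d → ℝ) : Prop where
  nonneg : ∀ᵐ v, 0 ≤ f v
  integrable : Integrable f
  integral_eq_one : ∫ v, f v = 1

/-- The unit vector of `ℝ^{d |ι|}` in the direction of the `a`-th velocity component of
particle `i`. -/
def unitVec [DecidableEq ι] (i : ι) (a : Fin d) : Config ι d :=
  Pi.single i (EuclideanSpace.single a (1 : ℝ))

/-- `G` is the weak partial derivative of `g` in the velocity component `a` of particle `i`. -/
def IsWeakPartial [DecidableEq ι] (i : ι) (a : Fin d) (g G : Config ι d → ℝ) : Prop :=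
  ∀ φ : Config ι d → ℝ, ContDiff ℝ (⊤ : ℕ∞) φ → HasCompactSupport φ →
    ∫ v, g v * fderiv ℝ φ v (unitVec i a) = -∫ v, G v * φ v

/-- The Sobolev space `H¹(ℝ^{d |ι|})`: square integrable, with square integrable weak first
partial derivatives. -/
def MemH1 [DecidableEq ι] (g : Config ι d → ℝ) : Prop :=
  MemLp g 2 ∧ ∀ (i : ι) (a : Fin d), ∃ G : Config ι d → ℝ, MemLp G 2 ∧ IsWeakPartial i a g G

/-- The integrand of the relative entropy (`0 ln 0 = 0`). -/
def entropyIntegrand (f g : Config ι d → ℝ) (v : Config ι d) : ℝ :=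
  f v * Real.log (f v / g v)

/-- The relative entropy `S(f|g) = ∫ f ln (f / g)`. -/
def relEntropy (f g : Config ι d → ℝ) : ℝ := ∫ v, entropyIntegrand f g v

/-- The kinetic energy `½ ∫ |u|² F(u) du` of a nonnegative density, possibly infinite. -/
def kineticEnergy (F : Config ι d → ℝ) : ENNReal :=
  ∫⁻ u, ENNReal.ofReal (2⁻¹ * energySq u * F u)

/-- The collision of the particles `i ≠ j` with scattering angle `σ`:
`u_i ↦ u_i - ⟨σ, u_i - u_j⟩ σ` and `u_j ↦ u_j + ⟨σ, u_i - u_j⟩ σ`. -/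
def collide [DecidableEq ι] (σ : Vel d) (i j : ι) (u : Config ι d) : Config ι d :=
  Function.update (Function.update u i (u i - inner ℝ σ (u i - u j) • σ))
    j (u j + inner ℝ σ (u i - u j) • σ)

/-- The pair collision operator `R_{ij} F (u) = ∫ F (M_σ^{ij} u) dρ(σ)`. -/
def pairCollision [DecidableEq ι] (ρ : Measure (Angle d)) (i j : ι) (F : Config ι d → ℝ)
    (u : Config ι d) : ℝ :=
  ∫ σ : Angle d, F (collide (σ : Vel d) i j u) ∂ρ

end Basic

/-- The symmetry condition `∫ σ ⊗ σ dρ(σ) = (1/d) Id`. -/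
def IsSymmetricAngleLaw {d : ℕ} (ρ : Measure (Angle d)) : Prop :=
  ∀ a b : Fin d, ∫ σ : Angle d, (σ : Vel d) a * (σ : Vel d) b ∂ρ = if a = b then 1 / (d : ℝ) else 0

section Reservoir

variable {N M d : ℕ}

/-- The time evolution operator
`λ_S/(N-1) ∑_{i<j≤N} (R_{ij}-1) + λ_R/(M-1) ∑_{N<i<j} (R_{ij}-1) + μ/M ∑_{i≤N<j} (R_{ij}-1)`.
For `N = 1` (or `M = 1`) the corresponding sum over pairs is empty. -/
def kacGenerator (ρ : Measure (Angle d)) (lamS lamR μ : ℝ) (F : Config (Label N M) d → ℝ)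
    (u : Config (Label N M) d) : ℝ :=
  lamS / ((N : ℝ) - 1) * ∑ i : Fin N, ∑ j ∈ Finset.Ioi i,
      (pairCollision ρ (Sum.inl i) (Sum.inl j) F u - F u)
    + lamR / ((M : ℝ) - 1) * ∑ i : Fin M, ∑ j ∈ Finset.Ioi i,
      (pairCollision ρ (Sum.inr i) (Sum.inr j) F u - F u)
    + μ / (M : ℝ) * ∑ i : Fin N, ∑ j : Fin M,
      (pairCollision ρ (Sum.inl i) (Sum.inr j) F u - F u)

/-- `(F_t)_{t ≥ 0}` solves the Kac master equation `dF_t/dt = 𝓛 F_t` in `L¹(ℝ^{d(N+M)})`: at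
every `t ≥ 0` the `L¹`-valued map `F` is differentiable (one-sided at `0`), and its derivative is
the class of `𝓛 F_t`. -/
def IsMasterSolution (ρ : Measure (Angle d)) (lamS lamR μ : ℝ)
    (F : ℝ → Lp ℝ 1 (volume : Measure (Config (Label N M) d))) : Prop :=
  ∀ t : ℝ, 0 ≤ t → ∃ G : Lp ℝ 1 (volume : Measure (Config (Label N M) d)),
    (G : Config (Label N M) d → ℝ) =ᵐ[volume] kacGenerator ρ lamS lamR μ (F t) ∧
      HasDerivWithinAt F G (Set.Ici 0) t

/-- The marginal of the Kac system: `f(v) = ∫ F(v, w) dw`. -/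
def kacMarginal (F : Config (Label N M) d → ℝ) (v : Config (Fin N) d) : ℝ :=
  ∫ w : Config (Fin M) d, F (Sum.elim v w)

/-- The product state `F(v, w) = f(v) γ(w)`. -/
def productState (β : ℝ) (f : Config (Fin N) d → ℝ) (u : Config (Label N M) d) : ℝ :=
  f (fun i => u (Sum.inl i)) * maxwellian β (fun j : Fin M => u (Sum.inr j))

end Reservoir

end KacReservoir

end

/-! The master equation reads F' = Λ (Q - 1) F, where Λ is the total collision rate and Q averages
over one random collision. So F_t is the average of Q^k F_0 with Poisson weights of mean Λt
(`hasSum_of_hasDerivWithinAt`). A collision is an energy preserving linear map, hence Q^k averages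
over random energy preserving maps T. Let A and B be the blocks of T that send the system,
respectively the reservoir, into the system. Since γ is invariant under T, the initial state γ(u)
h(v) has after k collisions the system density γ(v) E h(A v + B w), where w is Maxwellian
(`marginalL1_averageL1_ae_eq`).

The heart is an entropy inequality (`lintegral_klFun_mixture_le`): if A v + B w is Maxwellian for
independent Maxwellian v and w, and E A Aᵀ = c, then the entropy of E h(A v + B w) is at most c
times that of h. This averaging commutes with the Ornstein-Uhlenbeck semigroup (`mixture_mehler`),
so de Bruijn's identity reduces the claim to Fisher informations. The gradient of the average is E
Aᵀ∇h. Joint convexity of |x|²/y moves the square inside the expectation, and since A v + B w is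
independent of the choice of T, the matrix A Aᵀ can be averaged separately, which gives the factor c
(`fisher_mixture_le`). Clipping and mollification remove the regularity assumptions.

The constant comes from following the expected squared length of the system part of a linear
functional ℓ. It obeys an affine recursion with ratio q = `stepFactor` and fixed point |ℓ|² N/(N+M),
so after k collisions c = q^k + (1 - q^k) N/(N+M) (`exists_average_eq_pow`). Entropy is convex and
lower semicontinuous (`lintegral_klFun_le_of_hasSum`), so these constants may be averaged against
the Poisson weights, and Λ(1 - q) = μ(N+M)/(dM) gives the stated rate.

The initial entropy is finite because √f₀ ∈ H¹ puts f₀ in some L^p with p > 1, which bounds f₀ ln f₀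
from above, while the energy bounds -f₀ ln γ. Entropies are written with `klFun` x = x ln x + 1 - x
≥ 0, so that lower integrals and Fatou's lemma apply without integrability conditions. -/

namespace KacReservoir

open Real InformationTheory Filter Topology ENNReal

/-! ### Maxwellian measures: moments, integration by parts, invariance under energy preserving maps
and rotations. -/

section Gaussian

variable {ι κ : Type} [Fintype ι] [Fintype κ] {d : ℕ} {β : ℝ}

lemma energySq_nonneg (u : Config ι d) : 0 ≤ energySq u :=
  Finset.sum_nonneg fun _ _ => sq_nonneg _

lemma continuous_energySq : Continuous (energySq : Config ι d → ℝ) := by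
  unfold energySq; fun_prop

lemma norm_sq_le_energySq (u : Config ι d) : ‖u‖ ^ 2 ≤ energySq u := by
  have h : ‖u‖ ≤ √(energySq u) := by
    refine (pi_norm_le_iff_of_nonneg (sqrt_nonneg _)).2 fun i => ?_
    refine le_sqrt_of_sq_le ?_
    exact Finset.single_le_sum (f := fun i => ‖u i‖ ^ 2) (fun _ _ => sq_nonneg _)
      (Finset.mem_univ i)
  calc ‖u‖ ^ 2 ≤ √(energySq u) ^ 2 := by gcongr
    _ = energySq u := sq_sqrt (energySq_nonneg u)

lemma energySq_eq_sum (u : Config ι d) : energySq u = ∑ p : ι × Fin d, u p.1 p.2 ^ 2 := by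
  rw [Fintype.sum_prod_type]
  exact Finset.sum_congr rfl fun i _ => by rw [EuclideanSpace.real_norm_sq_eq]

lemma maxwellian_nonneg [hβ : Fact (0 < β)] (u : Config ι d) : 0 ≤ maxwellian β u := by
  have := hβ.out
  unfold maxwellian; positivity

lemma maxwellian_pos [hβ : Fact (0 < β)] (u : Config ι d) : 0 < maxwellian β u := by
  have := hβ.out
  unfold maxwellian; positivity

lemma continuous_maxwellian : Continuous (maxwellian β : Config ι d → ℝ) := by
  unfold maxwellian
  have := continuous_energySq (ι := ι) (d := d)
  fun_prop

lemma exp_neg_energySq_eq_prod (b : ℝ) (u : Config ι d) :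
    exp (-b * energySq u) = ∏ i, exp (-b * ‖u i‖ ^ 2) := by
  rw [energySq, Finset.mul_sum, Real.exp_sum]

lemma integral_exp_neg_energySq {b : ℝ} (hb : 0 < b) :
    ∫ u : Config ι d, exp (-b * energySq u) = (π / b) ^ ((d : ℝ) * (Fintype.card ι : ℝ) / 2) := by
  simp_rw [exp_neg_energySq_eq_prod]
  rw [integral_fintype_prod_volume_eq_prod (fun (_ : ι) (x : Vel d) => exp (-b * ‖x‖ ^ 2))]
  simp only [GaussianFourier.integral_rexp_neg_mul_sq_norm hb, finrank_euclideanSpace,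
    Fintype.card_fin, Finset.prod_const, Finset.card_univ]
  rw [← Real.rpow_natCast, ← Real.rpow_mul (by positivity)]
  ring_nf

lemma integrable_exp_neg_energySq {b : ℝ} (hb : 0 < b) :
    Integrable fun u : Config ι d => exp (-b * energySq u) := by
  refine Integrable.of_integral_ne_zero ?_
  rw [integral_exp_neg_energySq hb]
  positivity

lemma integrable_maxwellian [hβ : Fact (0 < β)] :
    Integrable (maxwellian β : Config ι d → ℝ) :=
  (integrable_exp_neg_energySq (half_pos hβ.out)).const_mul _

lemma integral_maxwellian [hβ : Fact (0 < β)] :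
    ∫ u : Config ι d, maxwellian β u = 1 := by
  have h := hβ.out
  unfold maxwellian
  rw [integral_const_mul, integral_exp_neg_energySq (half_pos h),
    ← Real.mul_rpow (by positivity) (by positivity)]
  have : β / (2 * π) * (π / (β / 2)) = 1 := by field_simp
  rw [this, Real.one_rpow]

variable (ι d β) in
/-- The Maxwellian as a measure. -/
noncomputable def maxwellMeasure : Measure (Config ι d) :=
  volume.withDensity fun u => ENNReal.ofReal (maxwellian β u)

lemma measurable_ofReal_maxwellian :
    Measurable fun u : Config ι d => ENNReal.ofReal (maxwellian β u) :=
  continuous_maxwellian.measurable.ennreal_ofReal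

instance [Fact (0 < β)] : IsProbabilityMeasure (maxwellMeasure ι d β) := by
  constructor
  rw [maxwellMeasure, withDensity_apply _ MeasurableSet.univ, Measure.restrict_univ,
    ← ofReal_integral_eq_lintegral_ofReal integrable_maxwellian
      (ae_of_all _ maxwellian_nonneg), integral_maxwellian, ENNReal.ofReal_one]

lemma maxwellMeasure_absolutelyContinuous : maxwellMeasure ι d β ≪ volume :=
  withDensity_absolutelyContinuous _ _

lemma absolutelyContinuous_maxwellMeasure [Fact (0 < β)] : volume ≪ maxwellMeasure ι d β :=
  withDensity_absolutelyContinuous' measurable_ofReal_maxwellian.aemeasurable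
    (ae_of_all _ fun u => by simpa using maxwellian_pos u)

lemma integral_maxwellMeasure [Fact (0 < β)] (g : Config ι d → ℝ) :
    ∫ u, g u ∂(maxwellMeasure ι d β) = ∫ u, maxwellian β u * g u := by
  rw [maxwellMeasure, integral_withDensity_eq_integral_toReal_smul measurable_ofReal_maxwellian
    (ae_of_all _ fun _ => ENNReal.ofReal_lt_top)]
  simp only [ENNReal.toReal_ofReal (maxwellian_nonneg _), smul_eq_mul]

lemma integrable_maxwellMeasure_iff [Fact (0 < β)] {g : Config ι d → ℝ} :
    Integrable g (maxwellMeasure ι d β) ↔ Integrable fun u => maxwellian β u * g u := by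
  rw [maxwellMeasure, integrable_withDensity_iff_integrable_smul' measurable_ofReal_maxwellian
    (ae_of_all _ fun _ => ENNReal.ofReal_lt_top)]
  simp only [ENNReal.toReal_ofReal (maxwellian_nonneg _), smul_eq_mul]

lemma lintegral_maxwellMeasure (g : Config ι d → ℝ≥0∞) :
    ∫⁻ u, g u ∂(maxwellMeasure ι d β) = ∫⁻ u, ENNReal.ofReal (maxwellian β u) * g u := by
  rw [maxwellMeasure, lintegral_withDensity_eq_lintegral_mul_non_measurable _
    measurable_ofReal_maxwellian (ae_of_all _ fun _ => ENNReal.ofReal_lt_top)]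
  rfl

lemma integrable_norm_maxwellMeasure [hβ : Fact (0 < β)] :
    Integrable (fun u : Config ι d => ‖u‖) (maxwellMeasure ι d β) := by
  have hb := hβ.out
  rw [integrable_maxwellMeasure_iff]
  refine ((integrable_exp_neg_energySq (ι := ι) (d := d) (b := β / 4) (by positivity)).const_mul
    ((β / (2 * π)) ^ (((d : ℝ) * (Fintype.card ι : ℝ)) / 2) * (1 + 4 / β))).mono'
    (continuous_maxwellian.mul continuous_norm).aestronglyMeasurable (ae_of_all _ fun u => ?_)
  rw [norm_mul, norm_norm, norm_of_nonneg (maxwellian_nonneg u), maxwellian, mul_assoc, mul_assoc]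
  refine mul_le_mul_of_nonneg_left ?_ (by positivity)
  have h1 : ‖u‖ ≤ 1 + energySq u := by
    nlinarith [norm_sq_le_energySq u, sq_nonneg (‖u‖ - 1)]
  have h2 : 1 + energySq u ≤ (1 + 4 / β) * exp (β / 4 * energySq u) := by
    have h3 := add_one_le_exp (β / 4 * energySq u)
    have h4 : 0 ≤ β / 4 * energySq u := mul_nonneg (by positivity) (energySq_nonneg u)
    have h5 : energySq u = 4 / β * (β / 4 * energySq u) := by field_simp
    have h6 : 0 < 4 / β := by positivity
    nlinarith
  calc exp (-(β / 2) * energySq u) * ‖u‖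
      ≤ exp (-(β / 2) * energySq u) * ((1 + 4 / β) * exp (β / 4 * energySq u)) := by
        gcongr; exact h1.trans h2
    _ = (1 + 4 / β) * (exp (-(β / 2) * energySq u) * exp (β / 4 * energySq u)) := by ring
    _ = _ := by rw [← Real.exp_add]; congr 2; ring

lemma sum_smul_unitVec [DecidableEq ι] (u : Config ι d) :
    ∑ p : ι × Fin d, u p.1 p.2 • unitVec p.1 p.2 = u := by
  funext i
  ext a
  rw [Fintype.sum_prod_type]
  simp [unitVec, Finset.sum_apply, Pi.single_apply, apply_ite]

lemma map_eq_sum [DecidableEq ι] (ℓ : Config ι d →L[ℝ] ℝ) (u : Config ι d) :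
    ℓ u = ∑ p : ι × Fin d, u p.1 p.2 * ℓ (unitVec p.1 p.2) := by
  conv_lhs => rw [← sum_smul_unitVec u]
  simp

lemma norm_unitVec_le [DecidableEq ι] (i : ι) (a : Fin d) :
    ‖(unitVec i a : Config ι d)‖ ≤ 1 := by
  refine (pi_norm_le_iff_of_nonneg zero_le_one).2 fun j => ?_
  by_cases hj : j = i
  · subst hj; simp [unitVec]
  · simp [unitVec, hj]

lemma hasFDerivAt_energySq (u : Config ι d) :
    HasFDerivAt (energySq : Config ι d → ℝ)
      (∑ p : ι × Fin d, (2 * u p.1 p.2) •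
        ((EuclideanSpace.proj p.2 : Vel d →L[ℝ] ℝ).comp (ContinuousLinearMap.proj p.1))) u := by
  have : (energySq : Config ι d → ℝ) = fun u => ∑ p : ι × Fin d, u p.1 p.2 ^ 2 :=
    funext energySq_eq_sum
  rw [this]
  refine HasFDerivAt.fun_sum fun p _ => ?_
  have h : HasFDerivAt (fun u : Config ι d => u p.1 p.2)
      ((EuclideanSpace.proj p.2 : Vel d →L[ℝ] ℝ).comp (ContinuousLinearMap.proj p.1)) u :=
    ((EuclideanSpace.proj p.2 : Vel d →L[ℝ] ℝ).comp
      (ContinuousLinearMap.proj (R := ℝ) (φ := fun _ : ι => Vel d) p.1)).hasFDerivAt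
  simpa using h.pow 2

lemma differentiable_maxwellian : Differentiable ℝ (maxwellian β : Config ι d → ℝ) := by
  intro u
  unfold maxwellian
  have := (hasFDerivAt_energySq u).differentiableAt
  fun_prop

lemma fderiv_maxwellian_unitVec [DecidableEq ι] (u : Config ι d) (i : ι) (a : Fin d) :
    fderiv ℝ (maxwellian β : Config ι d → ℝ) u (unitVec i a) = -β * (u i a * maxwellian β u) := by
  have h := ((((hasFDerivAt_energySq u).const_mul (-(β / 2))).exp).const_mul
    ((β / (2 * π)) ^ (((d : ℝ) * (Fintype.card ι : ℝ)) / 2))).fderiv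
  unfold maxwellian
  rw [h]
  simp only [smul_apply, sum_apply,
    ContinuousLinearMap.comp_apply, ContinuousLinearMap.proj_apply, smul_eq_mul,
    PiLp.proj_apply]
  have h2 : ∑ p : ι × Fin d, 2 * u p.1 p.2 * (unitVec i a : Config ι d) p.1 p.2 = 2 * u i a := by
    rw [Fintype.sum_prod_type, Finset.sum_eq_single i, Finset.sum_eq_single a]
    · simp [unitVec]
    · intro b _ hb; simp [unitVec, hb]
    · simp
    · intro j _ hj; simp [unitVec, hj]
    · simp
  rw [h2]; ring

lemma abs_coord_le (u : Config ι d) (i : ι) (a : Fin d) : |u i a| ≤ ‖u‖ :=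
  (PiLp.norm_apply_le (u i) a).trans (norm_le_pi_norm u i)

/-- Gaussian integration by parts. -/
lemma integral_coord_mul [DecidableEq ι] [hβ : Fact (0 < β)] {ψ : Config ι d → ℝ}
    (hψ : Differentiable ℝ ψ) {C C' : ℝ} (hC : ∀ u, |ψ u| ≤ C) (i : ι) (a : Fin d)
    (hC' : ∀ u, |fderiv ℝ ψ u (unitVec i a)| ≤ C') :
    ∫ u, u i a * ψ u ∂(maxwellMeasure ι d β) =
      β⁻¹ * ∫ u, fderiv ℝ ψ u (unitVec i a) ∂(maxwellMeasure ι d β) := by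
  have hb := hβ.out
  have hmul : Integrable (fun u : Config ι d => u i a * ψ u) (maxwellMeasure ι d β) := by
    refine (integrable_norm_maxwellMeasure.mul_const C).mono' ?_ (ae_of_all _ fun u => ?_)
    · have : Continuous fun u : Config ι d => u i a := by fun_prop
      exact (this.mul hψ.continuous).aestronglyMeasurable
    · rw [norm_mul]
      exact mul_le_mul (abs_coord_le u i a) (hC u) (norm_nonneg _) (norm_nonneg _)
  have hd : Integrable (fun u : Config ι d => fderiv ℝ ψ u (unitVec i a))
      (maxwellMeasure ι d β) :=
    (integrable_const C').mono' (measurable_fderiv_apply_const ℝ ψ _).aestronglyMeasurable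
      (ae_of_all _ hC')
  have hψi : Integrable ψ (maxwellMeasure ι d β) :=
    (integrable_const C).mono' hψ.continuous.aestronglyMeasurable (ae_of_all _ hC)
  rw [integrable_maxwellMeasure_iff] at hmul hd hψi
  have key := integral_mul_fderiv_eq_neg_fderiv_mul_of_integrable (μ := volume)
    (f := ψ) (g := maxwellian β) (v := unitVec i a) (by simpa only [mul_comm] using hd)
    (by
      simp_rw [fderiv_maxwellian_unitVec]
      refine (hmul.const_mul (-β)).congr (ae_of_all _ fun u => ?_)
      ring)
    (by simpa only [mul_comm] using hψi) (fun x _ => hψ x)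
    (fun x _ => differentiable_maxwellian x)
  rw [integral_maxwellMeasure, integral_maxwellMeasure]
  simp_rw [fderiv_maxwellian_unitVec] at key
  have e1 : ∫ u : Config ι d, ψ u * (-β * (u i a * maxwellian β u)) =
      -β * ∫ u : Config ι d, maxwellian β u * (u i a * ψ u) := by
    rw [← integral_const_mul]; congr 1; ext u; ring
  have e2 : ∫ u : Config ι d, maxwellian β u * fderiv ℝ ψ u (unitVec i a) =
      ∫ u : Config ι d, fderiv ℝ ψ u (unitVec i a) * maxwellian β u := by
    congr 1; ext u; ring
  rw [e1] at key
  rw [e2, eq_inv_mul_iff_mul_eq₀ hb.ne']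
  linarith

/-- A linear automorphism of a finite-dimensional space that preserves some function of finite
positive integral preserves Lebesgue measure. -/
lemma measurePreserving_of_comp_eq {E : Type*} [NormedAddCommGroup E] [NormedSpace ℝ E]
    [MeasurableSpace E] [BorelSpace E] [FiniteDimensional ℝ E] (μ : Measure E)
    [μ.IsAddHaarMeasure] (L : E ≃L[ℝ] E) {g : E → ℝ≥0∞} (hg : Measurable g)
    (hg0 : ∫⁻ x, g x ∂μ ≠ 0) (hg1 : ∫⁻ x, g x ∂μ ≠ ∞) (hL : ∀ x, g (L x) = g x) :
    MeasurePreserving L μ μ := by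
  have hdet : LinearMap.det (L : E →ₗ[ℝ] E) ≠ 0 :=
    (LinearEquiv.isUnit_det' L.toLinearEquiv).ne_zero
  have hmap := Measure.map_linearMap_addHaar_eq_smul_addHaar μ hdet
  have hcoe : ⇑(L : E →ₗ[ℝ] E) = L := rfl
  rw [hcoe] at hmap
  refine ⟨L.continuous.measurable, ?_⟩
  have h1 : ∫⁻ x, g x ∂(Measure.map L μ) = ∫⁻ x, g x ∂μ := by
    rw [lintegral_map hg L.continuous.measurable]
    simp [hL]
  rw [hmap, lintegral_smul_measure, smul_eq_mul] at h1
  -- The pushforward multiplies Haar measure by |det|⁻¹, and comparing the integrals of the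
  -- invariant function `g` forces this factor to be 1.
  have h2 : ENNReal.ofReal |(LinearMap.det (L : E →ₗ[ℝ] E))⁻¹| = 1 := by
    have := (ENNReal.mul_eq_right hg0 hg1).1 h1
    exact this
  rw [hmap, h2, one_smul]

lemma lintegral_ofReal_maxwellian [Fact (0 < β)] :
    ∫⁻ u : Config ι d, ENNReal.ofReal (maxwellian β u) = 1 := by
  have := measure_univ (μ := maxwellMeasure ι d β)
  rwa [maxwellMeasure, withDensity_apply _ MeasurableSet.univ, Measure.restrict_univ] at this

lemma measurePreserving_withDensity {E F : Type*} [MeasurableSpace E] [MeasurableSpace F]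
    {μ : Measure E} {ν : Measure F} {T : E → F} (hT : MeasurePreserving T μ ν) {g : F → ℝ≥0∞}
    (hg : Measurable g) :
    MeasurePreserving T (μ.withDensity (g ∘ T)) (ν.withDensity g) := by
  refine ⟨hT.measurable, ?_⟩
  ext s hs
  rw [Measure.map_apply hT.measurable hs, withDensity_apply _ hs,
    withDensity_apply _ (hT.measurable hs), ← hT.setLIntegral_comp_preimage hs hg]
  rfl

/-- Energy preserving linear automorphisms preserve Lebesgue measure. -/
lemma measurePreserving_volume_of_energySq (L : Config ι d ≃L[ℝ] Config ι d)
    (hL : ∀ u, energySq (L u) = energySq u) : MeasurePreserving L volume volume := by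
  have : Fact ((0 : ℝ) < 1) := ⟨one_pos⟩
  -- The invariant function is the Maxwellian with parameter 1, whose integral is 1.
  refine measurePreserving_of_comp_eq volume L
    (measurable_ofReal_maxwellian (ι := ι) (d := d) (β := 1)) ?_ ?_ ?_
  · simp [lintegral_ofReal_maxwellian]
  · simp [lintegral_ofReal_maxwellian]
  · intro u; simp [maxwellian, hL]

lemma measurePreserving_maxwellMeasure_of_energySq {T : Config ι d → Config ι d}
    (hT : MeasurePreserving T volume volume) (hE : ∀ u, energySq (T u) = energySq u) :
    MeasurePreserving T (maxwellMeasure ι d β) (maxwellMeasure ι d β) := by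
  have h := measurePreserving_withDensity hT (measurable_ofReal_maxwellian (β := β))
  have e : (fun u : Config ι d => ENNReal.ofReal (maxwellian β u)) ∘ T =
      fun u => ENNReal.ofReal (maxwellian β u) := by
    funext u; simp [maxwellian, hE]
  rwa [e] at h

lemma prod_maxwellMeasure [Fact (0 < β)] :
    (maxwellMeasure ι d β).prod (maxwellMeasure κ d β) =
      ((volume : Measure (Config ι d)).prod volume).withDensity
        fun p => ENNReal.ofReal (maxwellian β p.1 * maxwellian β p.2) := by
  rw [maxwellMeasure, maxwellMeasure, prod_withDensity measurable_ofReal_maxwellian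
    measurable_ofReal_maxwellian]
  congr 1
  funext p
  rw [ENNReal.ofReal_mul (maxwellian_nonneg _)]

/-- The rotation by the angle `θ` in the product of two copies of the same space. -/
noncomputable def rotate {E : Type*} [NormedAddCommGroup E] [NormedSpace ℝ E] (θ : ℝ) :
    (E × E) ≃L[ℝ] (E × E) :=
  ContinuousLinearEquiv.equivOfInverse
    ((cos θ • ContinuousLinearMap.fst ℝ E E + sin θ • ContinuousLinearMap.snd ℝ E E).prod
      (-sin θ • ContinuousLinearMap.fst ℝ E E + cos θ • ContinuousLinearMap.snd ℝ E E))
    ((cos θ • ContinuousLinearMap.fst ℝ E E - sin θ • ContinuousLinearMap.snd ℝ E E).prod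
      (sin θ • ContinuousLinearMap.fst ℝ E E + cos θ • ContinuousLinearMap.snd ℝ E E))
    (fun p => by
      have h := sin_sq_add_cos_sq θ
      ext
      · simp only [ContinuousLinearMap.prod_apply, sub_apply,
          add_apply, smul_apply,
          ContinuousLinearMap.coe_fst', ContinuousLinearMap.coe_snd']
        linear_combination (norm := module) h • p.1
      · simp only [ContinuousLinearMap.prod_apply, sub_apply,
          add_apply, smul_apply,
          ContinuousLinearMap.coe_fst', ContinuousLinearMap.coe_snd']
        linear_combination (norm := module) h • p.2)
    (fun p => by
      have h := sin_sq_add_cos_sq θ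
      ext
      · simp only [ContinuousLinearMap.prod_apply, sub_apply,
          add_apply, smul_apply,
          ContinuousLinearMap.coe_fst', ContinuousLinearMap.coe_snd']
        linear_combination (norm := module) h • p.1
      · simp only [ContinuousLinearMap.prod_apply, sub_apply,
          add_apply, smul_apply,
          ContinuousLinearMap.coe_fst', ContinuousLinearMap.coe_snd']
        linear_combination (norm := module) h • p.2)

lemma rotate_apply {E : Type*} [NormedAddCommGroup E] [NormedSpace ℝ E] (θ : ℝ) (p : E × E) :
    rotate θ p = (cos θ • p.1 + sin θ • p.2, -sin θ • p.1 + cos θ • p.2) := rfl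

lemma rotate_symm_apply {E : Type*} [NormedAddCommGroup E] [NormedSpace ℝ E] (θ : ℝ)
    (p : E × E) :
    (rotate θ).symm p = (cos θ • p.1 - sin θ • p.2, sin θ • p.1 + cos θ • p.2) := rfl

lemma energySq_rotate (θ : ℝ) (p : Config ι d × Config ι d) :
    energySq (rotate θ p).1 + energySq (rotate θ p).2 = energySq p.1 + energySq p.2 := by
  simp only [energySq_eq_sum, rotate_apply, ← Finset.sum_add_distrib]
  refine Finset.sum_congr rfl fun q _ => ?_
  simp only [Pi.add_apply, Pi.smul_apply, PiLp.add_apply, PiLp.smul_apply, smul_eq_mul]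
  linear_combination (p.1 q.1 q.2 ^ 2 + p.2 q.1 q.2 ^ 2) * sin_sq_add_cos_sq θ

lemma maxwellian_mul_maxwellian (u : Config ι d) (w : Config κ d) :
    maxwellian β u * maxwellian β w =
      (β / (2 * π)) ^ (((d : ℝ) * (Fintype.card ι : ℝ)) / 2) *
      (β / (2 * π)) ^ (((d : ℝ) * (Fintype.card κ : ℝ)) / 2) *
        exp (-(β / 2) * (energySq u + energySq w)) := by
  unfold maxwellian
  rw [mul_add, Real.exp_add]; ring

/-- The density of the product depends only on the sum of the two energies, which a rotation keeps.
In particular cos θ v + sin θ z is Maxwellian for independent Maxwellian v and z. -/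
lemma measurePreserving_rotate [Fact (0 < β)] (θ : ℝ) :
    MeasurePreserving (rotate θ : (Config ι d × Config ι d) ≃L[ℝ] (Config ι d × Config ι d))
      ((maxwellMeasure ι d β).prod (maxwellMeasure ι d β))
      ((maxwellMeasure ι d β).prod (maxwellMeasure ι d β)) := by
  set g : Config ι d × Config ι d → ℝ≥0∞ :=
    fun p => ENNReal.ofReal (maxwellian β p.1 * maxwellian β p.2) with hg
  have hgm : Measurable g := by
    have := continuous_maxwellian (ι := ι) (d := d) (β := β)
    exact (Continuous.mul (by fun_prop) (by fun_prop)).measurable.ennreal_ofReal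
  have hgL : ∀ p, g (rotate θ p) = g p := fun p => by
    simp only [hg, maxwellian_mul_maxwellian, energySq_rotate]
  have hint : ∫⁻ p, g p ∂((volume : Measure (Config ι d)).prod volume) = 1 := by
    have := measure_univ (μ := (maxwellMeasure ι d β).prod (maxwellMeasure ι d β))
    rwa [prod_maxwellMeasure, withDensity_apply _ MeasurableSet.univ, Measure.restrict_univ]
      at this
  have : ((volume : Measure (Config ι d)).prod
      (volume : Measure (Config ι d))).IsAddHaarMeasure :=
    Measure.prod.instIsAddHaarMeasure _ _
  have h1 := measurePreserving_of_comp_eq ((volume : Measure (Config ι d)).prod volume)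
    (rotate θ) hgm (by simp [hint]) (by simp [hint]) hgL
  have h2 := measurePreserving_withDensity h1 hgm
  rw [prod_maxwellMeasure]
  have e : g ∘ (rotate θ) = g := funext hgL
  rwa [e] at h2

end Gaussian

end KacReservoir

namespace KacReservoir

open Real InformationTheory Filter Topology ENNReal

/-! ### The Ornstein-Uhlenbeck semigroup and de Bruijn's identity. -/

section Mehler

variable {ι κ : Type} [Fintype ι] [Fintype κ] {d : ℕ} {β : ℝ}

/-- Continuously differentiable functions with bounded derivative, bounded and bounded away
from zero. -/
structure IsNice (h : Config ι d → ℝ) : Prop where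
  contDiff : ContDiff ℝ 1 h
  exists_bounds : ∃ a b, 0 < a ∧ ∀ x, a ≤ h x ∧ h x ≤ b
  exists_fderiv_le : ∃ C, ∀ x, ‖fderiv ℝ h x‖ ≤ C

lemma IsNice.pos {h : Config ι d → ℝ} (hh : IsNice h) (x : Config ι d) : 0 < h x := by
  obtain ⟨a, b, ha, hab⟩ := hh.exists_bounds
  exact ha.trans_le (hab x).1

lemma IsNice.differentiable {h : Config ι d → ℝ} (hh : IsNice h) : Differentiable ℝ h :=
  hh.contDiff.differentiable one_ne_zero

lemma IsNice.continuous_fderiv {h : Config ι d → ℝ} (hh : IsNice h) :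
    Continuous (fderiv ℝ h) :=
  hh.contDiff.continuous_fderiv one_ne_zero

lemma IsNice.exists_abs_le {h : Config ι d → ℝ} (hh : IsNice h) : ∃ b, ∀ x, |h x| ≤ b := by
  obtain ⟨a, b, ha, hab⟩ := hh.exists_bounds
  exact ⟨b, fun x => abs_le.2 ⟨by linarith [hab x], (hab x).2⟩⟩

lemma IsNice.exists_abs_log_le {h : Config ι d → ℝ} (hh : IsNice h) :
    ∃ L, ∀ x, |log (h x)| ≤ L := by
  obtain ⟨a, b, ha, hab⟩ := hh.exists_bounds
  refine ⟨max |log a| |log b|, fun x => abs_le_max_abs_abs ?_ ?_⟩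
  · exact log_le_log ha (hab x).1
  · exact log_le_log (hh.pos x) (hab x).2

lemma IsNice.exists_abs_klFun_le {h : Config ι d → ℝ} (hh : IsNice h) :
    ∃ L, ∀ x, |klFun (h x)| ≤ L := by
  obtain ⟨L, hL⟩ := hh.exists_abs_log_le
  obtain ⟨b, hb⟩ := hh.exists_abs_le
  refine ⟨b * L + 1 + b, fun x => ?_⟩
  have h1 : |h x * log (h x)| ≤ b * L := by
    rw [abs_mul]
    exact mul_le_mul (hb x) (hL x) (abs_nonneg _) ((abs_nonneg _).trans (hb x))
  have h2 := hb x
  rw [klFun_apply]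
  rw [abs_le] at *
  constructor <;> linarith

/-- Random linear maps are only assumed measurable vector by vector. In finite dimension the
finitely many coefficients determine the functional and make it measurable for the operator norm. -/
lemma aestronglyMeasurable_clm [DecidableEq ι] {X : Type*} [MeasurableSpace X] {τ : Measure X}
    {f : X → Config ι d →L[ℝ] ℝ}
    (hf : ∀ p : ι × Fin d, AEStronglyMeasurable (fun x => f x (unitVec p.1 p.2)) τ) :
    AEStronglyMeasurable f τ := by
  have : f = fun x => ∑ p : ι × Fin d, f x (unitVec p.1 p.2) •
      ((EuclideanSpace.proj p.2 : Vel d →L[ℝ] ℝ).comp (ContinuousLinearMap.proj p.1)) := by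
    funext x
    ext u
    rw [map_eq_sum]
    simp [mul_comm]
  rw [this]
  exact Finset.aestronglyMeasurable_fun_sum _ fun p _ => (hf p).smul_const _

section Average

variable {X : Type*} [MeasurableSpace X] {τ : Measure X} [IsProbabilityMeasure τ]
  {A : X → Config ι d →L[ℝ] Config ι d} {b : X → Config ι d} {C : ℝ} {h : Config ι d → ℝ}

/-- The average of `h` over random affine maps. -/
noncomputable def affineAverage (τ : Measure X) (A : X → Config ι d →L[ℝ] Config ι d)
    (b : X → Config ι d) (h : Config ι d → ℝ) (v : Config ι d) : ℝ :=
  ∫ x, h (A x v + b x) ∂τ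

lemma aestronglyMeasurable_fderiv_comp (hh : IsNice h) (hA : ∀ v, Measurable fun x => A x v)
    (hb : Measurable b) (v : Config ι d) :
    AEStronglyMeasurable (fun x => (fderiv ℝ h (A x v + b x)).comp (A x)) τ := by
  classical
  refine aestronglyMeasurable_clm fun p => ?_
  have h1 : Measurable fun x => (A x v + b x, A x (unitVec p.1 p.2)) :=
    ((hA v).add hb).prodMk (hA _)
  have h2 : Continuous fun q : Config ι d × Config ι d => fderiv ℝ h q.1 q.2 :=
    (hh.continuous_fderiv.comp continuous_fst).clm_apply continuous_snd
  exact (h2.measurable.comp h1).aestronglyMeasurable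

lemma norm_fderiv_comp_le {K : ℝ} (hK : ∀ x, ‖fderiv ℝ h x‖ ≤ K) (hC : ∀ x, ‖A x‖ ≤ C)
    (v : Config ι d) (x : X) : ‖(fderiv ℝ h (A x v + b x)).comp (A x)‖ ≤ K * C :=
  (ContinuousLinearMap.opNorm_comp_le _ _).trans
    (mul_le_mul (hK _) (hC _) (norm_nonneg _) ((norm_nonneg _).trans (hK 0)))

lemma measurable_comp_affine (hh : IsNice h) (hA : ∀ v, Measurable fun x => A x v)
    (hb : Measurable b) (v : Config ι d) : Measurable fun x => h (A x v + b x) :=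
  hh.contDiff.continuous.measurable.comp ((hA v).add hb)

lemma integrable_comp_affine (hh : IsNice h) (hA : ∀ v, Measurable fun x => A x v)
    (hb : Measurable b) (v : Config ι d) : Integrable (fun x => h (A x v + b x)) τ := by
  obtain ⟨M, hM⟩ := hh.exists_abs_le
  exact (integrable_const M).mono' (measurable_comp_affine hh hA hb v).aestronglyMeasurable
    (ae_of_all _ fun x => hM _)

/-- Differentiation under the integral, with a constant as dominating function. It serves both
`mehler` and `mixture`, which are averages over random affine maps. -/
lemma hasFDerivAt_affineAverage (hh : IsNice h) (hA : ∀ v, Measurable fun x => A x v)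
    (hb : Measurable b) (hC : ∀ x, ‖A x‖ ≤ C) (v : Config ι d) :
    HasFDerivAt (affineAverage τ A b h)
      (∫ x, (fderiv ℝ h (A x v + b x)).comp (A x) ∂τ) v := by
  obtain ⟨K, hK⟩ := hh.exists_fderiv_le
  refine hasFDerivAt_integral_of_dominated_of_fderiv_le (bound := fun _ => K * C)
    (F' := fun v x => (fderiv ℝ h (A x v + b x)).comp (A x)) univ_mem
    (Eventually.of_forall fun v => (measurable_comp_affine hh hA hb v).aestronglyMeasurable)
    (integrable_comp_affine hh hA hb v) (aestronglyMeasurable_fderiv_comp hh hA hb v)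
    (ae_of_all _ fun x v _ => norm_fderiv_comp_le hK hC v x) (integrable_const _)
    (ae_of_all _ fun x v _ => ?_)
  exact (hh.differentiable _).hasFDerivAt.comp v ((A x).hasFDerivAt.add_const (b x))

lemma fderiv_affineAverage_apply (hh : IsNice h) (hA : ∀ v, Measurable fun x => A x v)
    (hb : Measurable b) (hC : ∀ x, ‖A x‖ ≤ C) (v e : Config ι d) :
    fderiv ℝ (affineAverage τ A b h) v e = ∫ x, fderiv ℝ h (A x v + b x) (A x e) ∂τ := by
  obtain ⟨K, hK⟩ := hh.exists_fderiv_le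
  rw [(hasFDerivAt_affineAverage hh hA hb hC v).fderiv, ContinuousLinearMap.integral_apply]
  · rfl
  · exact (integrable_const (K * C)).mono' (aestronglyMeasurable_fderiv_comp hh hA hb v)
      (ae_of_all _ fun x => norm_fderiv_comp_le hK hC v x)

lemma IsNice.affineAverage (hh : IsNice h) (hA : ∀ v, Measurable fun x => A x v)
    (hb : Measurable b) (hC : ∀ x, ‖A x‖ ≤ C) : IsNice (affineAverage τ A b h) := by
  obtain ⟨K, hK⟩ := hh.exists_fderiv_le
  obtain ⟨l, r, hl, hlr⟩ := hh.exists_bounds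
  have hfd := fun v => (hasFDerivAt_affineAverage (τ := τ) hh hA hb hC v)
  refine ⟨?_, ⟨l, r, hl, fun v => ⟨?_, ?_⟩⟩, ⟨K * C, fun v => ?_⟩⟩
  · rw [contDiff_one_iff_fderiv]
    refine ⟨fun v => (hfd v).differentiableAt, ?_⟩
    rw [show fderiv ℝ (KacReservoir.affineAverage τ A b h) = _ from funext fun v => (hfd v).fderiv]
    refine continuous_of_dominated (bound := fun _ => K * C)
      (fun v => aestronglyMeasurable_fderiv_comp hh hA hb v)
      (fun v => ae_of_all _ fun x => norm_fderiv_comp_le hK hC v x) (integrable_const _)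
      (ae_of_all _ fun x => ?_)
    have := hh.continuous_fderiv
    fun_prop
  · calc l = ∫ _ : X, l ∂τ := by simp
      _ ≤ _ := integral_mono (integrable_const _) (integrable_comp_affine hh hA hb v)
        fun x => (hlr _).1
  · calc _ ≤ ∫ _ : X, r ∂τ := integral_mono (integrable_comp_affine hh hA hb v)
            (integrable_const _) fun x => (hlr _).2
      _ = r := by simp
  · rw [(hfd v).fderiv]
    calc _ ≤ ∫ _ : X, K * C ∂τ := norm_integral_le_of_norm_le (integrable_const _)
          (ae_of_all _ fun x => norm_fderiv_comp_le hK hC v x)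
      _ = K * C := by simp

end Average

/-- The Mehler form of the Ornstein-Uhlenbeck semigroup, parametrized by the angle `θ` with
`cos θ = exp (-s)`. -/
noncomputable def mehler (β θ : ℝ) (h : Config ι d → ℝ) (v : Config ι d) : ℝ :=
  ∫ z, h (cos θ • v + sin θ • z) ∂(maxwellMeasure ι d β)

lemma mehler_eq_affineAverage (θ : ℝ) (h : Config ι d → ℝ) :
    mehler β θ h = affineAverage (maxwellMeasure ι d β)
      (fun _ => cos θ • ContinuousLinearMap.id ℝ (Config ι d)) (fun z => sin θ • z) h := rfl

variable [Fact (0 < β)] {h : Config ι d → ℝ}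

lemma IsNice.mehler (hh : IsNice h) (θ : ℝ) : IsNice (mehler β θ h) := by
  rw [mehler_eq_affineAverage]
  exact hh.affineAverage (fun _ => measurable_const) (measurable_const_smul _) (fun _ => le_rfl)

lemma fderiv_mehler_apply (hh : IsNice h) (θ : ℝ) (v e : Config ι d) :
    fderiv ℝ (mehler β θ h) v e =
      cos θ * ∫ z, fderiv ℝ h (cos θ • v + sin θ • z) e ∂(maxwellMeasure ι d β) := by
  rw [mehler_eq_affineAverage, fderiv_affineAverage_apply hh (fun _ => measurable_const)
    (measurable_const_smul _) (fun _ => le_rfl), ← integral_const_mul]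
  simp

lemma mehler_zero (h : Config ι d → ℝ) : mehler β 0 h = h := by
  funext v; simp [mehler]

lemma mehler_pi_div_two (h : Config ι d → ℝ) (v : Config ι d) :
    mehler β (π / 2) h v = ∫ z, h z ∂(maxwellMeasure ι d β) := by
  simp [mehler]

lemma integrable_norm_add_norm (v : Config ι d) :
    Integrable (fun z : Config ι d => ‖v‖ + ‖z‖) (maxwellMeasure ι d β) :=
  (integrable_const _).add integrable_norm_maxwellMeasure

lemma norm_rotate_le (θ : ℝ) (v z : Config ι d) : ‖-sin θ • v + cos θ • z‖ ≤ ‖v‖ + ‖z‖ := by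
  refine (norm_add_le _ _).trans (add_le_add ?_ ?_)
  · rw [norm_smul, norm_neg]
    exact mul_le_of_le_one_left (norm_nonneg _) (abs_sin_le_one θ)
  · rw [norm_smul]
    exact mul_le_of_le_one_left (norm_nonneg _) (abs_cos_le_one θ)

lemma continuous_fderiv_rotate (hh : IsNice h) (θ : ℝ) :
    Continuous fun p : Config ι d × Config ι d =>
      fderiv ℝ h (cos θ • p.1 + sin θ • p.2) (-sin θ • p.1 + cos θ • p.2) := by
  have := hh.continuous_fderiv
  exact (this.comp (by fun_prop)).clm_apply (by fun_prop)

/-- The derivative of `h` is taken at the first component of `rotate θ (v, z)` in the direction of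
the second. The two components are independent Maxwellians, so this form is ready for Gaussian
integration by parts. Even at θ = 0 no singularity appears, in contrast to the parametrization by
the time s. -/
lemma hasDerivAt_mehler (hh : IsNice h) (v : Config ι d) (θ : ℝ) :
    HasDerivAt (fun θ => mehler β θ h v)
      (∫ z, fderiv ℝ h (cos θ • v + sin θ • z) (-sin θ • v + cos θ • z)
        ∂(maxwellMeasure ι d β)) θ := by
  obtain ⟨K, hK⟩ := hh.exists_fderiv_le
  have hcont := hh.contDiff.continuous
  refine (hasDerivAt_integral_of_dominated_loc_of_deriv_le (μ := maxwellMeasure ι d β)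
    (bound := fun z => K * (‖v‖ + ‖z‖))
    (F := fun θ z => h (cos θ • v + sin θ • z))
    (F' := fun θ z => fderiv ℝ h (cos θ • v + sin θ • z) (-sin θ • v + cos θ • z)) univ_mem
    (Eventually.of_forall fun θ => ?_) ?_ ?_ ?_ ?_ ?_).2
  · exact Continuous.aestronglyMeasurable (by fun_prop)
  · obtain ⟨b, hb⟩ := hh.exists_abs_le
    exact (integrable_const b).mono' (Continuous.aestronglyMeasurable (by fun_prop))
      (ae_of_all _ fun x => hb _)
  · exact ((continuous_fderiv_rotate hh θ).comp
      (by fun_prop : Continuous fun z : Config ι d => (v, z))).aestronglyMeasurable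
  · exact ae_of_all _ fun z θ _ => ((fderiv ℝ h _).le_opNorm _).trans
      (mul_le_mul (hK _) (norm_rotate_le θ v z) (norm_nonneg _) ((norm_nonneg _).trans (hK 0)))
  · exact (integrable_norm_add_norm v).const_mul K
  · refine ae_of_all _ fun z θ _ => ?_
    have h1 : HasDerivAt (fun θ : ℝ => cos θ • v + sin θ • z) (-sin θ • v + cos θ • z) θ :=
      ((hasDerivAt_cos θ).smul_const v).add ((hasDerivAt_sin θ).smul_const z)
    exact (hh.differentiable _).hasFDerivAt.comp_hasDerivAt θ h1

lemma integrable_prod_norm_add_norm :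
    Integrable (fun p : Config ι d × Config ι d => ‖p.1‖ + ‖p.2‖)
      ((maxwellMeasure ι d β).prod (maxwellMeasure ι d β)) :=
  (integrable_norm_maxwellMeasure.comp_fst _).add (integrable_norm_maxwellMeasure.comp_snd _)

/-- The derivative of `klFun` is `log`, which is bounded along the flow because the flow keeps the
bounds of `h`. -/
lemma hasDerivAt_integral_klFun_mehler (hh : IsNice h) (θ : ℝ) :
    HasDerivAt (fun θ => ∫ v, klFun (mehler β θ h v) ∂(maxwellMeasure ι d β))
      (∫ v, log (mehler β θ h v) *
        ∫ z, fderiv ℝ h (cos θ • v + sin θ • z) (-sin θ • v + cos θ • z)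
        ∂(maxwellMeasure ι d β) ∂(maxwellMeasure ι d β)) θ := by
  obtain ⟨K, hK⟩ := hh.exists_fderiv_le
  obtain ⟨a, b, ha, hab⟩ := hh.exists_bounds
  have hk : ∀ θ v, a ≤ mehler β θ h v ∧ mehler β θ h v ≤ b := by
    intro θ v
    have hi : Integrable (fun z => h (cos θ • v + sin θ • z)) (maxwellMeasure ι d β) :=
      integrable_comp_affine (A := fun _ => cos θ • ContinuousLinearMap.id ℝ (Config ι d)) hh
        (fun _ => measurable_const) (measurable_const_smul _) v
    constructor
    · calc a = ∫ _, a ∂(maxwellMeasure ι d β) := by simp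
        _ ≤ _ := integral_mono (integrable_const _) hi fun x => (hab _).1
    · calc _ ≤ ∫ _, b ∂(maxwellMeasure ι d β) := integral_mono hi (integrable_const _)
            fun x => (hab _).2
        _ = b := by simp
  set L := max |log a| |log b|
  have hL : ∀ θ v, |log (mehler β θ h v)| ≤ L := fun θ v =>
    abs_le_max_abs_abs (log_le_log ha (hk θ v).1)
      (log_le_log (ha.trans_le (hk θ v).1) (hk θ v).2)
  have hint : ∀ v θ, Integrable (fun z => fderiv ℝ h (cos θ • v + sin θ • z)
      (-sin θ • v + cos θ • z)) (maxwellMeasure ι d β) := fun v θ => by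
    refine ((integrable_norm_add_norm v).const_mul K).mono'
      ((continuous_fderiv_rotate hh θ).comp
        (by fun_prop : Continuous fun z : Config ι d => (v, z))).aestronglyMeasurable
      (ae_of_all _ fun z => ((fderiv ℝ h _).le_opNorm _).trans
        (mul_le_mul (hK _) (norm_rotate_le θ v z) (norm_nonneg _) ((norm_nonneg _).trans (hK 0))))
  refine (hasDerivAt_integral_of_dominated_loc_of_deriv_le (μ := maxwellMeasure ι d β)
    (bound := fun v => L * (K * (‖v‖ + ∫ z : Config ι d, ‖z‖ ∂(maxwellMeasure ι d β))))
    (F := fun θ v => klFun (mehler β θ h v))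
    (F' := fun θ v => log (mehler β θ h v) *
        ∫ z, fderiv ℝ h (cos θ • v + sin θ • z) (-sin θ • v + cos θ • z)
        ∂(maxwellMeasure ι d β)) univ_mem
    (Eventually.of_forall fun θ => ?_) ?_ ?_ ?_ ?_ ?_).2
  · exact (continuous_klFun.comp (hh.mehler θ).contDiff.continuous).aestronglyMeasurable
  · obtain ⟨B, hB⟩ := (hh.mehler (β := β) θ).exists_abs_klFun_le
    exact (integrable_const B).mono'
      (continuous_klFun.comp (hh.mehler θ).contDiff.continuous).aestronglyMeasurable
      (ae_of_all _ fun x => hB _)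
  · refine AEStronglyMeasurable.mul ?_ ?_
    · exact (Real.measurable_log.comp
        (hh.mehler θ).contDiff.continuous.measurable).aestronglyMeasurable
    · exact ((continuous_fderiv_rotate hh θ).stronglyMeasurable.integral_prod_right'
        (ν := maxwellMeasure ι d β)).aestronglyMeasurable
  · refine ae_of_all _ fun v θ _ => ?_
    rw [norm_mul]
    refine mul_le_mul (hL θ v) ?_ (norm_nonneg _) ((abs_nonneg _).trans (hL θ v))
    refine (norm_integral_le_of_norm_le ((integrable_norm_add_norm v).const_mul K)
      (ae_of_all _ fun z => ((fderiv ℝ h _).le_opNorm _).trans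
        (mul_le_mul (hK _) (norm_rotate_le θ v z) (norm_nonneg _)
          ((norm_nonneg _).trans (hK 0))))).trans_eq ?_
    rw [integral_const_mul, integral_add (integrable_const _) integrable_norm_maxwellMeasure]
    simp
  · exact ((integrable_norm_maxwellMeasure.add (integrable_const _)).const_mul K).const_mul L
  · refine ae_of_all _ fun v θ _ => ?_
    exact (hasDerivAt_klFun ((hh.mehler (β := β) θ).pos v).ne').comp θ (hasDerivAt_mehler hh v θ)

lemma integral_comp_rotate (θ : ℝ) (G : Config ι d × Config ι d → ℝ) :
    ∫ p, G (rotate θ p) ∂((maxwellMeasure ι d β).prod (maxwellMeasure ι d β)) =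
      ∫ p, G p ∂((maxwellMeasure ι d β).prod (maxwellMeasure ι d β)) :=
  (measurePreserving_rotate θ).integral_comp
    (rotate θ).toHomeomorph.measurableEmbedding G

/-- Gaussian integration by parts in the rotated variables. -/
lemma integral_mul_rotate_coord [DecidableEq ι] {ψ g : Config ι d → ℝ} (hψ : ContDiff ℝ 1 ψ)
    {C C' C'' : ℝ} (hC : ∀ u, |ψ u| ≤ C) (hC' : ∀ u, ‖fderiv ℝ ψ u‖ ≤ C')
    (hg : Continuous g) (hg' : ∀ u, |g u| ≤ C'') (θ : ℝ) (i : ι) (a : Fin d) :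
    ∫ p : Config ι d × Config ι d, ψ p.1 * ((rotate θ p).2 i a * g (rotate θ p).1)
        ∂((maxwellMeasure ι d β).prod (maxwellMeasure ι d β)) =
      -(sin θ / β) * ∫ p : Config ι d × Config ι d,
        fderiv ℝ ψ p.1 (unitVec i a) * g (rotate θ p).1
        ∂((maxwellMeasure ι d β).prod (maxwellMeasure ι d β)) := by
  have hψc := hψ.continuous
  have hψd : Differentiable ℝ ψ := hψ.differentiable one_ne_zero
  have hψf : Continuous (fderiv ℝ ψ) := hψ.continuous_fderiv one_ne_zero
  have hC'e : ∀ u, |fderiv ℝ ψ u (unitVec i a)| ≤ C' := fun u =>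
    ((fderiv ℝ ψ u).le_opNorm _).trans
      (mul_le_of_le_one_right (norm_nonneg _) (norm_unitVec_le i a) |>.trans (hC' u))
  -- Passing to the rotated pair q as variable turns the second rotated component into the plain
  -- coordinate q.2, which Gaussian integration by parts removes for each fixed q.1.
  have e1 := integral_comp_rotate (β := β) θ
    (fun q : Config ι d × Config ι d => ψ ((rotate θ).symm q).1 * (q.2 i a * g q.1))
  have e2 := integral_comp_rotate (β := β) θ
    (fun q : Config ι d × Config ι d => fderiv ℝ ψ ((rotate θ).symm q).1 (unitVec i a) * g q.1)
  simp only [ContinuousLinearEquiv.symm_apply_apply] at e1 e2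
  rw [e1, e2, integral_prod, integral_prod, ← integral_const_mul]
  · congr 1
    funext x
    simp only [rotate_symm_apply]
    have hinner : ∀ y, HasFDerivAt (fun y : Config ι d => ψ (cos θ • x - sin θ • y))
        ((fderiv ℝ ψ (cos θ • x - sin θ • y)).comp
          (-(sin θ • ContinuousLinearMap.id ℝ (Config ι d)))) y := fun y => by
      refine (hψd _).hasFDerivAt.comp y ?_
      exact (((ContinuousLinearMap.id ℝ (Config ι d)).hasFDerivAt).const_smul (sin θ)).const_sub
        (cos θ • x)
    -- The factor -sin θ of the claim is the inner derivative of cos θ x - sin θ y with respect to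
    -- y.
    have hstein := integral_coord_mul (β := β) (ψ := fun y => ψ (cos θ • x - sin θ • y))
      (fun y => (hinner y).differentiableAt) (fun y => hC _) i a (C' := |sin θ| * C')
      (fun y => by
        rw [(hinner y).fderiv]
        simp only [ContinuousLinearMap.comp_apply, neg_apply, smul_apply,
          ContinuousLinearMap.id_apply, map_neg, map_smul, abs_neg, smul_eq_mul, abs_mul]
        exact mul_le_mul_of_nonneg_left (hC'e _) (abs_nonneg _))
    have r1 : ∀ y : Config ι d, ψ (cos θ • x - sin θ • y) * (y i a * g x) =
        g x * (y i a * ψ (cos θ • x - sin θ • y)) := fun y => by ring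
    have r2 : ∀ y : Config ι d, fderiv ℝ ψ (cos θ • x - sin θ • y) (unitVec i a) * g x =
        g x * fderiv ℝ ψ (cos θ • x - sin θ • y) (unitVec i a) := fun y => by ring
    simp_rw [r1, r2]
    rw [integral_const_mul, integral_const_mul, hstein]
    simp_rw [(hinner _).fderiv]
    simp only [ContinuousLinearMap.comp_apply, neg_apply, smul_apply,
      ContinuousLinearMap.id_apply, map_neg, map_smul, smul_eq_mul, integral_neg,
      integral_const_mul]
    ring
  · refine (integrable_const (C' * C'')).mono' ?_ (ae_of_all _ fun p => ?_)
    · refine Continuous.aestronglyMeasurable ?_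
      have := (rotate θ : (Config ι d × Config ι d) ≃L[ℝ] _).symm.continuous
      exact ((hψf.comp (continuous_fst.comp this)).clm_apply continuous_const).mul
        (hg.comp continuous_fst)
    · rw [norm_mul]
      exact mul_le_mul (hC'e _) (hg' _) (norm_nonneg _) ((norm_nonneg _).trans (hC' 0))
  · refine ((integrable_norm_maxwellMeasure.comp_snd (maxwellMeasure ι d β)).const_mul
      (C * C'')).mono' ?_ (ae_of_all _ fun p => ?_)
    · refine Continuous.aestronglyMeasurable ?_
      have := (rotate θ : (Config ι d × Config ι d) ≃L[ℝ] _).symm.continuous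
      exact (hψc.comp (continuous_fst.comp this)).mul
        ((by fun_prop : Continuous fun p : Config ι d × Config ι d => p.2 i a).mul
          (hg.comp continuous_fst))
    · rw [norm_mul, norm_mul]
      calc |ψ ((rotate θ).symm p).1| * (|p.2 i a| * |g p.1|) ≤ C * (‖p.2‖ * C'') := by
            have := (abs_nonneg _).trans (hC 0)
            gcongr
            · exact hC _
            · exact abs_coord_le _ _ _
            · exact hg' _
        _ = C * C'' * ‖p.2‖ := by ring

/-- The Fisher information `∫ |∇h|² / h dγ`. -/
noncomputable def fisher [DecidableEq ι] (β : ℝ) (h : Config ι d → ℝ) : ℝ :=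
  ∫ v, (∑ p : ι × Fin d, fderiv ℝ h v (unitVec p.1 p.2) ^ 2) / h v ∂(maxwellMeasure ι d β)

/-- De Bruijn's identity. -/
lemma cos_mul_deriv_integral_klFun_mehler [DecidableEq ι] (hh : IsNice h) (θ : ℝ) :
    cos θ * deriv (fun θ => ∫ v, klFun (mehler β θ h v) ∂(maxwellMeasure ι d β)) θ =
      -(sin θ / β) * fisher β (mehler β θ h) := by
  rw [(hasDerivAt_integral_klFun_mehler hh θ).deriv]
  set k := mehler β θ h with hk
  set γ := maxwellMeasure ι d β
  have hkn : IsNice k := hh.mehler θ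
  obtain ⟨K, hK⟩ := hh.exists_fderiv_le
  obtain ⟨L, hL⟩ := hkn.exists_abs_log_le
  obtain ⟨K', hK'⟩ := hkn.exists_fderiv_le
  obtain ⟨a, b, ha, hab⟩ := hkn.exists_bounds
  have hKe : ∀ u (p : ι × Fin d), |fderiv ℝ h u (unitVec p.1 p.2)| ≤ K := fun u p =>
    ((fderiv ℝ h u).le_opNorm _).trans
      (mul_le_of_le_one_right (norm_nonneg _) (norm_unitVec_le _ _) |>.trans (hK u))
  have hlog : ∀ v, HasFDerivAt (fun v => log (k v)) ((k v)⁻¹ • fderiv ℝ k v) v := fun v =>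
    (hkn.differentiable v).hasFDerivAt.log (hkn.pos v).ne'
  have hlogc : ContDiff ℝ 1 fun v => log (k v) := hkn.contDiff.log fun v => (hkn.pos v).ne'
  have hlogb : ∀ v, ‖fderiv ℝ (fun v => log (k v)) v‖ ≤ a⁻¹ * K' := fun v => by
    rw [(hlog v).fderiv, norm_smul, norm_inv, norm_of_nonneg (hkn.pos v).le]
    exact mul_le_mul (inv_anti₀ ha (hab v).1) (hK' v) (norm_nonneg _) (by positivity)
  have hcont : ∀ p : ι × Fin d, Continuous fun u => fderiv ℝ h u (unitVec p.1 p.2) := fun p =>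
    hh.continuous_fderiv.clm_apply continuous_const
  have hrc := (rotate θ : (Config ι d × Config ι d) ≃L[ℝ] _).continuous
  have hint : ∀ p : ι × Fin d, Integrable (fun q : Config ι d × Config ι d => log (k q.1) *
      ((rotate θ q).2 p.1 p.2 * fderiv ℝ h (rotate θ q).1 (unitVec p.1 p.2))) (γ.prod γ) := by
    intro p
    refine (integrable_prod_norm_add_norm.const_mul (L * K)).mono' ?_ (ae_of_all _ fun q => ?_)
    · refine Continuous.aestronglyMeasurable ?_
      refine (hlogc.continuous.comp continuous_fst).mul (Continuous.mul ?_ ?_)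
      · exact (by fun_prop : Continuous fun q : Config ι d × Config ι d => q.2 p.1 p.2).comp hrc
      · exact (hcont p).comp (continuous_fst.comp hrc)
    · rw [norm_mul, norm_mul]
      calc |log (k q.1)| * (|(rotate θ q).2 p.1 p.2| *
            |fderiv ℝ h (rotate θ q).1 (unitVec p.1 p.2)|) ≤ L * ((‖q.1‖ + ‖q.2‖) * K) := by
            have := (abs_nonneg _).trans (hL 0)
            gcongr
            · exact hL _
            · exact (abs_coord_le _ _ _).trans (norm_rotate_le θ q.1 q.2)
            · exact hKe _ _
        _ = L * K * (‖q.1‖ + ‖q.2‖) := by ring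
  have hexp : ∀ q : Config ι d × Config ι d,
      log (k q.1) * fderiv ℝ h (cos θ • q.1 + sin θ • q.2) (-sin θ • q.1 + cos θ • q.2) =
      ∑ p : ι × Fin d, log (k q.1) *
        ((rotate θ q).2 p.1 p.2 * fderiv ℝ h (rotate θ q).1 (unitVec p.1 p.2)) := fun q => by
    rw [← Finset.mul_sum, ← map_eq_sum, rotate_apply]
  have e1 : ∫ v, log (k v) * ∫ z, fderiv ℝ h (cos θ • v + sin θ • z)
      (-sin θ • v + cos θ • z) ∂γ ∂γ =
      ∫ q, ∑ p : ι × Fin d, log (k q.1) *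
        ((rotate θ q).2 p.1 p.2 * fderiv ℝ h (rotate θ q).1 (unitVec p.1 p.2)) ∂(γ.prod γ) := by
    rw [integral_prod _ (integrable_finsetSum _ fun p _ => hint p)]
    simp_rw [← integral_const_mul]
    congr 1; funext v; congr 1; funext z
    exact hexp (v, z)
  have hfi : ∀ p : ι × Fin d, Integrable (fun v => fderiv ℝ k v (unitVec p.1 p.2) ^ 2 / k v) γ := by
    intro p
    refine (integrable_const (K' ^ 2 / a)).mono' ?_ (ae_of_all _ fun v => ?_)
    · exact ((hkn.continuous_fderiv.clm_apply continuous_const).pow 2 |>.div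
        hkn.contDiff.continuous fun v => (hkn.pos v).ne').aestronglyMeasurable
    · rw [norm_div, norm_pow, norm_of_nonneg (hkn.pos v).le]
      have : ‖fderiv ℝ k v (unitVec p.1 p.2)‖ ≤ K' := ((fderiv ℝ k v).le_opNorm _).trans
        (mul_le_of_le_one_right (norm_nonneg _) (norm_unitVec_le _ _) |>.trans (hK' v))
      gcongr
      exact (hab v).1
  rw [e1, integral_finsetSum _ fun p _ => hint p]
  -- Integration by parts leaves ∂ log k = ∂k / k times the average of ∂h. Multiplying that average
  -- by cos θ gives ∂k once more (`fderiv_mehler_apply`), and the product is the integrand of the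
  -- Fisher information.
  have e2 : ∀ p : ι × Fin d, cos θ * ∫ q, log (k q.1) *
        ((rotate θ q).2 p.1 p.2 * fderiv ℝ h (rotate θ q).1 (unitVec p.1 p.2)) ∂(γ.prod γ) =
      -(sin θ / β) * ∫ v, fderiv ℝ k v (unitVec p.1 p.2) ^ 2 / k v ∂γ := by
    intro p
    rw [integral_mul_rotate_coord (g := fun u => fderiv ℝ h u (unitVec p.1 p.2)) hlogc hL hlogb
      (hcont p) (fun u => hKe u p) θ p.1 p.2, integral_prod]
    · rw [mul_left_comm, ← integral_const_mul]
      congr 2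
      funext v
      simp only [(hlog v).fderiv, rotate_apply]
      rw [integral_const_mul, smul_apply, smul_eq_mul, fderiv_mehler_apply hh]
      ring
    · refine (integrable_const (a⁻¹ * K' * K)).mono' ?_ (ae_of_all _ fun q => ?_)
      · refine Continuous.aestronglyMeasurable ?_
        refine Continuous.mul ?_ ((hcont p).comp (continuous_fst.comp hrc))
        exact ((hlogc.continuous_fderiv one_ne_zero).comp continuous_fst).clm_apply
          continuous_const
      · rw [norm_mul]
        refine mul_le_mul ?_ (hKe _ _) (norm_nonneg _) ?_
        · exact ((fderiv ℝ (fun v => log (k v)) q.1).le_opNorm _).trans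
            (mul_le_of_le_one_right (norm_nonneg _) (norm_unitVec_le _ _) |>.trans (hlogb _))
        · exact (norm_nonneg _).trans (hlogb 0)
  rw [Finset.mul_sum, Finset.sum_congr rfl fun p _ => e2 p, ← Finset.mul_sum, fisher,
    ← integral_finsetSum _ fun p _ => hfi p]
  simp_rw [Finset.sum_div]
  rfl

end Mehler

end KacReservoir

namespace KacReservoir

open Real InformationTheory Filter Topology ENNReal

/-! ### Entropy contraction for random linear maps that preserve Maxwellians, on regular functions.
-/

section Mixture

variable {ι κ : Type} [Fintype ι] [Fintype κ] [DecidableEq ι] {d : ℕ} {β c : ℝ}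
  {Ω : Type*} [MeasurableSpace Ω] {ν : Measure Ω}
  {A : Ω → Config ι d →L[ℝ] Config ι d} {B : Ω → Config κ d →L[ℝ] Config ι d}

/-- A random family of linear maps `(v, w) ↦ A v + B w`, each of which sends Maxwellians to the
Maxwellian, with `𝔼 (A Aᵀ) = c`. -/
structure IsMaxwellMixture (β c : ℝ) (ν : Measure Ω) (A : Ω → Config ι d →L[ℝ] Config ι d)
    (B : Ω → Config κ d →L[ℝ] Config ι d) : Prop where
  measurable_left : ∀ v, Measurable fun ω => A ω v
  measurable_right : ∀ w, Measurable fun ω => B ω w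
  exists_norm_le : ∃ C, ∀ ω, ‖A ω‖ ≤ C
  measurePreserving : ∀ ω, MeasurePreserving (fun p : Config ι d × Config κ d => A ω p.1 + B ω p.2)
    ((maxwellMeasure ι d β).prod (maxwellMeasure κ d β)) (maxwellMeasure ι d β)
  sum_rule : ∀ ℓ : Config ι d →L[ℝ] ℝ,
    ∫ ω, ∑ p : ι × Fin d, ℓ (A ω (unitVec p.1 p.2)) ^ 2 ∂ν =
      c * ∑ p : ι × Fin d, ℓ (unitVec p.1 p.2) ^ 2

/-- The average of `h` over a random family of linear maps and a Maxwellian second argument. -/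
noncomputable def mixture (β : ℝ) (ν : Measure Ω) (A : Ω → Config ι d →L[ℝ] Config ι d)
    (B : Ω → Config κ d →L[ℝ] Config ι d) (h : Config ι d → ℝ) (v : Config ι d) : ℝ :=
  ∫ q : Ω × Config κ d, h (A q.1 v + B q.1 q.2) ∂(ν.prod (maxwellMeasure κ d β))

lemma mixture_eq_affineAverage (h : Config ι d → ℝ) :
    mixture β ν A B h = affineAverage (ν.prod (maxwellMeasure κ d β))
      (fun q => A q.1) (fun q => B q.1 q.2) h := rfl

lemma measurable_clm_uncurry {F : Type*} [NormedAddCommGroup F] [NormedSpace ℝ F]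
    [MeasurableSpace F] [BorelSpace F] [SecondCountableTopology F]
    {T : Ω → Config ι d →L[ℝ] F} (hT : ∀ v, Measurable fun ω => T ω v) :
    Measurable fun q : Ω × Config ι d => T q.1 q.2 := by
  have : (fun q : Ω × Config ι d => T q.1 q.2) =
      fun q => ∑ p : ι × Fin d, q.2 p.1 p.2 • T q.1 (unitVec p.1 p.2) := by
    funext q
    conv_lhs => rw [← sum_smul_unitVec q.2]
    simp
  rw [this]
  refine Finset.measurable_fun_sum _ fun p _ => Measurable.smul ?_ ((hT _).comp measurable_fst)
  exact (by fun_prop : Continuous fun u : Config ι d => u p.1 p.2).measurable.comp measurable_snd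

namespace IsMaxwellMixture

variable [Fact (0 < β)] [IsProbabilityMeasure ν] {h : Config ι d → ℝ}

lemma measurable_right_uncurry [DecidableEq κ] (hK : IsMaxwellMixture β c ν A B) :
    Measurable fun q : Ω × Config κ d => B q.1 q.2 :=
  measurable_clm_uncurry hK.measurable_right

lemma measurable_affine (hK : IsMaxwellMixture β c ν A B) :
    Measurable fun q : Ω × (Config ι d × Config κ d) => A q.1 q.2.1 + B q.1 q.2.2 := by
  classical
  have h1 := measurable_clm_uncurry hK.measurable_left
  have h2 := measurable_clm_uncurry hK.measurable_right
  exact (h1.comp (measurable_fst.prodMk (measurable_fst.comp measurable_snd))).add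
    (h2.comp (measurable_fst.prodMk (measurable_snd.comp measurable_snd)))

lemma measurePreserving_left_comm {X Y Z : Type*} [MeasurableSpace X] [MeasurableSpace Y]
    [MeasurableSpace Z] (μ₁ : Measure X) (μ₂ : Measure Y) (μ₃ : Measure Z) [SFinite μ₁]
    [SFinite μ₂] [SFinite μ₃] :
    MeasurePreserving (fun p : X × (Y × Z) => (p.2.1, (p.1, p.2.2)))
      (μ₁.prod (μ₂.prod μ₃)) (μ₂.prod (μ₁.prod μ₃)) :=
  (measurePreserving_prodAssoc μ₂ μ₁ μ₃).comp
    (((Measure.measurePreserving_swap (μ := μ₁) (ν := μ₂)).prod (MeasurePreserving.id μ₃)).comp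
      (measurePreserving_prodAssoc μ₁ μ₂ μ₃).symm)

/-- For every fixed ω the output A v + B w is Maxwellian, so it is independent of ω. This is what
allows the matrices A Aᵀ to be averaged at a fixed value of ∇h in `fisher_mixture_le`. -/
lemma measurePreserving_skew (hK : IsMaxwellMixture β c ν A B) :
    MeasurePreserving (fun p : Config ι d × (Ω × Config κ d) =>
        (p.2.1, A p.2.1 p.1 + B p.2.1 p.2.2))
      ((maxwellMeasure ι d β).prod (ν.prod (maxwellMeasure κ d β)))
      (ν.prod (maxwellMeasure ι d β)) :=
  ((MeasurePreserving.id ν).skew_product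
    (g := fun ω (p : Config ι d × Config κ d) => A ω p.1 + B ω p.2) hK.measurable_affine
    (ae_of_all _ fun ω => (hK.measurePreserving ω).map_eq)).comp
    (measurePreserving_left_comm _ _ _)

lemma measurePreserving_affine (hK : IsMaxwellMixture β c ν A B) :
    MeasurePreserving (fun p : Config ι d × (Ω × Config κ d) => A p.2.1 p.1 + B p.2.1 p.2.2)
      ((maxwellMeasure ι d β).prod (ν.prod (maxwellMeasure κ d β)))
      (maxwellMeasure ι d β) :=
  measurePreserving_snd.comp hK.measurePreserving_skew

lemma isNice (hK : IsMaxwellMixture β c ν A B) (hh : IsNice h) :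
    IsNice (mixture β ν A B h) := by
  classical
  obtain ⟨C, hC⟩ := hK.exists_norm_le
  rw [mixture_eq_affineAverage]
  exact hh.affineAverage (fun v => (hK.measurable_left v).comp measurable_fst)
    hK.measurable_right_uncurry (fun q => hC q.1)

/-- Joint convexity of x²/y, by integrating the tangent plane bound 2mx - m²y ≤ x²/y. The slope m is
the ratio of the two means, where the bound becomes sharp. -/
lemma sq_integral_div_le {X : Type*} [MeasurableSpace X] {μ : Measure X} {f g : X → ℝ}
    (hf : Integrable f μ) (hg : Integrable g μ) (hg0 : ∀ x, 0 < g x)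
    (hfg : Integrable (fun x => f x ^ 2 / g x) μ) (hpos : 0 < ∫ x, g x ∂μ) :
    (∫ x, f x ∂μ) ^ 2 / ∫ x, g x ∂μ ≤ ∫ x, f x ^ 2 / g x ∂μ := by
  set m := (∫ x, f x ∂μ) / ∫ x, g x ∂μ with hm
  have h1 : ∫ x, (2 * m * f x - m ^ 2 * g x) ∂μ ≤ ∫ x, f x ^ 2 / g x ∂μ := by
    refine integral_mono ((hf.const_mul _).sub (hg.const_mul _)) hfg fun x => ?_
    have := hg0 x
    simp only
    rw [le_div_iff₀ this]
    nlinarith [sq_nonneg (f x - m * g x)]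
  rw [integral_sub (hf.const_mul _) (hg.const_mul _), integral_const_mul, integral_const_mul]
    at h1
  refine le_trans (le_of_eq ?_) h1
  rw [hm]
  field_simp
  ring

lemma abs_unitVec_le {C : ℝ} {ℓ : Config ι d →L[ℝ] ℝ} (hℓ : ‖ℓ‖ ≤ C) (p : ι × Fin d) :
    |ℓ (unitVec p.1 p.2)| ≤ C :=
  ((ℓ.le_opNorm _).trans
    (mul_le_of_le_one_right (norm_nonneg _) (norm_unitVec_le _ _))).trans hℓ

/-- Averaging over a Maxwell mixture contracts the Fisher information. -/
lemma fisher_mixture_le (hK : IsMaxwellMixture β c ν A B) (hh : IsNice h) :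
    fisher β (mixture β ν A B h) ≤ c * fisher β h := by
  classical
  set γ := maxwellMeasure ι d β with hγ
  set τ := ν.prod (maxwellMeasure κ d β) with hτ
  obtain ⟨C, hC⟩ := hK.exists_norm_le
  obtain ⟨D, hD⟩ := hh.exists_fderiv_le
  obtain ⟨a, b, ha, hab⟩ := hh.exists_bounds
  have hD0 : 0 ≤ D := (norm_nonneg _).trans (hD 0)
  have hkn := hK.isNice hh
  have hmA : ∀ v, Measurable fun q : Ω × Config κ d => A q.1 v :=
    fun v => (hK.measurable_left v).comp measurable_fst
  have hmB := hK.measurable_right_uncurry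
  -- the integrand after averaging
  set Φ : Ω × Config ι d → ℝ := fun r =>
    ∑ p : ι × Fin d, fderiv ℝ h r.2 (A r.1 (unitVec p.1 p.2)) ^ 2 / h r.2 with hΦ
  have hle : ∀ (ω : Ω) (y : Config ι d) (p : ι × Fin d),
      |fderiv ℝ h y (A ω (unitVec p.1 p.2))| ≤ D * C := fun ω y p =>
    abs_unitVec_le (ℓ := (fderiv ℝ h y).comp (A ω)) ((ContinuousLinearMap.opNorm_comp_le _ _).trans
      (mul_le_mul (hD _) (hC _) (norm_nonneg _) hD0)) p
  have hDA : ∀ p : ι × Fin d, Measurable fun r : Ω × Config ι d =>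
      fderiv ℝ h r.2 (A r.1 (unitVec p.1 p.2)) := fun p => by
    have h2 : Continuous fun q : Config ι d × Config ι d => fderiv ℝ h q.1 q.2 :=
      (hh.continuous_fderiv.comp continuous_fst).clm_apply continuous_snd
    exact h2.measurable.comp
      (measurable_snd.prodMk ((hK.measurable_left (unitVec p.1 p.2)).comp measurable_fst))
  have hΦp : ∀ p : ι × Fin d, Measurable fun r : Ω × Config ι d =>
      fderiv ℝ h r.2 (A r.1 (unitVec p.1 p.2)) ^ 2 / h r.2 := fun p =>
    ((hDA p).pow_const 2).div (hh.contDiff.continuous.measurable.comp measurable_snd)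
  have hΦple : ∀ (p : ι × Fin d) (r : Ω × Config ι d),
      ‖fderiv ℝ h r.2 (A r.1 (unitVec p.1 p.2)) ^ 2 / h r.2‖ ≤ (D * C) ^ 2 / a := fun p r => by
    rw [norm_div, norm_pow, norm_of_nonneg (hh.pos _).le]
    have := hle r.1 r.2 p
    rw [← Real.norm_eq_abs] at this
    gcongr
    exact (hab _).1
  have hΦm : Measurable Φ := Finset.measurable_fun_sum _ fun p _ => hΦp p
  have hΦi : Integrable Φ (ν.prod γ) :=
    integrable_finsetSum _ fun p _ => (integrable_const ((D * C) ^ 2 / a)).mono'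
      (hΦp p).aestronglyMeasurable (ae_of_all _ (hΦple p))
  -- pointwise Cauchy-Schwarz
  have hpt : ∀ v, (∑ p : ι × Fin d,
      fderiv ℝ (mixture β ν A B h) v (unitVec p.1 p.2) ^ 2) / mixture β ν A B h v ≤
      ∫ q, Φ (q.1, A q.1 v + B q.1 q.2) ∂τ := by
    intro v
    have hmap : Measurable fun q : Ω × Config κ d => (q.1, A q.1 v + B q.1 q.2) :=
      measurable_fst.prodMk ((hmA v).add hmB)
    have hi : ∀ p : ι × Fin d, Integrable (fun q : Ω × Config κ d =>
        fderiv ℝ h (A q.1 v + B q.1 q.2) (A q.1 (unitVec p.1 p.2)) ^ 2 /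
          h (A q.1 v + B q.1 q.2)) τ := fun p =>
      (integrable_const ((D * C) ^ 2 / a)).mono'
        ((hΦp p).comp hmap).aestronglyMeasurable
        (ae_of_all _ fun q => hΦple p (q.1, A q.1 v + B q.1 q.2))
    simp only [hΦ]
    rw [integral_finsetSum _ fun p _ => hi p, Finset.sum_div]
    refine Finset.sum_le_sum fun p _ => ?_
    rw [mixture_eq_affineAverage, fderiv_affineAverage_apply hh hmA hmB (fun q => hC q.1)]
    refine sq_integral_div_le ?_ (integrable_comp_affine hh hmA hmB v) (fun q => hh.pos _) (hi p)
      ?_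
    · exact (integrable_const (D * C)).mono' ((hDA p).comp hmap).aestronglyMeasurable
        (ae_of_all _ fun q => hle q.1 _ p)
    · exact hkn.pos v
  -- Under the integral over v, the pair (ω, A v + B w) may be replaced by an independent pair (ω,
  -- y).
  have hskew := hK.measurePreserving_skew (ν := ν)
  have hint2 : Integrable (fun p : Config ι d × (Ω × Config κ d) =>
      Φ (p.2.1, A p.2.1 p.1 + B p.2.1 p.2.2)) (γ.prod τ) :=
    hskew.integrable_comp_of_integrable hΦi
  have hfi : Integrable (fun v => (∑ p : ι × Fin d,
      fderiv ℝ (mixture β ν A B h) v (unitVec p.1 p.2) ^ 2) / mixture β ν A B h v) γ := by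
    refine Integrable.mono' hint2.integral_prod_left ?_ (ae_of_all _ fun v => ?_)
    · refine Continuous.aestronglyMeasurable ?_
      refine Continuous.div ?_ hkn.contDiff.continuous fun v => (hkn.pos v).ne'
      exact continuous_finsetSum _ fun p _ =>
        (hkn.continuous_fderiv.clm_apply continuous_const).pow 2
    · rw [norm_of_nonneg]
      · exact hpt v
      · exact div_nonneg (Finset.sum_nonneg fun _ _ => sq_nonneg _) (hkn.pos v).le
  calc fisher β (mixture β ν A B h)
      ≤ ∫ v, ∫ q, Φ (q.1, A q.1 v + B q.1 q.2) ∂τ ∂γ :=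
        integral_mono hfi hint2.integral_prod_left hpt
    _ = ∫ p : Config ι d × (Ω × Config κ d),
          Φ (p.2.1, A p.2.1 p.1 + B p.2.1 p.2.2) ∂(γ.prod τ) := (integral_prod _ hint2).symm
    _ = ∫ r, Φ r ∂(ν.prod γ) := by
        rw [← hskew.map_eq, integral_map hskew.measurable.aemeasurable]
        exact hΦm.aestronglyMeasurable
    _ = ∫ y, ∫ ω, Φ (ω, y) ∂ν ∂γ := integral_prod_symm _ hΦi
    _ = ∫ y, c * ((∑ p : ι × Fin d, fderiv ℝ h y (unitVec p.1 p.2) ^ 2) / h y) ∂γ := by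
        congr 1
        funext y
        simp only [hΦ]
        -- The sum rule is applied to the functional ∇h(y), with y held fixed while ω is averaged.
        rw [← mul_div_assoc, ← hK.sum_rule, ← integral_div]
        simp_rw [Finset.sum_div]
    _ = c * fisher β h := integral_const_mul _ _

lemma _root_.KacReservoir.IsNice.integrable_comp (hh : IsNice h) {X : Type*} [MeasurableSpace X]
    {μ : Measure X} [IsFiniteMeasure μ] {f : X → Config ι d} (hf : Measurable f) :
    Integrable (fun x => h (f x)) μ := by
  obtain ⟨M, hM⟩ := hh.exists_abs_le
  exact (integrable_const M).mono'
    (hh.contDiff.continuous.measurable.comp hf).aestronglyMeasurable (ae_of_all _ fun _ => hM _)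

/-- In the right side the Maxwellian noise z has the law of A z + B w'. The argument of `h` becomes
A (cos θ v + sin θ z) + B (cos θ w + sin θ w'), and cos θ w + sin θ w' is again Maxwellian by
rotation invariance. This is the left side. -/
lemma mixture_mehler (hK : IsMaxwellMixture β c ν A B) (hh : IsNice h) (θ : ℝ)
    (v : Config ι d) :
    mehler β θ (mixture β ν A B h) v = mixture β ν A B (mehler β θ h) v := by
  classical
  have hc := hh.contDiff.continuous
  have hA := measurable_clm_uncurry hK.measurable_left
  have hB := hK.measurable_right_uncurry
  have e1 : mehler β θ (mixture β ν A B h) v = ∫ ω, ∫ z, ∫ w,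
      h (A ω (cos θ • v + sin θ • z) + B ω w) ∂(maxwellMeasure κ d β) ∂(maxwellMeasure ι d β)
        ∂ν := by
    have hm : Measurable fun p : Config ι d × (Ω × Config κ d) =>
        A p.2.1 (cos θ • v + sin θ • p.1) + B p.2.1 p.2.2 := by
      refine (hA.comp (Measurable.prodMk (by fun_prop) (by fun_prop))).add
        (hB.comp (Measurable.prodMk (by fun_prop) (by fun_prop)))
    have hm' : Measurable fun p : Ω × (Config ι d × Config κ d) =>
        A p.1 (cos θ • v + sin θ • p.2.1) + B p.1 p.2.2 := by
      refine (hA.comp (Measurable.prodMk (by fun_prop) (by fun_prop))).add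
        (hB.comp (Measurable.prodMk (by fun_prop) (by fun_prop)))
    have hmp := measurePreserving_left_comm (maxwellMeasure ι d β) ν (maxwellMeasure κ d β)
    calc mehler β θ (mixture β ν A B h) v
        = ∫ p : Config ι d × (Ω × Config κ d),
            h (A p.2.1 (cos θ • v + sin θ • p.1) + B p.2.1 p.2.2)
            ∂((maxwellMeasure ι d β).prod (ν.prod (maxwellMeasure κ d β))) :=
          (integral_prod _ (hh.integrable_comp hm)).symm
      _ = ∫ p : Ω × (Config ι d × Config κ d),
            h (A p.1 (cos θ • v + sin θ • p.2.1) + B p.1 p.2.2)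
            ∂(ν.prod ((maxwellMeasure ι d β).prod (maxwellMeasure κ d β))) := by
          rw [← hmp.map_eq, integral_map hmp.measurable.aemeasurable]
          exact (hc.measurable.comp hm').aestronglyMeasurable
      _ = _ := by
          rw [integral_prod _ (hh.integrable_comp hm')]
          congr 1; funext ω
          rw [integral_prod]
          exact hh.integrable_comp (hm'.comp (measurable_const.prodMk measurable_id))
  have e2 : mixture β ν A B (mehler β θ h) v = ∫ ω, ∫ w, ∫ z,
      h (cos θ • (A ω v + B ω w) + sin θ • z) ∂(maxwellMeasure ι d β) ∂(maxwellMeasure κ d β)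
        ∂ν := by
    refine integral_prod _ ?_
    obtain ⟨M', hM'⟩ := (hh.mehler (β := β) θ).exists_abs_le
    refine (integrable_const M').mono' ?_ (ae_of_all _ fun _ => hM' _)
    refine ((hh.mehler θ).contDiff.continuous.measurable.comp ?_).aestronglyMeasurable
    exact ((hK.measurable_left v).comp measurable_fst).add hB
  rw [e1, e2]
  congr 1
  funext ω
  have hpres := hK.measurePreserving ω
  have hG : ∀ w : Config κ d, ∫ z, h (cos θ • (A ω v + B ω w) + sin θ • z)
      ∂(maxwellMeasure ι d β) = ∫ q : Config ι d × Config κ d,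
        h (cos θ • (A ω v + B ω w) + sin θ • (A ω q.1 + B ω q.2))
        ∂((maxwellMeasure ι d β).prod (maxwellMeasure κ d β)) := fun w => by
    conv_lhs => rw [← hpres.map_eq]
    rw [integral_map hpres.measurable.aemeasurable]
    exact Continuous.aestronglyMeasurable (by fun_prop)
  simp_rw [hG]
  have hm3 : Measurable fun p : Config κ d × (Config ι d × Config κ d) =>
      cos θ • (A ω v + B ω p.1) + sin θ • (A ω p.2.1 + B ω p.2.2) :=
    Continuous.measurable (by fun_prop)
  have hm4 : Measurable fun p : Config ι d × (Config κ d × Config κ d) =>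
      cos θ • (A ω v + B ω p.2.1) + sin θ • (A ω p.1 + B ω p.2.2) :=
    Continuous.measurable (by fun_prop)
  have hmp := measurePreserving_left_comm (maxwellMeasure κ d β) (maxwellMeasure ι d β)
    (maxwellMeasure κ d β)
  have e3 : ∫ w, ∫ q : Config ι d × Config κ d,
        h (cos θ • (A ω v + B ω w) + sin θ • (A ω q.1 + B ω q.2))
        ∂((maxwellMeasure ι d β).prod (maxwellMeasure κ d β)) ∂(maxwellMeasure κ d β) =
      ∫ z, ∫ r : Config κ d × Config κ d,
        h (cos θ • (A ω v + B ω r.1) + sin θ • (A ω z + B ω r.2))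
        ∂((maxwellMeasure κ d β).prod (maxwellMeasure κ d β)) ∂(maxwellMeasure ι d β) := by
    refine (integral_prod (fun p : Config κ d × (Config ι d × Config κ d) =>
      h (cos θ • (A ω v + B ω p.1) + sin θ • (A ω p.2.1 + B ω p.2.2))) (hh.integrable_comp hm3)).symm.trans ?_
    refine Eq.trans ?_ (integral_prod (fun p : Config ι d × (Config κ d × Config κ d) =>
      h (cos θ • (A ω v + B ω p.2.1) + sin θ • (A ω p.1 + B ω p.2.2))) (hh.integrable_comp hm4))
    rw [← hmp.map_eq, integral_map hmp.measurable.aemeasurable]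
    exact (hc.measurable.comp hm4).aestronglyMeasurable
  rw [e3]
  congr 1
  funext z
  have e4 : ∀ r : Config κ d × Config κ d,
      cos θ • (A ω v + B ω r.1) + sin θ • (A ω z + B ω r.2) =
        A ω (cos θ • v + sin θ • z) + B ω (rotate θ r).1 := fun r => by
    simp only [rotate_apply, map_add, map_smul]
    module
  simp_rw [e4]
  rw [integral_comp_rotate θ (fun r : Config κ d × Config κ d =>
    h (A ω (cos θ • v + sin θ • z) + B ω r.1))]
  rw [integral_prod]
  · simp
  · exact hh.integrable_comp (f := fun r : Config κ d × Config κ d =>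
      A ω (cos θ • v + sin θ • z) + B ω r.1) (Continuous.measurable (by fun_prop))

lemma integral_mixture (hK : IsMaxwellMixture β c ν A B) (hh : Integrable h (maxwellMeasure ι d β)) :
    ∫ v, mixture β ν A B h v ∂(maxwellMeasure ι d β) = ∫ v, h v ∂(maxwellMeasure ι d β) := by
  have hmp := hK.measurePreserving_affine
  refine (integral_prod _ (hmp.integrable_comp_of_integrable hh)).symm.trans ?_
  conv_rhs => rw [← hmp.map_eq]
  rw [integral_map hmp.measurable.aemeasurable]
  · rfl
  · rw [hmp.map_eq]; exact hh.aestronglyMeasurable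

/-- The entropy inequality for regular functions. -/
lemma integral_klFun_mixture_le_of_isNice (hK : IsMaxwellMixture β c ν A B) (hh : IsNice h) :
    ∫ v, klFun (mixture β ν A B h v) ∂(maxwellMeasure ι d β) +
        c * klFun (∫ v, h v ∂(maxwellMeasure ι d β)) ≤
      c * ∫ v, klFun (h v) ∂(maxwellMeasure ι d β) +
        klFun (∫ v, h v ∂(maxwellMeasure ι d β)) := by
  have hβ : 0 < β := Fact.out
  set γ := maxwellMeasure ι d β
  set k := mixture β ν A B h
  have hkn : IsNice k := hK.isNice hh
  set D₁ : ℝ → ℝ := fun θ => ∫ v, klFun (mehler β θ h v) ∂γ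
  set D₂ : ℝ → ℝ := fun θ => ∫ v, klFun (mehler β θ k v) ∂γ
  have hd1 : Differentiable ℝ D₁ := fun θ =>
    (hasDerivAt_integral_klFun_mehler hh θ).differentiableAt
  have hd2 : Differentiable ℝ D₂ := fun θ =>
    (hasDerivAt_integral_klFun_mehler hkn θ).differentiableAt
  -- De Bruijn's identity expresses both derivatives by Fisher informations with the same factor
  -- -(sin θ / β) / cos θ, and the Fisher information of the mixture is at most c times the other
  -- one. The sign of the derivative is needed only in the open interval, where cos θ > 0.
  have hanti : AntitoneOn (fun θ => c * D₁ θ - D₂ θ) (Set.Icc 0 (π / 2)) := by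
    refine antitoneOn_of_deriv_nonpos (convex_Icc _ _)
      ((hd1.const_mul c).sub hd2).continuous.continuousOn
      ((hd1.const_mul c).sub hd2).differentiableOn fun θ hθ => ?_
    rw [interior_Icc] at hθ
    have hcos : 0 < cos θ := cos_pos_of_mem_Ioo ⟨by linarith [hθ.1, pi_pos], hθ.2⟩
    have hsin : 0 < sin θ := sin_pos_of_pos_of_lt_pi hθ.1 (by linarith [hθ.2, pi_pos])
    rw [deriv_fun_sub ((hd1 θ).const_mul c) (hd2 θ), deriv_const_mul _ (hd1 θ)]
    have h1 := cos_mul_deriv_integral_klFun_mehler (β := β) hh θ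
    have h2 := cos_mul_deriv_integral_klFun_mehler (β := β) hkn θ
    have h3 : fisher β (mehler β θ k) ≤ c * fisher β (mehler β θ h) := by
      rw [show mehler β θ k = mixture β ν A B (mehler β θ h) from
        funext fun v => hK.mixture_mehler hh θ v]
      exact hK.fisher_mixture_le (hh.mehler θ)
    have h4 : cos θ * (c * deriv D₁ θ - deriv D₂ θ) ≤ 0 := by
      have : cos θ * (c * deriv D₁ θ - deriv D₂ θ) =
          -(sin θ / β) * (c * fisher β (mehler β θ h) - fisher β (mehler β θ k)) := by
        linear_combination c * h1 - h2
      rw [this]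
      have : 0 < sin θ / β := by positivity
      nlinarith
    by_contra hcon
    push Not at hcon
    nlinarith [mul_pos hcos hcon]
  -- At θ = 0 the flow is the identity, and at θ = π/2 it has replaced each function by its mean.
  have hfin := hanti (Set.left_mem_Icc.2 (by positivity)) (Set.right_mem_Icc.2 (by positivity))
    (by positivity : (0 : ℝ) ≤ π / 2)
  have hmass : ∫ v, k v ∂γ = ∫ v, h v ∂γ := by
    obtain ⟨M, hM⟩ := hh.exists_abs_le
    exact hK.integral_mixture ((integrable_const M).mono'
      hh.contDiff.continuous.aestronglyMeasurable (ae_of_all _ hM))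
  simp only [D₁, D₂, mehler_zero, mehler_pi_div_two] at hfin
  rw [hmass] at hfin
  simp only [integral_const, probReal_univ, one_smul] at hfin
  linarith

end IsMaxwellMixture

end Mixture

end KacReservoir

namespace KacReservoir

open Real InformationTheory Filter Topology ENNReal

/-! ### Mollification of bounded functions. -/

section Mollifier

variable {ι : Type} [Fintype ι] {d : ℕ}

/-- Invariance under reflection permits the substitution t ↦ x - t in convolution integrals. -/
instance : (volume : Measure (Config ι d)).IsNegInvariant := by
  have : (volume : Measure (Config ι d)).Regular :=
    Measure.Regular.of_sigmaCompactSpace_of_isLocallyFiniteMeasure _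
  exact Measure.IsAddHaarMeasure.isNegInvariant_of_regular _

variable (ι d) in
/-- A sequence of bump functions shrinking to the origin. -/
noncomputable def bump (n : ℕ) : ContDiffBump (0 : Config ι d) where
  rIn := 1 / ((n : ℝ) + 1)
  rOut := 2 / ((n : ℝ) + 1)
  rIn_pos := by positivity
  rIn_lt_rOut := by gcongr; norm_num

/-- Mollification by the normed bump functions. -/
noncomputable def mollify (n : ℕ) (g : Config ι d → ℝ) : Config ι d → ℝ :=
  convolution ((bump ι d n).normed volume) g (ContinuousLinearMap.lsmul ℝ ℝ) volume

lemma mollify_apply (n : ℕ) (g : Config ι d → ℝ) (x : Config ι d) :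
    mollify n g x = ∫ t, (bump ι d n).normed volume t * g (x - t) := rfl

lemma tendsto_mollify {g : Config ι d → ℝ} (hg : LocallyIntegrable g) :
    ∀ᵐ x, Tendsto (fun n => mollify n g x) atTop (𝓝 (g x)) := by
  refine ContDiffBump.ae_convolution_tendsto_right_of_locallyIntegrable (K := 2) ?_ ?_ hg
  · have := (tendsto_one_div_add_atTop_nhds_zero_nat (𝕜 := ℝ)).const_mul 2
    simpa [bump, mul_one_div, div_eq_mul_inv] using this
  · refine Eventually.of_forall fun n => ?_
    simp only [bump]
    rw [← mul_one_div]

lemma integrable_normed_mul (n : ℕ) {g : Config ι d → ℝ} (hg : LocallyIntegrable g)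
    (x : Config ι d) : Integrable fun t => (bump ι d n).normed volume t * g (x - t) :=
  (bump ι d n).hasCompactSupport_normed.convolutionExists_left
    (ContinuousLinearMap.lsmul ℝ ℝ) (bump ι d n).continuous_normed hg x

lemma contDiff_mollify (n : ℕ) {g : Config ι d → ℝ} (hg : LocallyIntegrable g) :
    ContDiff ℝ 1 (mollify n g) :=
  (bump ι d n).hasCompactSupport_normed.contDiff_convolution_left (n := 1) _
    (bump ι d n).contDiff_normed hg

lemma fderiv_mollify_apply (n : ℕ) {g : Config ι d → ℝ} (hg : LocallyIntegrable g)
    (x e : Config ι d) :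
    fderiv ℝ (mollify n g) x e =
      ∫ t, fderiv ℝ ((bump ι d n).normed volume) t e * g (x - t) := by
  have hs := (bump ι d n).hasCompactSupport_normed (μ := volume)
  have hd : ContDiff ℝ 1 ((bump ι d n).normed volume) := (bump ι d n).contDiff_normed
  rw [mollify, (hs.hasFDerivAt_convolution_left (ContinuousLinearMap.lsmul ℝ ℝ) hd hg x).fderiv,
    convolution, ContinuousLinearMap.integral_apply]
  · rfl
  · exact (hs.fderiv (𝕜 := ℝ)).convolutionExists_left
      ((ContinuousLinearMap.lsmul ℝ ℝ : ℝ →L[ℝ] ℝ →L[ℝ] ℝ).precompL (Config ι d))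
      (hd.continuous_fderiv one_ne_zero) hg x

/-- The bump has mass one, so the two bounds survive averaging. The derivative falls on the bump and
is therefore bounded by its L¹ norm times `b`. -/
lemma isNice_mollify (n : ℕ) {g : Config ι d → ℝ} (hg : Measurable g) {a b : ℝ} (ha : 0 < a)
    (hab : ∀ x, a ≤ g x ∧ g x ≤ b) :
    IsNice (mollify n g) ∧ ∀ x, a ≤ mollify n g x ∧ mollify n g x ≤ b := by
  have hgb : ∀ x, ‖g x‖ ≤ b := fun x => by
    rw [norm_of_nonneg (ha.le.trans (hab x).1)]; exact (hab x).2
  have hb0 : 0 ≤ b := (norm_nonneg _).trans (hgb 0)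
  have hloc : LocallyIntegrable g := fun x => ⟨Metric.ball x 1, Metric.ball_mem_nhds x one_pos,
    (integrableOn_const measure_ball_lt_top.ne).mono' hg.aestronglyMeasurable
      (ae_of_all _ hgb)⟩
  have hmass : ∀ c : ℝ, ∫ t, (bump ι d n).normed volume t * c = c := fun c => by
    rw [integral_mul_const, (bump ι d n).integral_normed, one_mul]
  have hi1 : ∀ c : ℝ, Integrable fun t => (bump ι d n).normed volume t * c := fun c =>
    (bump ι d n).integrable_normed.mul_const c
  have hbounds : ∀ x, a ≤ mollify n g x ∧ mollify n g x ≤ b := fun x => by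
    constructor
    · rw [← hmass a, mollify_apply]
      exact integral_mono (hi1 a) (integrable_normed_mul n hloc x) fun t =>
        mul_le_mul_of_nonneg_left (hab _).1 ((bump ι d n).nonneg_normed t)
    · rw [← hmass b, mollify_apply]
      exact integral_mono (integrable_normed_mul n hloc x) (hi1 b) fun t =>
        mul_le_mul_of_nonneg_left (hab _).2 ((bump ι d n).nonneg_normed t)
  refine ⟨⟨contDiff_mollify n hloc, ⟨a, b, ha, hbounds⟩,
    ⟨(∫ t, ‖fderiv ℝ ((bump ι d n).normed volume) t‖) * b, fun x => ?_⟩⟩, hbounds⟩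
  have hs := (bump ι d n).hasCompactSupport_normed (μ := volume)
  have hd : ContDiff ℝ 1 ((bump ι d n).normed volume) := (bump ι d n).contDiff_normed
  have hfi : Integrable fun t => ‖fderiv ℝ ((bump ι d n).normed volume) t‖ :=
    ((hd.continuous_fderiv one_ne_zero).integrable_of_hasCompactSupport
      (hs.fderiv (𝕜 := ℝ))).norm
  refine ContinuousLinearMap.opNorm_le_bound _
    (mul_nonneg (integral_nonneg fun _ => norm_nonneg _) hb0) fun e => ?_
  rw [fderiv_mollify_apply n hloc]
  refine (norm_integral_le_of_norm_le (g := fun t =>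
    ‖fderiv ℝ ((bump ι d n).normed volume) t‖ * (b * ‖e‖)) (hfi.mul_const _)
    (ae_of_all _ fun t => ?_)).trans_eq ?_
  · rw [norm_mul]
    calc _ ≤ (‖fderiv ℝ ((bump ι d n).normed volume) t‖ * ‖e‖) * b :=
          mul_le_mul (ContinuousLinearMap.le_opNorm _ _) (hgb _) (norm_nonneg _) (by positivity)
      _ = _ := by ring
  · rw [integral_mul_const]; ring

end Mollifier

/-! ### Removal of the regularity assumptions from the entropy inequality. -/

section Limit

variable {ι κ : Type} [Fintype ι] [Fintype κ] [DecidableEq ι] {d : ℕ} {β c : ℝ}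
  [Fact (0 < β)]
  {Ω : Type*} [MeasurableSpace Ω] {ν : Measure Ω} [IsProbabilityMeasure ν]
  {A : Ω → Config ι d →L[ℝ] Config ι d} {B : Ω → Config κ d →L[ℝ] Config ι d}

/-- `klFun` is convex and takes its minimum 0 at 1, so it decreases when its argument moves towards
1. -/
lemma klFun_le_of_mem_segment {x y : ℝ} (hx : 0 ≤ x) (hy : y ∈ segment ℝ 1 x) :
    klFun y ≤ klFun x := by
  refine (convexOn_klFun.le_max_of_mem_segment (Set.mem_Ici.2 zero_le_one) hx hy).trans ?_
  rw [klFun_one]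
  exact max_le (klFun_nonneg hx) le_rfl

/-- Truncation to the interval `[1 / (n + 1), n + 1]`. -/
noncomputable def clip (n : ℕ) (x : ℝ) : ℝ := max (min x (n + 1)) (1 / (n + 1))

lemma clip_bounds (n : ℕ) (x : ℝ) : 1 / ((n : ℝ) + 1) ≤ clip n x ∧ clip n x ≤ n + 1 := by
  have h0 : (0 : ℝ) ≤ n := n.cast_nonneg
  have h1 : 1 / ((n : ℝ) + 1) ≤ 1 := by rw [div_le_one (by positivity)]; linarith
  refine ⟨le_max_right _ _, max_le (min_le_right _ _) (by linarith)⟩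

/-- The truncation interval contains 1, so clipping moves `x` towards 1. Hence clipping never
increases the entropy. -/
lemma klFun_clip_le (n : ℕ) {x : ℝ} (hx : 0 ≤ x) : klFun (clip n x) ≤ klFun x := by
  have h0 : (0 : ℝ) ≤ n := n.cast_nonneg
  have h1 : 1 / ((n : ℝ) + 1) ≤ 1 := by rw [div_le_one (by positivity)]; linarith
  refine klFun_le_of_mem_segment hx ?_
  rw [segment_eq_uIcc, Set.mem_uIcc]
  unfold clip
  rcases le_total 1 x with h | h
  · left
    refine ⟨le_max_of_le_left (le_min h (by linarith)), max_le (min_le_left _ _) (h1.trans h)⟩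
  · right
    have : min x (n + 1) = x := min_eq_left (by linarith)
    rw [this]
    exact ⟨le_max_left _ _, max_le h h1⟩

lemma clip_le (n : ℕ) {x : ℝ} (hx : 0 ≤ x) : |clip n x| ≤ x + 1 := by
  have h0 : (0 : ℝ) ≤ n := n.cast_nonneg
  have h1 : 1 / ((n : ℝ) + 1) ≤ 1 := by rw [div_le_one (by positivity)]; linarith
  rw [abs_of_nonneg ((by positivity : (0 : ℝ) ≤ 1 / ((n : ℝ) + 1)).trans (clip_bounds n x).1)]
  exact max_le ((min_le_left _ _).trans (by linarith)) (by linarith)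

lemma tendsto_clip {x : ℝ} (hx : 0 ≤ x) : Tendsto (fun n => clip n x) atTop (𝓝 x) := by
  have h1 : Tendsto (fun n : ℕ => min x ((n : ℝ) + 1)) atTop (𝓝 x) := by
    refine tendsto_const_nhds.congr' ?_
    filter_upwards [eventually_ge_atTop ⌈x⌉₊] with n hn
    rw [min_eq_left]
    have := Nat.ceil_le.1 hn
    linarith
  have h2 := h1.max (tendsto_one_div_add_atTop_nhds_zero_nat (𝕜 := ℝ))
  rwa [max_eq_left hx] at h2

lemma measurable_clip (n : ℕ) : Measurable (clip n) := by
  unfold clip; fun_prop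

lemma measurable_ofReal_klFun : Measurable fun x : ℝ => ENNReal.ofReal (klFun x) :=
  measurable_klFun.ennreal_ofReal

lemma continuous_ofReal_klFun : Continuous fun x : ℝ => ENNReal.ofReal (klFun x) :=
  ENNReal.continuous_ofReal.comp continuous_klFun

namespace IsMaxwellMixture

lemma aestronglyMeasurable_mixture (hK : IsMaxwellMixture β c ν A B) {h : Config ι d → ℝ}
    (hh : Measurable h) :
    AEStronglyMeasurable (mixture β ν A B h) (maxwellMeasure ι d β) :=
  ((hh.comp hK.measurePreserving_affine.measurable).stronglyMeasurable.integral_prod_right'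
    (ν := ν.prod (maxwellMeasure κ d β))).aestronglyMeasurable

/-- The entropy inequality passes to dominated limits. -/
lemma lintegral_klFun_mixture_le_of_tendsto (hK : IsMaxwellMixture β c ν A B)
    {h : ℕ → Config ι d → ℝ} {h' H : Config ι d → ℝ} {e : ℕ → ℝ≥0∞} {e' : ℝ≥0∞}
    (hm : ∀ n, Measurable (h n))
    (hH : Integrable H (maxwellMeasure ι d β))
    (hle : ∀ n, ∀ᵐ x ∂(maxwellMeasure ι d β), ‖h n x‖ ≤ H x)
    (hlim : ∀ᵐ x ∂(maxwellMeasure ι d β), Tendsto (fun n => h n x) atTop (𝓝 (h' x)))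
    (he : Tendsto e atTop (𝓝 e'))
    (hineq : ∀ n, ∫⁻ v, ENNReal.ofReal (klFun (mixture β ν A B (h n) v)) ∂(maxwellMeasure ι d β) ≤
      ENNReal.ofReal c * e n +
        ENNReal.ofReal (klFun (∫ v, h n v ∂(maxwellMeasure ι d β)))) :
    ∫⁻ v, ENNReal.ofReal (klFun (mixture β ν A B h' v)) ∂(maxwellMeasure ι d β) ≤
      ENNReal.ofReal c * e' +
        ENNReal.ofReal (klFun (∫ v, h' v ∂(maxwellMeasure ι d β))) := by
  set γ := maxwellMeasure ι d β
  set τ := ν.prod (maxwellMeasure κ d β)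
  have hmp : MeasurePreserving (fun p : Config ι d × (Ω × Config κ d) =>
      A p.2.1 p.1 + B p.2.1 p.2.2) (γ.prod τ) γ := hK.measurePreserving_affine
  have hk : ∀ᵐ v ∂γ, Tendsto (fun n => mixture β ν A B (h n) v) atTop
      (𝓝 (mixture β ν A B h' v)) := by
    -- Null sets and the dominating function `H` are pulled back along (v, ω, w) ↦ A v + B w, which
    -- maps the product law to the Maxwellian.
    have h1 : ∀ᵐ v ∂γ, ∀ᵐ q ∂τ, Tendsto (fun n => h n (A q.1 v + B q.1 q.2)) atTop
        (𝓝 (h' (A q.1 v + B q.1 q.2))) :=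
      Measure.ae_ae_of_ae_prod (hmp.quasiMeasurePreserving.ae hlim)
    have h2 : ∀ᵐ v ∂γ, ∀ᵐ q ∂τ, ∀ n, ‖h n (A q.1 v + B q.1 q.2)‖ ≤ H (A q.1 v + B q.1 q.2) :=
      Measure.ae_ae_of_ae_prod (hmp.quasiMeasurePreserving.ae (ae_all_iff.2 hle))
    have h3 : ∀ᵐ v ∂γ, Integrable (fun q => H (A q.1 v + B q.1 q.2)) τ :=
      (hmp.integrable_comp_of_integrable hH).prod_right_ae
    filter_upwards [h1, h2, h3] with v h1 h2 h3
    refine tendsto_integral_of_dominated_convergence _ (fun n => ?_) h3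
      (fun n => h2.mono fun q hq => hq n) h1
    exact ((hm n).comp (hmp.measurable.comp
      (measurable_const.prodMk measurable_id))).aestronglyMeasurable
  have hmass : Tendsto (fun n => ∫ v, h n v ∂γ) atTop (𝓝 (∫ v, h' v ∂γ)) :=
    tendsto_integral_of_dominated_convergence H (fun n => (hm n).aestronglyMeasurable) hH hle hlim
  have hrhs : Tendsto (fun n => ENNReal.ofReal c * e n +
      ENNReal.ofReal (klFun (∫ v, h n v ∂γ))) atTop
      (𝓝 (ENNReal.ofReal c * e' + ENNReal.ofReal (klFun (∫ v, h' v ∂γ)))) :=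
    (ENNReal.Tendsto.const_mul he (Or.inr ENNReal.ofReal_ne_top)).add
      ((continuous_ofReal_klFun.tendsto _).comp hmass)
  calc ∫⁻ v, ENNReal.ofReal (klFun (mixture β ν A B h' v)) ∂γ
      = ∫⁻ v, liminf (fun n => ENNReal.ofReal (klFun (mixture β ν A B (h n) v))) atTop ∂γ := by
        refine lintegral_congr_ae (hk.mono fun v hv => ?_)
        exact (((continuous_ofReal_klFun.tendsto _).comp hv).liminf_eq).symm
    _ ≤ liminf (fun n => ∫⁻ v, ENNReal.ofReal (klFun (mixture β ν A B (h n) v)) ∂γ) atTop :=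
        lintegral_liminf_le' fun n => measurable_ofReal_klFun.comp_aemeasurable
          (hK.aestronglyMeasurable_mixture (hm n)).aemeasurable
    _ ≤ liminf (fun n => ENNReal.ofReal c * e n +
          ENNReal.ofReal (klFun (∫ v, h n v ∂γ))) atTop :=
        liminf_le_liminf (Eventually.of_forall hineq)
    _ = _ := hrhs.liminf_eq

lemma lintegral_klFun_mixture_le_of_isNice (hK : IsMaxwellMixture β c ν A B) (hc : 0 ≤ c)
    {h : Config ι d → ℝ} (hh : IsNice h) :
    ∫⁻ v, ENNReal.ofReal (klFun (mixture β ν A B h v)) ∂(maxwellMeasure ι d β) ≤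
      ENNReal.ofReal c * ∫⁻ v, ENNReal.ofReal (klFun (h v)) ∂(maxwellMeasure ι d β) +
        ENNReal.ofReal (klFun (∫ v, h v ∂(maxwellMeasure ι d β))) := by
  have hint : ∀ {g : Config ι d → ℝ}, IsNice g →
      ∫⁻ v, ENNReal.ofReal (klFun (g v)) ∂(maxwellMeasure ι d β) =
        ENNReal.ofReal (∫ v, klFun (g v) ∂(maxwellMeasure ι d β)) := fun {g} hg => by
    obtain ⟨M, hM⟩ := hg.exists_abs_klFun_le
    refine (ofReal_integral_eq_lintegral_ofReal ((integrable_const M).mono'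
      (continuous_klFun.comp hg.contDiff.continuous).aestronglyMeasurable (ae_of_all _ hM))
      (ae_of_all _ fun v => klFun_nonneg (hg.pos v).le)).symm
  have hm0 : 0 ≤ ∫ v, h v ∂(maxwellMeasure ι d β) := integral_nonneg fun v => (hh.pos v).le
  rw [hint (hK.isNice hh), hint hh, ← ENNReal.ofReal_mul hc, ← ENNReal.ofReal_add]
  · refine ENNReal.ofReal_le_ofReal ?_
    have := hK.integral_klFun_mixture_le_of_isNice hh
    have := mul_nonneg hc (klFun_nonneg hm0)
    linarith
  · exact mul_nonneg hc (integral_nonneg fun v => klFun_nonneg (hh.pos v).le)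
  · exact klFun_nonneg hm0

/-- The entropy inequality for a Maxwell mixture. -/
lemma lintegral_klFun_mixture_le (hK : IsMaxwellMixture β c ν A B) (hc : 0 ≤ c)
    {h : Config ι d → ℝ} (hm : Measurable h) (h0 : ∀ v, 0 ≤ h v)
    (hi : Integrable h (maxwellMeasure ι d β)) (h1 : ∫ v, h v ∂(maxwellMeasure ι d β) = 1) :
    ∫⁻ v, ENNReal.ofReal (klFun (mixture β ν A B h v)) ∂(maxwellMeasure ι d β) ≤
      ENNReal.ofReal c * ∫⁻ v, ENNReal.ofReal (klFun (h v)) ∂(maxwellMeasure ι d β) := by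
  -- Inner limit, at a fixed level of clipping. The mollified functions take values in one compact
  -- interval, where `klFun` is bounded, so their entropies converge by dominated convergence.
  have key : ∀ n : ℕ,
      ∫⁻ v, ENNReal.ofReal (klFun (mixture β ν A B (fun x => clip n (h x)) v))
        ∂(maxwellMeasure ι d β) ≤
      ENNReal.ofReal c * ∫⁻ v, ENNReal.ofReal (klFun (clip n (h v))) ∂(maxwellMeasure ι d β) +
        ENNReal.ofReal (klFun (∫ v, clip n (h v) ∂(maxwellMeasure ι d β))) := fun n => by
    have hg : Measurable fun x => clip n (h x) := (measurable_clip n).comp hm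
    have hpos : (0 : ℝ) < 1 / ((n : ℝ) + 1) := by positivity
    have hmol := fun m => isNice_mollify m hg hpos fun x => clip_bounds n (h x)
    have hgb : ∀ x, ‖clip n (h x)‖ ≤ (n : ℝ) + 1 := fun x => by
      rw [norm_of_nonneg (hpos.le.trans (clip_bounds n _).1)]; exact (clip_bounds n _).2
    have hloc : LocallyIntegrable fun x => clip n (h x) := fun x =>
      ⟨Metric.ball x 1, Metric.ball_mem_nhds x one_pos,
        (integrableOn_const measure_ball_lt_top.ne).mono' hg.aestronglyMeasurable
          (ae_of_all _ hgb)⟩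
    have hlim : ∀ᵐ x ∂(maxwellMeasure ι d β),
        Tendsto (fun m => mollify m (fun x => clip n (h x)) x) atTop (𝓝 (clip n (h x))) :=
      (maxwellMeasure_absolutelyContinuous (β := β)).ae_le (tendsto_mollify hloc)
    have hb : ∀ m x, ‖mollify m (fun x => clip n (h x)) x‖ ≤ (n : ℝ) + 1 := fun m x => by
      rw [norm_of_nonneg (hpos.le.trans ((hmol m).2 x).1)]; exact ((hmol m).2 x).2
    refine hK.lintegral_klFun_mixture_le_of_tendsto
      (h := fun m => mollify m fun x => clip n (h x)) (H := fun _ => (n : ℝ) + 1)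
      (fun m => (hmol m).1.contDiff.continuous.measurable) (integrable_const _)
      (fun m => ae_of_all _ (hb m)) hlim ?_
      (fun m => hK.lintegral_klFun_mixture_le_of_isNice hc (hmol m).1)
    obtain ⟨M, hM⟩ := isCompact_Icc (a := 1 / ((n : ℝ) + 1)) (b := (n : ℝ) + 1)
      |>.exists_bound_of_continuousOn continuous_klFun.continuousOn
    refine tendsto_lintegral_of_dominated_convergence' (fun _ => ENNReal.ofReal M)
      (fun m => (measurable_ofReal_klFun.comp
        (hmol m).1.contDiff.continuous.measurable).aemeasurable)
      (fun m => ae_of_all _ fun x => ENNReal.ofReal_le_ofReal ?_) ?_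
      (hlim.mono fun x hx => (continuous_ofReal_klFun.tendsto _).comp hx)
    · exact (le_abs_self _).trans (hM _ ((hmol m).2 x))
    · simp
  -- Outer limit in the level of clipping. The entropies on the right are bounded by that of `h`
  -- through `klFun_clip_le`, so a constant sequence suffices. Clipping destroys the normalization,
  -- but the term with the mean tends to `klFun` 1 = 0.
  have := hK.lintegral_klFun_mixture_le_of_tendsto (h := fun n x => clip n (h x))
    (h' := h) (H := fun x => h x + 1)
    (e := fun _ => ∫⁻ v, ENNReal.ofReal (klFun (h v)) ∂(maxwellMeasure ι d β))
    (fun n => (measurable_clip n).comp hm) (hi.add (integrable_const _))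
    (fun n => ae_of_all _ fun x => clip_le n (h0 x))
    (ae_of_all _ fun x => tendsto_clip (h0 x)) tendsto_const_nhds
    (fun n => (key n).trans (by
      gcongr
      exact klFun_clip_le n (h0 _)))
  simpa [h1, klFun_one] using this

end IsMaxwellMixture

end Limit

end KacReservoir

namespace KacReservoir

open Real InformationTheory Filter Topology ENNReal

/-! ### Finiteness of the initial entropy by a Sobolev inequality. -/

section Sobolev

variable {ι : Type} [Fintype ι] {d : ℕ}

/-- A Sobolev inequality with a weaker exponent, valid in every positive dimension. -/
lemma exists_lintegral_rpow_le {E : Type*} [NormedAddCommGroup E] [NormedSpace ℝ E]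
    [MeasurableSpace E] [BorelSpace E] [FiniteDimensional ℝ E] (μ : Measure E)
    [μ.IsAddHaarMeasure] {p : ℝ} (hp : ((Module.finrank ℝ E : ℝ) + 1).HolderConjugate p) :
    ∃ C : ℝ≥0∞, C ≠ ∞ ∧ ∀ u : E → ℝ, ContDiff ℝ 1 u → HasCompactSupport u →
      ∫⁻ x, ‖u x‖ₑ ^ p ∂μ ≤ C * (∫⁻ x, ‖fderiv ℝ u x‖ₑ ∂μ + ∫⁻ x, ‖u x‖ₑ ∂μ) ^ p := by
  have hp1 : 0 < p := hp.symm.pos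
  -- Multiplying by a bump in one extra real variable raises the dimension from n to n + 1. The
  -- Gagliardo-Nirenberg-Sobolev exponent is then (n + 1)/n, which is finite also for n = 1.
  set η : ContDiffBump (0 : ℝ) := ⟨1, 2, one_pos, one_lt_two⟩
  have hηc : ContDiff ℝ 1 η := η.contDiff
  have hηs : HasCompactSupport η := η.hasCompactSupport
  have : (μ.prod (volume : Measure ℝ)).IsAddHaarMeasure := Measure.prod.instIsAddHaarMeasure _ _
  set S : ℝ≥0∞ := ↑(lintegralPowLePowLIntegralFDerivConst (μ.prod (volume : Measure ℝ)) p)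
  set a : ℝ≥0∞ := ∫⁻ s, ‖η s‖ₑ ^ p
  set b : ℝ≥0∞ := ∫⁻ s, ‖η s‖ₑ
  set c : ℝ≥0∞ := ∫⁻ s, ‖fderiv ℝ η s‖ₑ
  have ha0 : a ≠ 0 := by
    intro h
    rw [lintegral_eq_zero_iff (by
      exact (hηc.continuous.measurable.enorm).pow_const p)] at h
    have h2 : volume (Metric.ball (0 : ℝ) 1) = 0 := by
      refine measure_mono_null (fun s hs => ?_) (ae_iff.1 h)
      have : η s = 1 := η.one_of_mem_closedBall (Metric.ball_subset_closedBall hs)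
      simp [this]
    simp at h2
  have hb : b ≠ ∞ := (hηc.continuous.integrable_of_hasCompactSupport hηs).2.ne
  have hc : c ≠ ∞ := ((hηc.continuous_fderiv one_ne_zero).integrable_of_hasCompactSupport
    (hηs.fderiv (𝕜 := ℝ))).2.ne
  refine ⟨a⁻¹ * (S * (b + c) ^ p), ?_, fun u hu hus => ?_⟩
  · refine ENNReal.mul_ne_top (ENNReal.inv_ne_top.2 ha0) (ENNReal.mul_ne_top ENNReal.coe_ne_top ?_)
    exact ENNReal.rpow_ne_top_of_nonneg hp1.le (ENNReal.add_ne_top.2 ⟨hb, hc⟩)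
  set U : E × ℝ → ℝ := fun q => u q.1 * η q.2
  have hU : ContDiff ℝ 1 U := (hu.comp contDiff_fst).mul (hηc.comp contDiff_snd)
  have hUs : HasCompactSupport U := by
    refine HasCompactSupport.intro (hus.isCompact.prod hηs.isCompact) fun q hq => ?_
    rw [Set.mem_prod, not_and_or] at hq
    rcases hq with h | h
    · simp [U, image_eq_zero_of_notMem_tsupport h]
    · simp [U, image_eq_zero_of_notMem_tsupport h]
  have hfr : (Module.finrank ℝ (E × ℝ) : ℝ).HolderConjugate p := by
    rw [Module.finrank_prod, Module.finrank_self]; push_cast; exact hp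
  have key := lintegral_pow_le_pow_lintegral_fderiv (μ.prod (volume : Measure ℝ)) hU hUs hfr
  have hlhs : ∫⁻ q, ‖U q‖ₑ ^ p ∂(μ.prod volume) = (∫⁻ x, ‖u x‖ₑ ^ p ∂μ) * a := by
    rw [← lintegral_prod_mul]
    · congr 1; funext q
      simp only [U, enorm_mul, ENNReal.mul_rpow_of_nonneg _ _ hp1.le]
    · exact (hu.continuous.measurable.enorm.pow_const p).aemeasurable
    · exact (hηc.continuous.measurable.enorm.pow_const p).aemeasurable
  have hder : ∀ q : E × ℝ, ‖fderiv ℝ U q‖ₑ ≤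
      ‖fderiv ℝ u q.1‖ₑ * ‖η q.2‖ₑ + ‖u q.1‖ₑ * ‖fderiv ℝ η q.2‖ₑ := by
    intro q
    have h1 : HasFDerivAt (fun q : E × ℝ => u q.1)
        ((fderiv ℝ u q.1).comp (ContinuousLinearMap.fst ℝ E ℝ)) q :=
      (hu.differentiable one_ne_zero _).hasFDerivAt.comp q hasFDerivAt_fst
    have h2 : HasFDerivAt (fun q : E × ℝ => η q.2)
        ((fderiv ℝ η q.2).comp (ContinuousLinearMap.snd ℝ E ℝ)) q :=
      (hηc.differentiable one_ne_zero _).hasFDerivAt.comp q hasFDerivAt_snd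
    have h3 : fderiv ℝ U q = η q.2 • (fderiv ℝ u q.1).comp (ContinuousLinearMap.fst ℝ E ℝ) +
        u q.1 • (fderiv ℝ η q.2).comp (ContinuousLinearMap.snd ℝ E ℝ) := by
      rw [add_comm]; exact (h1.mul h2).fderiv
    have h4 : ‖fderiv ℝ U q‖ ≤ ‖fderiv ℝ u q.1‖ * ‖η q.2‖ + ‖u q.1‖ * ‖fderiv ℝ η q.2‖ := by
      rw [h3]
      refine (norm_add_le _ _).trans (add_le_add ?_ ?_)
      · rw [norm_smul, mul_comm]
        gcongr
        exact (ContinuousLinearMap.opNorm_comp_le _ _).trans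
          (mul_le_of_le_one_right (norm_nonneg _) (ContinuousLinearMap.norm_fst_le _ _ _))
      · rw [norm_smul]
        gcongr
        exact (ContinuousLinearMap.opNorm_comp_le _ _).trans
          (mul_le_of_le_one_right (norm_nonneg _) (ContinuousLinearMap.norm_snd_le _ _ _))
    simp only [← ofReal_norm]
    rw [← ENNReal.ofReal_mul (norm_nonneg _), ← ENNReal.ofReal_mul (norm_nonneg _),
      ← ENNReal.ofReal_add (by positivity) (by positivity)]
    exact ENNReal.ofReal_le_ofReal h4
  have hrhs : ∫⁻ q, ‖fderiv ℝ U q‖ₑ ∂(μ.prod volume) ≤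
      (b + c) * (∫⁻ x, ‖fderiv ℝ u x‖ₑ ∂μ + ∫⁻ x, ‖u x‖ₑ ∂μ) := by
    have hm1 : Measurable fun x => ‖fderiv ℝ u x‖ₑ :=
      (hu.continuous_fderiv one_ne_zero).measurable.enorm
    have hm2 : Measurable fun x => ‖u x‖ₑ := hu.continuous.measurable.enorm
    have hm3 : Measurable fun x => ‖fderiv ℝ η x‖ₑ :=
      (hηc.continuous_fderiv one_ne_zero).measurable.enorm
    have hm4 : Measurable fun x => ‖η x‖ₑ := hηc.continuous.measurable.enorm
    calc _ ≤ ∫⁻ q : E × ℝ, (‖fderiv ℝ u q.1‖ₑ * ‖η q.2‖ₑ + ‖u q.1‖ₑ * ‖fderiv ℝ η q.2‖ₑ)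
          ∂(μ.prod volume) := lintegral_mono hder
      _ = (∫⁻ x, ‖fderiv ℝ u x‖ₑ ∂μ) * b + (∫⁻ x, ‖u x‖ₑ ∂μ) * c := by
          have hm5 : Measurable fun q : E × ℝ => ‖fderiv ℝ u q.1‖ₑ * ‖η q.2‖ₑ :=
            (hm1.comp measurable_fst).mul (hm4.comp measurable_snd)
          rw [lintegral_add_left hm5,
            lintegral_prod_mul hm1.aemeasurable hm4.aemeasurable,
            lintegral_prod_mul hm2.aemeasurable hm3.aemeasurable]
      _ ≤ _ := by
          rw [mul_add, mul_comm _ b, mul_comm _ c]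
          gcongr
          · exact le_self_add
          · exact le_add_self
  rw [hlhs] at key
  have ha1 : a ≠ ∞ := by
    have := (hηc.continuous.norm.rpow_const (p := p) fun _ => Or.inr hp1.le)
      |>.integrable_of_hasCompactSupport (μ := volume) (hηs.comp_left (g := fun x : ℝ => ‖x‖ ^ p) (by
        simp [hp1.ne']))
    have h2 := this.2.ne
    convert h2 using 2
    funext s
    rw [Real.enorm_rpow_of_nonneg (norm_nonneg _) hp1.le, enorm_norm]
  calc ∫⁻ x, ‖u x‖ₑ ^ p ∂μ = a⁻¹ * ((∫⁻ x, ‖u x‖ₑ ^ p ∂μ) * a) := by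
        rw [mul_comm _ a, ← mul_assoc, ENNReal.inv_mul_cancel ha0 ha1, one_mul]
    _ ≤ a⁻¹ * (S * ((b + c) * (∫⁻ x, ‖fderiv ℝ u x‖ₑ ∂μ + ∫⁻ x, ‖u x‖ₑ ∂μ)) ^ p) := by
        refine mul_le_mul_right (key.trans ?_) _
        exact mul_le_mul_right (ENNReal.rpow_le_rpow hrhs hp1.le) _
    _ = _ := by rw [ENNReal.mul_rpow_of_nonneg _ _ hp1.le]; ring

/-- Jensen's inequality: the variance of `g` about its local mean m is nonnegative. -/
lemma sq_mollify_le (n : ℕ) {g : Config ι d → ℝ} (hg : MemLp g 2) (x : Config ι d) :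
    mollify n g x ^ 2 ≤ mollify n (fun y => g y ^ 2) x := by
  have h1 := integrable_normed_mul n (hg.locallyIntegrable (by norm_num)) x
  have h2 := integrable_normed_mul n hg.integrable_sq.locallyIntegrable x
  have h3 := (bump ι d n).integrable_normed (μ := volume)
  set m := mollify n g x with hm
  have h4 : 0 ≤ ∫ t, (bump ι d n).normed volume t * (g (x - t) - m) ^ 2 :=
    integral_nonneg fun t => mul_nonneg ((bump ι d n).nonneg_normed t) (sq_nonneg _)
  have h5 : ∀ t, (bump ι d n).normed volume t * (g (x - t) - m) ^ 2 =
      (bump ι d n).normed volume t * g (x - t) ^ 2 -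
        2 * m * ((bump ι d n).normed volume t * g (x - t)) +
        m ^ 2 * (bump ι d n).normed volume t := fun t => by ring
  simp_rw [h5] at h4
  have h12 : Integrable fun t => (bump ι d n).normed volume t * g (x - t) ^ 2 -
      2 * m * ((bump ι d n).normed volume t * g (x - t)) := h2.sub (h1.const_mul _)
  rw [integral_add h12 (h3.const_mul _), integral_sub h2 (h1.const_mul _), integral_const_mul, integral_const_mul,
    (bump ι d n).integral_normed, ← mollify_apply n g, ← hm] at h4
  rw [mollify_apply]
  linarith

lemma integrable_sq_mollify (n : ℕ) {g : Config ι d → ℝ} (hg : MemLp g 2) :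
    Integrable (fun x => mollify n g x ^ 2) ∧ ∫ x, mollify n g x ^ 2 ≤ ∫ x, g x ^ 2 := by
  have h1 : Integrable (mollify n fun y => g y ^ 2) :=
    (bump ι d n).integrable_normed.integrable_convolution (ContinuousLinearMap.lsmul ℝ ℝ)
      hg.integrable_sq
  have h2 : ∫ x, mollify n (fun y => g y ^ 2) x = ∫ x, g x ^ 2 := by
    refine (integral_convolution (ContinuousLinearMap.lsmul ℝ ℝ)
      (bump ι d n).integrable_normed hg.integrable_sq).trans ?_
    rw [(bump ι d n).integral_normed]
    simp
  have h3 : Integrable (fun x => mollify n g x ^ 2) := by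
    refine h1.mono' ?_ (ae_of_all _ fun x => ?_)
    · exact ((contDiff_mollify n (hg.locallyIntegrable (by norm_num))).continuous.pow
        2).aestronglyMeasurable
    · rw [norm_of_nonneg (sq_nonneg _)]
      exact sq_mollify_le n hg x
  exact ⟨h3, h2 ▸ integral_mono h3 h1 (sq_mollify_le n hg)⟩

/-- The reflected and translated bump s ↦ η(x - s) is an admissible test function. The sign from the
reflection cancels the sign in the definition of the weak derivative. -/
lemma fderiv_mollify_unitVec [DecidableEq ι] (n : ℕ) {g G : Config ι d → ℝ}
    (hg : LocallyIntegrable g) {i : ι} {a : Fin d} (hG : IsWeakPartial i a g G)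
    (x : Config ι d) : fderiv ℝ (mollify n g) x (unitVec i a) = mollify n G x := by
  have hsm : ContDiff ℝ (⊤ : ℕ∞) ((bump ι d n).normed volume) := (bump ι d n).contDiff_normed
  have hs := (bump ι d n).hasCompactSupport_normed (μ := volume)
  have h1 := hG (fun s => (bump ι d n).normed volume (x - s))
    (hsm.comp (contDiff_const.sub contDiff_id))
    (hs.comp_homeomorph (Homeomorph.subLeft x))
  have h2 : ∀ s, fderiv ℝ (fun s => (bump ι d n).normed volume (x - s)) s (unitVec i a) =
      -fderiv ℝ ((bump ι d n).normed volume) (x - s) (unitVec i a) := fun s => by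
    have h3 : HasFDerivAt (fun s : Config ι d => x - s)
        (-ContinuousLinearMap.id ℝ (Config ι d)) s := (hasFDerivAt_id s).const_sub x
    have h4 := ((hsm.differentiable (by simp)) (x - s)).hasFDerivAt.comp s h3
    have h5 : fderiv ℝ (fun s => (bump ι d n).normed volume (x - s)) s = _ := h4.fderiv
    rw [h5]
    simp
  simp_rw [h2, mul_neg, integral_neg] at h1
  rw [fderiv_mollify_apply n hg, mollify_apply]
  have h6 := integral_sub_left_eq_self
    (fun t => fderiv ℝ ((bump ι d n).normed volume) t (unitVec i a) * g (x - t)) volume x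
  have h7 := integral_sub_left_eq_self
    (fun t => (bump ι d n).normed volume t * G (x - t)) volume x
  rw [← h6, ← h7]
  simp_rw [_root_.sub_sub_cancel, mul_comm (fderiv ℝ _ _ _), mul_comm ((bump ι d n).normed volume _)]
  linarith

lemma norm_le_sum_abs_unitVec [DecidableEq ι] (ℓ : Config ι d →L[ℝ] ℝ) :
    ‖ℓ‖ ≤ ∑ p : ι × Fin d, |ℓ (unitVec p.1 p.2)| := by
  refine ℓ.opNorm_le_bound (Finset.sum_nonneg fun _ _ => abs_nonneg _) fun u => ?_
  rw [map_eq_sum, Finset.sum_mul]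
  refine (norm_sum_le _ _).trans (Finset.sum_le_sum fun p _ => ?_)
  rw [norm_mul, mul_comm]
  exact mul_le_mul_of_nonneg_left (abs_coord_le u _ _) (norm_nonneg _)

lemma sq_norm_le_sum_sq_unitVec [DecidableEq ι] (ℓ : Config ι d →L[ℝ] ℝ) :
    ‖ℓ‖ ^ 2 ≤ (Fintype.card (ι × Fin d) : ℝ) * ∑ p : ι × Fin d, ℓ (unitVec p.1 p.2) ^ 2 := by
  calc ‖ℓ‖ ^ 2 ≤ (∑ p : ι × Fin d, |ℓ (unitVec p.1 p.2)|) ^ 2 := by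
        gcongr; exact norm_le_sum_abs_unitVec ℓ
    _ ≤ _ := by
        refine sq_sum_le_card_mul_sum_sq.trans_eq ?_
        simp

/-- The square of an `H¹` function has integrable powers of order greater than one. -/
lemma lintegral_sq_rpow_lt_top [DecidableEq ι] {g : Config ι d → ℝ} (hg : MemH1 g) {p : ℝ}
    (hp : ((Module.finrank ℝ (Config ι d) : ℝ) + 1).HolderConjugate p) :
    ∫⁻ x, ENNReal.ofReal (g x ^ 2) ^ p < ∞ := by
  obtain ⟨hg2, hpart⟩ := hg
  choose G hG2 hGw using hpart
  have hp1 : 0 < p := hp.symm.pos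
  have hloc : LocallyIntegrable g := hg2.locallyIntegrable (by norm_num)
  obtain ⟨C, hC, hsob⟩ := exists_lintegral_rpow_le (volume : Measure (Config ι d)) hp
  set χ : ContDiffBump (0 : Config ι d) := ⟨1, 2, one_pos, one_lt_two⟩
  have hχc : ContDiff ℝ 1 χ := χ.contDiff
  obtain ⟨K, hK⟩ := (hχc.continuous_fderiv one_ne_zero).bounded_above_of_compact_support
    (χ.hasCompactSupport.fderiv (𝕜 := ℝ))
  have hK0 : 0 ≤ K := (norm_nonneg _).trans (hK 0)
  set r : ℕ → ℝ := fun n => 1 / ((n : ℝ) + 1)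
  have hr0 : ∀ n, 0 < r n := fun n => by positivity
  have hr1 : ∀ n, r n ≤ 1 := fun n => by
    have : (0 : ℝ) ≤ n := n.cast_nonneg
    simp only [r]; rw [div_le_one (by positivity)]; linarith
  set χn : ℕ → Config ι d → ℝ := fun n x => χ (r n • x)
  have hχn : ∀ n, ContDiff ℝ 1 (χn n) := fun n => hχc.comp (contDiff_const_smul (r n))
  have hχnd : ∀ n x, ‖fderiv ℝ (χn n) x‖ ≤ K := fun n x => by
    have h3 : HasFDerivAt (fun s : Config ι d => r n • s)
        (r n • ContinuousLinearMap.id ℝ (Config ι d)) x := (hasFDerivAt_id x).const_smul (r n)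
    have h5 : fderiv ℝ (χn n) x = _ :=
      (((hχc.differentiable one_ne_zero) (r n • x)).hasFDerivAt.comp x h3).fderiv
    rw [h5]
    refine (ContinuousLinearMap.opNorm_comp_le _ _).trans ?_
    have h6 : ‖r n • ContinuousLinearMap.id ℝ (Config ι d)‖ ≤ 1 := by
      rw [norm_smul, norm_of_nonneg (hr0 n).le]
      exact mul_le_one₀ (hr1 n) (norm_nonneg _) ContinuousLinearMap.norm_id_le
    calc _ ≤ K * 1 := mul_le_mul (hK _) h6 (norm_nonneg _) hK0
      _ = K := mul_one K
  have hχ01 : ∀ n x, |χn n x| ≤ 1 := fun n x => by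
    rw [abs_of_nonneg χ.nonneg]; exact χ.le_one
  set gn : ℕ → Config ι d → ℝ := fun n => mollify n g
  have hgn : ∀ n, ContDiff ℝ 1 (gn n) := fun n => contDiff_mollify n hloc
  -- Squares of cut off mollifications. The derivative of a square is a product of two L² functions,
  -- so u_n and its gradient are bounded in L¹ uniformly in n, and the L¹ Sobolev inequality
  -- applies.
  set u : ℕ → Config ι d → ℝ := fun n x => (χn n x * gn n x) ^ 2
  have hu : ∀ n, ContDiff ℝ 1 (u n) := fun n => ((hχn n).mul (hgn n)).pow 2
  have hus : ∀ n, HasCompactSupport (u n) := fun n => by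
    have h1 : HasCompactSupport (χn n) :=
      χ.hasCompactSupport.comp_homeomorph (Homeomorph.smulOfNeZero (r n) (hr0 n).ne')
    refine h1.mono fun x hx => ?_
    contrapose! hx
    simp only [Function.mem_support, not_not] at hx ⊢
    simp [u, hx]
  set J : ℝ := (Fintype.card (ι × Fin d) : ℝ)
  set D : ℕ → Config ι d → ℝ := fun n x => ∑ p : ι × Fin d, mollify n (G p.1 p.2) x ^ 2
  have hDn : ∀ n x, ‖fderiv ℝ (gn n) x‖ ^ 2 ≤ J * D n x := fun n x => by
    refine (sq_norm_le_sum_sq_unitVec _).trans_eq ?_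
    simp only [gn, D, J, fderiv_mollify_unitVec n hloc (hGw _ _)]
  have hDi : ∀ n, Integrable (D n) := fun n =>
    integrable_finsetSum _ fun p _ => (integrable_sq_mollify n (hG2 p.1 p.2)).1
  set Q : ℝ := ∫ x, g x ^ 2
  set R : ℝ := ∑ p : ι × Fin d, ∫ x, G p.1 p.2 x ^ 2
  have hDR : ∀ n, ∫ x, D n x ≤ R := fun n => by
    rw [integral_finsetSum _ fun p _ => (integrable_sq_mollify n (hG2 p.1 p.2)).1]
    exact Finset.sum_le_sum fun p _ => (integrable_sq_mollify n (hG2 p.1 p.2)).2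
  have hud : ∀ n x, ‖fderiv ℝ (u n) x‖ + ‖u n x‖ ≤ (2 + 2 * K) * gn n x ^ 2 + J * D n x := by
    intro n x
    have h1 : HasFDerivAt (fun x => χn n x * gn n x)
        (χn n x • fderiv ℝ (gn n) x + gn n x • fderiv ℝ (χn n) x) x :=
      ((hχn n).differentiable one_ne_zero x).hasFDerivAt.mul
        ((hgn n).differentiable one_ne_zero x).hasFDerivAt
    have h2 : fderiv ℝ (u n) x = _ := (h1.pow 2).fderiv
    have h3 : ‖χn n x • fderiv ℝ (gn n) x + gn n x • fderiv ℝ (χn n) x‖ ≤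
        ‖fderiv ℝ (gn n) x‖ + |gn n x| * K := by
      refine (norm_add_le _ _).trans (add_le_add ?_ ?_)
      · rw [norm_smul]; exact mul_le_of_le_one_left (norm_nonneg _) (hχ01 n x)
      · rw [norm_smul]; exact mul_le_mul_of_nonneg_left (hχnd n x) (abs_nonneg _)
    have h4 : |χn n x * gn n x| ≤ |gn n x| := by
      rw [abs_mul]; exact mul_le_of_le_one_left (abs_nonneg _) (hχ01 n x)
    have h5 : ‖u n x‖ ≤ gn n x ^ 2 := by
      simp only [u]
      rw [norm_pow, ← sq_abs (gn n x)]
      exact pow_le_pow_left₀ (norm_nonneg _) h4 2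
    have h6 : ‖fderiv ℝ (u n) x‖ ≤ 2 * |gn n x| * (‖fderiv ℝ (gn n) x‖ + |gn n x| * K) := by
      rw [h2, norm_smul]
      refine mul_le_mul ?_ h3 (norm_nonneg _) (by positivity)
      simp only [norm_mul, nsmul_eq_mul, Nat.add_one_sub_one, pow_one, Nat.cast_ofNat]
      rw [norm_ofNat, ← norm_mul]
      exact mul_le_mul_of_nonneg_left h4 zero_le_two
    have h7 := hDn n x
    -- The product 2|g||∇g| is split into g² + |∇g|², the cutoff contributes 2K g², and u_n itself
    -- contributes a last g².
    nlinarith [sq_nonneg (|gn n x| - ‖fderiv ℝ (gn n) x‖), sq_abs (gn n x)]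
  have hbound : ∀ n, (∫⁻ x, ‖fderiv ℝ (u n) x‖ₑ) + ∫⁻ x, ‖u n x‖ₑ ≤
      ENNReal.ofReal ((2 + 2 * K) * Q + J * R) := fun n => by
    rw [← lintegral_add_left ((hu n).continuous_fderiv one_ne_zero).measurable.enorm]
    have hi := (integrable_sq_mollify n hg2).1.const_mul (2 + 2 * K)
    calc _ ≤ ∫⁻ x, ENNReal.ofReal ((2 + 2 * K) * gn n x ^ 2 + J * D n x) := by
          refine lintegral_mono fun x => ?_
          rw [← ofReal_norm, ← ofReal_norm, ← ENNReal.ofReal_add (norm_nonneg _) (norm_nonneg _)]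
          exact ENNReal.ofReal_le_ofReal (hud n x)
      _ = ENNReal.ofReal (∫ x, ((2 + 2 * K) * gn n x ^ 2 + J * D n x)) := by
          refine (ofReal_integral_eq_lintegral_ofReal (hi.add ((hDi n).const_mul J))
            (ae_of_all _ fun x => ?_)).symm
          exact (add_nonneg (norm_nonneg _) (norm_nonneg _)).trans (hud n x)
      _ ≤ _ := by
          refine ENNReal.ofReal_le_ofReal ?_
          rw [integral_add hi ((hDi n).const_mul J), integral_const_mul, integral_const_mul]
          have h1 := (integrable_sq_mollify n hg2).2
          have h2 := hDR n
          gcongr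
  have hlim : ∀ᵐ x, Tendsto (fun n => ‖u n x‖ₑ ^ p) atTop
      (𝓝 (ENNReal.ofReal (g x ^ 2) ^ p)) := by
    filter_upwards [tendsto_mollify hloc] with x hx
    have h1 : Tendsto (fun n => χn n x) atTop (𝓝 1) := by
      have h2 : Tendsto (fun n => r n • x) atTop (𝓝 ((0 : ℝ) • x)) :=
        (tendsto_one_div_add_atTop_nhds_zero_nat (𝕜 := ℝ)).smul_const x
      rw [zero_smul] at h2
      have h3 := (χ.continuous.tendsto 0).comp h2
      rwa [χ.one_of_mem_closedBall (Metric.mem_closedBall_self zero_le_one)] at h3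
    have h4 : Tendsto (fun n => u n x) atTop (𝓝 ((1 * g x) ^ 2)) := (h1.mul hx).pow 2
    rw [one_mul] at h4
    have h5 : Tendsto (fun n => ENNReal.ofReal (u n x) ^ p) atTop
        (𝓝 (ENNReal.ofReal (g x ^ 2) ^ p)) :=
      (ENNReal.continuous_rpow_const.tendsto _).comp
        ((ENNReal.continuous_ofReal.tendsto _).comp h4)
    refine h5.congr fun n => ?_
    rw [Real.enorm_of_nonneg (sq_nonneg _)]
  calc ∫⁻ x, ENNReal.ofReal (g x ^ 2) ^ p
      = ∫⁻ x, liminf (fun n => ‖u n x‖ₑ ^ p) atTop :=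
        lintegral_congr_ae (hlim.mono fun x hx => hx.liminf_eq.symm)
    _ ≤ liminf (fun n => ∫⁻ x, ‖u n x‖ₑ ^ p) atTop := lintegral_liminf_le fun n =>
        (hu n).continuous.measurable.enorm.pow_const p
    _ ≤ liminf (fun _ : ℕ => C * ENNReal.ofReal ((2 + 2 * K) * Q + J * R) ^ p) atTop := by
        refine liminf_le_liminf (Eventually.of_forall fun n => (hsob _ (hu n) (hus n)).trans ?_)
        gcongr
        exact hbound n
    _ = C * ENNReal.ofReal ((2 + 2 * K) * Q + J * R) ^ p := by simp
    _ < ∞ := ENNReal.mul_lt_top hC.lt_top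
        (ENNReal.rpow_lt_top_of_nonneg hp1.le ENNReal.ofReal_ne_top)

variable {β : ℝ} [Fact (0 < β)]

/-- Probability densities of finite energy whose square root is in `H¹` have finite entropy. -/
lemma lintegral_klFun_div_maxwellian_lt_top [DecidableEq ι] [Nonempty ι] (hd : 0 < d)
    {f : Config ι d → ℝ} (hf0 : ∀ᵐ v, 0 ≤ f v) (hfi : Integrable f)
    (hH : MemH1 fun v => √(f v)) (hE : ∫⁻ v, ENNReal.ofReal (energySq v * f v) < ∞) :
    ∫⁻ v, ENNReal.ofReal (klFun (f v / maxwellian β v)) ∂(maxwellMeasure ι d β) < ∞ := by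
  have hβ : 0 < β := Fact.out
  set n : ℝ := (Module.finrank ℝ (Config ι d) : ℝ)
  have hn : 0 < n := by
    have : 0 < Module.finrank ℝ (Config ι d) := by
      rw [Module.finrank_pi_fintype]
      simp only [finrank_euclideanSpace, Fintype.card_fin, Finset.sum_const, Finset.card_univ,
        smul_eq_mul]
      exact Nat.mul_pos Fintype.card_pos hd
    exact Nat.cast_pos.2 this
  have hp : (n + 1).HolderConjugate (1 + 1 / n) := by
    rw [Real.holderConjugate_iff]
    refine ⟨by linarith, ?_⟩
    field_simp
    ring
  have hpow := lintegral_sq_rpow_lt_top hH hp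
  set c₀ : ℝ := log ((β / (2 * π)) ^ (((d : ℝ) * (Fintype.card ι : ℝ)) / 2))
  have hlogγ : ∀ v : Config ι d, log (maxwellian β v) = c₀ - β / 2 * energySq v := fun v => by
    unfold maxwellian
    rw [log_mul (by positivity) (exp_pos _).ne', log_exp]; ring
  rw [lintegral_maxwellMeasure]
  -- Only an upper bound is needed, since `klFun` is nonnegative. A lower bound on f ln f never
  -- enters.
  have hle : ∀ᵐ v : Config ι d, ENNReal.ofReal (maxwellian β v) *
      ENNReal.ofReal (klFun (f v / maxwellian β v)) ≤
      ENNReal.ofReal n * ENNReal.ofReal (√(f v) ^ 2) ^ (1 + 1 / n) +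
        ENNReal.ofReal |c₀| * ‖f v‖ₑ + ENNReal.ofReal (β / 2) * ENNReal.ofReal (energySq v * f v)
        + ENNReal.ofReal (maxwellian β v) := by
    filter_upwards [hf0] with v hv
    have hγ := maxwellian_pos (β := β) v
    have hen := energySq_nonneg v
    rw [sq_sqrt hv, ENNReal.ofReal_rpow_of_nonneg hv (by positivity), Real.enorm_of_nonneg hv,
      ← ENNReal.ofReal_mul hγ.le, ← ENNReal.ofReal_mul hn.le, ← ENNReal.ofReal_mul (abs_nonneg _),
      ← ENNReal.ofReal_mul (by positivity), ← ENNReal.ofReal_add (by positivity) (by positivity),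
      ← ENNReal.ofReal_add (by positivity) (by positivity),
      ← ENNReal.ofReal_add (by positivity) (by positivity)]
    refine ENNReal.ofReal_le_ofReal ?_
    rcases hv.eq_or_lt with h0 | h0
    · rw [← h0]
      simp only [zero_div, klFun_zero, mul_one, mul_zero, add_zero]
      have : (0 : ℝ) ≤ n * 0 ^ (1 + 1 / n) := by positivity
      linarith
    · rw [klFun_apply, log_div h0.ne' hγ.ne', hlogγ]
      have e1 : maxwellian β v * (f v / maxwellian β v * (log (f v) - (c₀ - β / 2 * energySq v))
          + 1 - f v / maxwellian β v) = f v * log (f v) - c₀ * f v + β / 2 * (energySq v * f v)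
            + maxwellian β v - f v := by
        field_simp
        ring
      -- From ln x ≤ n x^(1/n), with the power matched to the Sobolev exponent 1 + 1/n.
      have e2 : f v * log (f v) ≤ n * f v ^ (1 + 1 / n) := by
        have := log_le_rpow_div hv (by positivity : 0 < 1 / n)
        rw [Real.rpow_add h0, Real.rpow_one]
        calc f v * log (f v) ≤ f v * (f v ^ (1 / n) / (1 / n)) := by gcongr
          _ = _ := by field_simp
      have e3 : -c₀ * f v ≤ |c₀| * f v := by gcongr; exact neg_le_abs c₀
      rw [e1]
      linarith
  refine (lintegral_mono_ae hle).trans_lt ?_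
  have hm1 : AEMeasurable (fun v => √(f v)) := hH.1.aestronglyMeasurable.aemeasurable
  have hm2 : AEMeasurable (fun v => ENNReal.ofReal (√(f v) ^ 2) ^ (1 + 1 / n)) :=
    ((hm1.pow_const 2).ennreal_ofReal).pow_const _
  have hm3 : AEMeasurable (fun v => ‖f v‖ₑ) := hfi.aestronglyMeasurable.enorm
  rw [lintegral_add_right _ measurable_ofReal_maxwellian, lintegral_add_left' (by fun_prop),
    lintegral_add_left' (by fun_prop), lintegral_const_mul'' _ hm2, lintegral_const_mul'' _ hm3,
    lintegral_const_mul' _ _ ENNReal.ofReal_ne_top, lintegral_ofReal_maxwellian]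
  refine ENNReal.add_lt_top.2 ⟨ENNReal.add_lt_top.2 ⟨ENNReal.add_lt_top.2 ⟨?_, ?_⟩, ?_⟩, by simp⟩
  · exact ENNReal.mul_lt_top ENNReal.ofReal_lt_top hpow
  · exact ENNReal.mul_lt_top ENNReal.ofReal_lt_top hfi.2
  · exact ENNReal.mul_lt_top ENNReal.ofReal_lt_top hE

end Sobolev

end KacReservoir

namespace KacReservoir

open Real InformationTheory Filter Topology ENNReal

/-! ### Averages over random energy preserving maps as contractions of L¹. -/

section IsometryMixture

variable {ι : Type} [Fintype ι] {d : ℕ}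

lemma eq_zero_of_energySq_eq_zero {u : Config ι d} (h : energySq u = 0) : u = 0 := by
  have := norm_sq_le_energySq u
  rw [h] at this
  exact norm_eq_zero.1 (pow_eq_zero_iff two_ne_zero |>.1 (le_antisymm this (sq_nonneg _)))

/-- Energy preservation makes the map injective, hence an automorphism in finite dimension. -/
lemma measurePreserving_volume_of_energySq' (T : Config ι d →L[ℝ] Config ι d)
    (hT : ∀ u, energySq (T u) = energySq u) : MeasurePreserving T volume volume := by
  have hinj : Function.Injective (T : Config ι d →ₗ[ℝ] Config ι d) := by
    refine (injective_iff_map_eq_zero _).2 fun u hu => eq_zero_of_energySq_eq_zero ?_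
    rw [← hT u]
    have : T u = 0 := hu
    simp [this, energySq]
  have := measurePreserving_volume_of_energySq
    (LinearEquiv.ofInjectiveEndo _ hinj).toContinuousLinearEquiv hT
  exact this

/-- A measurable family of linear maps preserving the energy. -/
structure IsIsometryMixture {Ω : Type*} [MeasurableSpace Ω]
    (T : Ω → Config ι d →L[ℝ] Config ι d) : Prop where
  measurable : ∀ u, Measurable fun ω => T ω u
  energySq : ∀ ω u, energySq (T ω u) = energySq u

namespace IsIsometryMixture

variable {Ω Ω' : Type*} [MeasurableSpace Ω] [MeasurableSpace Ω']
  {T : Ω → Config ι d →L[ℝ] Config ι d} {T' : Ω' → Config ι d →L[ℝ] Config ι d}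
  (ν : Measure Ω) [IsProbabilityMeasure ν] (ν' : Measure Ω') [IsProbabilityMeasure ν']

lemma measurable_uncurry (hT : IsIsometryMixture T) :
    Measurable fun q : Ω × Config ι d => T q.1 q.2 := by
  classical
  exact measurable_clm_uncurry hT.measurable

lemma comp (hT : IsIsometryMixture T) (hT' : IsIsometryMixture T') :
    IsIsometryMixture fun q : Ω × Ω' => (T q.1).comp (T' q.2) :=
  ⟨fun u => hT.measurable_uncurry.comp
    (measurable_fst.prodMk ((hT'.measurable u).comp measurable_snd)),
    fun _ _ => (hT.energySq _ _).trans (hT'.energySq _ _)⟩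

lemma measurePreserving_skew (hT : IsIsometryMixture T) :
    MeasurePreserving (fun q : Ω × Config ι d => (q.1, T q.1 q.2)) (ν.prod volume)
      (ν.prod volume) :=
  (MeasurePreserving.id ν).skew_product (g := fun ω u => T ω u) hT.measurable_uncurry
    (ae_of_all _ fun ω => (measurePreserving_volume_of_energySq' _ (hT.energySq ω)).map_eq)

lemma measurePreserving_skew' (hT : IsIsometryMixture T) :
    MeasurePreserving (fun q : Config ι d × Ω => (q.2, T q.2 q.1))
      ((volume : Measure (Config ι d)).prod ν) (ν.prod volume) :=
  (hT.measurePreserving_skew ν).comp Measure.measurePreserving_swap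

lemma quasiMeasurePreserving (hT : IsIsometryMixture T) :
    Measure.QuasiMeasurePreserving (fun q : Config ι d × Ω => T q.2 q.1)
      ((volume : Measure (Config ι d)).prod ν) volume :=
  Measure.quasiMeasurePreserving_snd.comp (hT.measurePreserving_skew' ν).quasiMeasurePreserving

lemma integrable_prod (hT : IsIsometryMixture T) {F : Config ι d → ℝ} (hF : Integrable F) :
    Integrable (fun q : Config ι d × Ω => F (T q.2 q.1))
      ((volume : Measure (Config ι d)).prod ν) :=
  (hT.measurePreserving_skew' ν).integrable_comp_of_integrable (hF.comp_snd ν)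

lemma ae_ae (hT : IsIsometryMixture T) {P : Config ι d → Prop} (hP : ∀ᵐ u, P u) :
    ∀ᵐ u, ∀ᵐ ω ∂ν, P (T ω u) :=
  Measure.ae_ae_of_ae_prod ((hT.quasiMeasurePreserving ν).ae hP)

lemma average_congr (hT : IsIsometryMixture T) {F G : Config ι d → ℝ} (h : F =ᵐ[volume] G) :
    (fun u => ∫ ω, F (T ω u) ∂ν) =ᵐ[volume] fun u => ∫ ω, G (T ω u) ∂ν :=
  (hT.ae_ae ν h).mono fun _ hu => integral_congr_ae hu

/-- Since (u, ω) ↦ (ω, T u) preserves the product measure, averaging is a contraction of L¹. -/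
lemma integral_norm_average_le (hT : IsIsometryMixture T) {F : Config ι d → ℝ}
    (hF : Integrable F) : ∫ u, ‖∫ ω, F (T ω u) ∂ν‖ ≤ ∫ u, ‖F u‖ := by
  have h1 := hT.integrable_prod ν hF
  have hmp := hT.measurePreserving_skew' ν
  calc ∫ u, ‖∫ ω, F (T ω u) ∂ν‖ ≤ ∫ u, ∫ ω, ‖F (T ω u)‖ ∂ν :=
        integral_mono h1.integral_prod_left.norm h1.norm.integral_prod_left
          fun u => norm_integral_le_integral_norm _
    _ = ∫ q : Config ι d × Ω, ‖F (T q.2 q.1)‖ ∂((volume : Measure (Config ι d)).prod ν) :=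
        (integral_prod _ h1.norm).symm
    _ = ∫ r : Ω × Config ι d, ‖F r.2‖ ∂(ν.prod volume) := by
        rw [← hmp.map_eq, integral_map hmp.measurable.aemeasurable]
        rw [hmp.map_eq]
        exact (hF.comp_snd ν).norm.aestronglyMeasurable
    _ = ∫ u, ‖F u‖ := by
        rw [integral_prod _ (hF.comp_snd ν).norm]
        simp

/-- The averaging operator on `L¹`. -/
noncomputable def averageL1 (hT : IsIsometryMixture T) :
    Lp ℝ 1 (volume : Measure (Config ι d)) →L[ℝ] Lp ℝ 1 (volume : Measure (Config ι d)) :=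
  LinearMap.mkContinuous
    { toFun := fun F => (hT.integrable_prod ν (L1.integrable_coeFn F)).integral_prod_left.toL1 _
      map_add' := fun F G => by
        rw [← Integrable.toL1_add, Integrable.toL1_eq_toL1_iff]
        refine (hT.average_congr ν (Lp.coeFn_add F G)).trans ?_
        have h1 := (hT.integrable_prod ν (L1.integrable_coeFn F)).prod_right_ae
        have h2 := (hT.integrable_prod ν (L1.integrable_coeFn G)).prod_right_ae
        filter_upwards [h1, h2] with u h1 h2
        exact integral_add h1 h2
      map_smul' := fun c F => by
        rw [RingHom.id_apply, ← Integrable.toL1_smul, Integrable.toL1_eq_toL1_iff]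
        refine (hT.average_congr ν (Lp.coeFn_smul c F)).trans (ae_of_all _ fun u => ?_)
        exact integral_smul c _ }
    1 fun F => by
      rw [one_mul]
      change ‖Integrable.toL1 _ (hT.integrable_prod ν
        (L1.integrable_coeFn F)).integral_prod_left‖ ≤ ‖F‖
      rw [L1.norm_eq_integral_norm, L1.norm_eq_integral_norm]
      refine (integral_congr_ae ((Integrable.coeFn_toL1 _).fun_comp norm)).trans_le ?_
      exact hT.integral_norm_average_le ν (L1.integrable_coeFn F)

lemma coeFn_averageL1 (hT : IsIsometryMixture T)
    (F : Lp ℝ 1 (volume : Measure (Config ι d))) :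
    hT.averageL1 ν F =ᵐ[volume] fun u => ∫ ω, F (T ω u) ∂ν :=
  Integrable.coeFn_toL1 (hT.integrable_prod ν (L1.integrable_coeFn F)).integral_prod_left

/-- The map averaged last is applied to the configuration first, which explains the order of
composition. -/
lemma averageL1_averageL1 (hT : IsIsometryMixture T) (hT' : IsIsometryMixture T')
    (F : Lp ℝ 1 (volume : Measure (Config ι d))) :
    hT'.averageL1 ν' (hT.averageL1 ν F) = (hT.comp hT').averageL1 (ν.prod ν') F := by
  refine Lp.ext ?_
  refine (hT'.coeFn_averageL1 ν' _).trans (Filter.EventuallyEq.trans ?_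
    ((hT.comp hT').coeFn_averageL1 (ν.prod ν') F).symm)
  refine (hT'.average_congr ν' (hT.coeFn_averageL1 ν F)).trans ?_
  filter_upwards [((hT.comp hT').integrable_prod (ν.prod ν') (L1.integrable_coeFn F)).prod_right_ae]
    with u hu
  exact (integral_prod_symm _ hu).symm

end IsIsometryMixture

end IsometryMixture

/-! ### Splitting into system and reservoir, and the marginal as an operator on L¹. -/

section Marginal

variable {N M d : ℕ} {β : ℝ}

variable (N M d) in
/-- Splitting a master vector into the Kac system and the reservoir. -/
noncomputable def splitEquiv :
    Config (Label N M) d ≃ᵐ Config (Fin N) d × Config (Fin M) d :=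
  MeasurableEquiv.sumPiEquivProdPi fun _ => Vel d

lemma splitEquiv_symm_apply (p : Config (Fin N) d × Config (Fin M) d) :
    (splitEquiv N M d).symm p = Sum.elim p.1 p.2 := by
  rw [MeasurableEquiv.symm_apply_eq]
  rfl

lemma measurePreserving_splitEquiv :
    MeasurePreserving (splitEquiv N M d) volume
      ((volume : Measure (Config (Fin N) d)).prod (volume : Measure (Config (Fin M) d))) :=
  volume_measurePreserving_sumPiEquivProdPi fun _ => Vel d

lemma measurePreserving_splitEquiv_symm :
    MeasurePreserving (fun p : Config (Fin N) d × Config (Fin M) d =>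
        (Sum.elim p.1 p.2 : Config (Label N M) d))
      ((volume : Measure (Config (Fin N) d)).prod (volume : Measure (Config (Fin M) d)))
      volume := by
  have h := (measurePreserving_splitEquiv (N := N) (M := M) (d := d)).symm
  rwa [show ⇑(splitEquiv N M d).symm = fun p => Sum.elim p.1 p.2 from
    funext splitEquiv_symm_apply] at h

lemma energySq_elim (v : Config (Fin N) d) (w : Config (Fin M) d) :
    energySq (Sum.elim v w : Config (Label N M) d) = energySq v + energySq w := by
  simp [energySq, Fintype.sum_sum_type]

lemma maxwellian_elim [Fact (0 < β)] (v : Config (Fin N) d) (w : Config (Fin M) d) :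
    maxwellian β (Sum.elim v w : Config (Label N M) d) = maxwellian β v * maxwellian β w := by
  have hβ : 0 < β := Fact.out
  rw [maxwellian_mul_maxwellian, maxwellian, energySq_elim, ← Real.rpow_add (by positivity)]
  congr 2
  simp only [Fintype.card_sum, Fintype.card_fin, Nat.cast_add]
  ring

lemma measurePreserving_elim_maxwellMeasure [Fact (0 < β)] :
    MeasurePreserving (fun p : Config (Fin N) d × Config (Fin M) d =>
        (Sum.elim p.1 p.2 : Config (Label N M) d))
      ((maxwellMeasure (Fin N) d β).prod (maxwellMeasure (Fin M) d β))
      (maxwellMeasure (Label N M) d β) := by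
  have h := measurePreserving_withDensity
    (measurePreserving_splitEquiv_symm (N := N) (M := M) (d := d))
    (measurable_ofReal_maxwellian (β := β))
  rw [prod_maxwellMeasure]
  have e : (fun p : Config (Fin N) d × Config (Fin M) d =>
      ENNReal.ofReal (maxwellian β p.1 * maxwellian β p.2)) =
      (fun u : Config (Label N M) d => ENNReal.ofReal (maxwellian β u)) ∘
        fun p : Config (Fin N) d × Config (Fin M) d => Sum.elim p.1 p.2 :=
    funext fun p => by rw [Function.comp_apply, maxwellian_elim]
  rw [e]
  exact h

lemma integrable_elim {F : Config (Label N M) d → ℝ} (hF : Integrable F) :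
    Integrable (fun p : Config (Fin N) d × Config (Fin M) d => F (Sum.elim p.1 p.2))
      ((volume : Measure (Config (Fin N) d)).prod (volume : Measure (Config (Fin M) d))) :=
  measurePreserving_splitEquiv_symm.integrable_comp_of_integrable hF

lemma integrable_kacMarginal {F : Config (Label N M) d → ℝ} (hF : Integrable F) :
    Integrable (kacMarginal F) :=
  (integrable_elim hF).integral_prod_left

lemma kacMarginal_congr {F G : Config (Label N M) d → ℝ} (h : F =ᵐ[volume] G) :
    kacMarginal F =ᵐ[volume] kacMarginal G := by
  have h1 : ∀ᵐ v : Config (Fin N) d, ∀ᵐ w : Config (Fin M) d,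
      F (Sum.elim v w) = G (Sum.elim v w) := Measure.ae_ae_of_ae_prod
    (measurePreserving_splitEquiv_symm.quasiMeasurePreserving.ae h)
  exact h1.mono fun v hv => integral_congr_ae hv

lemma integral_norm_kacMarginal_le {F : Config (Label N M) d → ℝ} (hF : Integrable F) :
    ∫ v, ‖kacMarginal F v‖ ≤ ∫ u, ‖F u‖ := by
  have h1 := integrable_elim hF
  have hmp := measurePreserving_splitEquiv_symm (N := N) (M := M) (d := d)
  calc ∫ v, ‖kacMarginal F v‖
      ≤ ∫ v : Config (Fin N) d, ∫ w : Config (Fin M) d, ‖F (Sum.elim v w)‖ :=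
        integral_mono h1.integral_prod_left.norm h1.norm.integral_prod_left
          fun u => norm_integral_le_integral_norm _
    _ = ∫ p : Config (Fin N) d × Config (Fin M) d, ‖F (Sum.elim p.1 p.2)‖
          ∂((volume : Measure (Config (Fin N) d)).prod (volume : Measure (Config (Fin M) d))) :=
        (integral_prod _ h1.norm).symm
    _ = ∫ u, ‖F u‖ := by
        conv_rhs => rw [← hmp.map_eq]
        rw [integral_map hmp.measurable.aemeasurable]
        rw [hmp.map_eq]
        exact hF.norm.aestronglyMeasurable

variable (N M d) in
/-- The marginal as an operator on `L¹`. -/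
noncomputable def marginalL1 :
    Lp ℝ 1 (volume : Measure (Config (Label N M) d)) →L[ℝ]
      Lp ℝ 1 (volume : Measure (Config (Fin N) d)) :=
  LinearMap.mkContinuous
    { toFun := fun F => (integrable_kacMarginal (L1.integrable_coeFn F)).toL1 _
      map_add' := fun F G => by
        rw [← Integrable.toL1_add, Integrable.toL1_eq_toL1_iff]
        refine (kacMarginal_congr (Lp.coeFn_add F G)).trans ?_
        have h1 := (integrable_elim (L1.integrable_coeFn F)).prod_right_ae
        have h2 := (integrable_elim (L1.integrable_coeFn G)).prod_right_ae
        filter_upwards [h1, h2] with u h1 h2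
        exact integral_add h1 h2
      map_smul' := fun c F => by
        rw [RingHom.id_apply, ← Integrable.toL1_smul, Integrable.toL1_eq_toL1_iff]
        refine (kacMarginal_congr (Lp.coeFn_smul c F)).trans (ae_of_all _ fun u => ?_)
        exact integral_smul c _ }
    1 fun F => by
      rw [one_mul]
      change ‖Integrable.toL1 _ (integrable_kacMarginal (L1.integrable_coeFn F))‖ ≤ ‖F‖
      rw [L1.norm_eq_integral_norm, L1.norm_eq_integral_norm]
      refine (integral_congr_ae ((Integrable.coeFn_toL1 _).fun_comp norm)).trans_le ?_
      exact integral_norm_kacMarginal_le (L1.integrable_coeFn F)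

lemma coeFn_marginalL1 (F : Lp ℝ 1 (volume : Measure (Config (Label N M) d))) :
    marginalL1 N M d F =ᵐ[volume] kacMarginal F :=
  Integrable.coeFn_toL1 (integrable_kacMarginal (L1.integrable_coeFn F))

end Marginal

/-! ### Entropy of countable convex combinations. -/

section Jensen

variable {ι : Type} [Fintype ι] {d : ℕ} {β : ℝ} [Fact (0 < β)]

/-- Jensen's inequality with the missing weight placed at the point 0, where `klFun` equals 1. It is
made for partial sums of a convex series, where this defect tends to 0. -/
lemma klFun_sum_le {s : Finset ℕ} {w x : ℕ → ℝ} (hw : ∀ k, 0 ≤ w k) (hs : ∑ k ∈ s, w k ≤ 1)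
    (hx : ∀ k, 0 ≤ x k) :
    klFun (∑ k ∈ s, w k * x k) ≤ ∑ k ∈ s, w k * klFun (x k) + (1 - ∑ k ∈ s, w k) := by
  have h := convexOn_klFun.map_add_sum_le (t := s) (w := w) (p := x)
    (v := 1 - ∑ k ∈ s, w k) (q := 0) (fun k _ => hw k) (by ring) (fun k _ => hx k)
    (by linarith) (Set.mem_Ici.2 le_rfl)
  simp only [smul_eq_mul, mul_zero, zero_add, klFun_zero, mul_one] at h
  linarith

/-- Relative entropy is convex and lower semicontinuous under countable convex combinations in
`L¹`. -/
lemma lintegral_klFun_le_of_hasSum {f : ℕ → Lp ℝ 1 (volume : Measure (Config ι d))}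
    {f' : Lp ℝ 1 (volume : Measure (Config ι d))} {h : ℕ → Config ι d → ℝ} {w E : ℕ → ℝ} {E' : ℝ}
    (hw : ∀ k, 0 ≤ w k) (hw1 : HasSum w 1) (hf : HasSum (fun k => w k • f k) f')
    (hfh : ∀ k, f k =ᵐ[volume] fun v => maxwellian β v * h k v)
    (h0 : ∀ k v, 0 ≤ h k v) (hm : ∀ k, AEMeasurable (h k) (maxwellMeasure ι d β))
    (hE0 : ∀ k, 0 ≤ E k)
    (hE : ∀ k, ∫⁻ v, ENNReal.ofReal (klFun (h k v)) ∂(maxwellMeasure ι d β) ≤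
      ENNReal.ofReal (E k))
    (hE' : HasSum (fun k => w k * E k) E') :
    (∀ᵐ v, 0 ≤ f' v) ∧
    ∫⁻ v, ENNReal.ofReal (klFun (f' v / maxwellian β v)) ∂(maxwellMeasure ι d β) ≤
      ENNReal.ofReal E' := by
  set S : ℕ → Lp ℝ 1 (volume : Measure (Config ι d)) := fun n => ∑ k ∈ Finset.range n, w k • f k
  set H : ℕ → Config ι d → ℝ := fun n v => ∑ k ∈ Finset.range n, w k * h k v
  have hS : Tendsto S atTop (𝓝 f') := hf.tendsto_sum_nat
  have hSH : ∀ n, S n =ᵐ[volume] fun v => maxwellian β v * H n v := fun n => by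
    have h1 : ∀ᵐ v, ∀ k, (w k • f k : Lp ℝ 1 (volume : Measure (Config ι d))) v =
        w k * (maxwellian β v * h k v) := ae_all_iff.2 fun k => by
      filter_upwards [Lp.coeFn_smul (w k) (f k), hfh k] with v h1 h2
      rw [h1, Pi.smul_apply, h2, smul_eq_mul]
    filter_upwards [Lp.coeFn_finsetSum (Finset.range n) (fun k => w k • f k), h1] with v h2 h1
    rw [h2, Finset.sum_apply, Finset.mul_sum]
    exact Finset.sum_congr rfl fun k _ => by rw [h1 k]; ring
  -- Convergence in L¹ gives almost everywhere convergence along a subsequence, which is enough for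
  -- Fatou's lemma.
  obtain ⟨φ, hφ, hlim⟩ := (tendstoInMeasure_of_tendsto_Lp hS).exists_seq_tendsto_ae
  have hlim' : ∀ᵐ v, Tendsto (fun n => H (φ n) v) atTop (𝓝 (f' v / maxwellian β v)) := by
    filter_upwards [hlim, ae_all_iff.2 hSH] with v h1 h2
    refine (h1.div_const (maxwellian β v)).congr fun n => ?_
    rw [h2, mul_div_cancel_left₀ _ (maxwellian_pos v).ne']
  have hH0 : ∀ n v, 0 ≤ H n v := fun n v =>
    Finset.sum_nonneg fun k _ => mul_nonneg (hw k) (h0 k v)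
  have hsum1 : ∀ n, ∑ k ∈ Finset.range n, w k ≤ 1 := fun n => sum_le_hasSum _ (fun k _ => hw k) hw1
  have hbound : ∀ n, ∫⁻ v, ENNReal.ofReal (klFun (H n v)) ∂(maxwellMeasure ι d β) ≤
      ENNReal.ofReal (∑ k ∈ Finset.range n, w k * E k + (1 - ∑ k ∈ Finset.range n, w k)) :=
    fun n => by
    calc _ ≤ ∫⁻ v, (∑ k ∈ Finset.range n, ENNReal.ofReal (w k) * ENNReal.ofReal (klFun (h k v)) +
          ENNReal.ofReal (1 - ∑ k ∈ Finset.range n, w k)) ∂(maxwellMeasure ι d β) := by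
          refine lintegral_mono fun v => ?_
          refine (ENNReal.ofReal_le_ofReal
            (klFun_sum_le hw (hsum1 n) fun k => h0 k v)).trans_eq ?_
          rw [ENNReal.ofReal_add (Finset.sum_nonneg fun k _ =>
            mul_nonneg (hw k) (klFun_nonneg (h0 k v))) (by linarith [hsum1 n]),
            ENNReal.ofReal_sum_of_nonneg fun k _ => mul_nonneg (hw k) (klFun_nonneg (h0 k v))]
          congr 1
          exact Finset.sum_congr rfl fun k _ => ENNReal.ofReal_mul (hw k)
      _ = ∑ k ∈ Finset.range n, ENNReal.ofReal (w k) *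
            ∫⁻ v, ENNReal.ofReal (klFun (h k v)) ∂(maxwellMeasure ι d β) +
          ENNReal.ofReal (1 - ∑ k ∈ Finset.range n, w k) := by
          rw [lintegral_add_right _ measurable_const, lintegral_finsetSum']
          · simp [lintegral_const_mul' _ _ ENNReal.ofReal_ne_top]
          · exact fun k _ => (measurable_ofReal_klFun.comp_aemeasurable (hm k)).const_mul _
      _ ≤ ∑ k ∈ Finset.range n, ENNReal.ofReal (w k * E k) +
          ENNReal.ofReal (1 - ∑ k ∈ Finset.range n, w k) := by
          gcongr with k
          rw [ENNReal.ofReal_mul (hw k)]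
          gcongr
          exact hE k
      _ = _ := by
          rw [← ENNReal.ofReal_sum_of_nonneg fun k _ => mul_nonneg (hw k) (hE0 k),
            ← ENNReal.ofReal_add (Finset.sum_nonneg fun k _ => mul_nonneg (hw k) (hE0 k))
              (by linarith [hsum1 n])]
  have hrhs : Tendsto (fun n => ENNReal.ofReal (∑ k ∈ Finset.range n, w k * E k +
      (1 - ∑ k ∈ Finset.range n, w k))) atTop (𝓝 (ENNReal.ofReal E')) := by
    refine (ENNReal.continuous_ofReal.tendsto _).comp ?_
    have := hE'.tendsto_sum_nat.add (hw1.tendsto_sum_nat.const_sub 1)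
    simpa using this
  refine ⟨?_, ?_⟩
  · filter_upwards [hlim'] with v hv
    have h1 := ge_of_tendsto' hv fun n => hH0 (φ n) v
    have h2 := maxwellian_pos (β := β) v
    by_contra hcon
    push Not at hcon
    exact absurd h1 (not_le.2 (div_neg_of_neg_of_pos hcon h2))
  · have hlim2 : ∀ᵐ v ∂(maxwellMeasure ι d β),
        Tendsto (fun n => H (φ n) v) atTop (𝓝 (f' v / maxwellian β v)) :=
      (maxwellMeasure_absolutelyContinuous (β := β)).ae_le hlim'
    calc _ = ∫⁻ v, liminf (fun n => ENNReal.ofReal (klFun (H (φ n) v))) atTop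
          ∂(maxwellMeasure ι d β) := by
          refine lintegral_congr_ae (hlim2.mono fun v hv => ?_)
          exact (((continuous_ofReal_klFun.tendsto _).comp hv).liminf_eq).symm
      _ ≤ liminf (fun n => ∫⁻ v, ENNReal.ofReal (klFun (H (φ n) v)) ∂(maxwellMeasure ι d β))
          atTop := lintegral_liminf_le' fun n => measurable_ofReal_klFun.comp_aemeasurable
            (Finset.aemeasurable_fun_sum _ fun k _ => (hm k).const_mul _)
      _ ≤ liminf (fun n => ENNReal.ofReal (∑ k ∈ Finset.range (φ n), w k * E k +
            (1 - ∑ k ∈ Finset.range (φ n), w k))) atTop :=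
          liminf_le_liminf (Eventually.of_forall fun n => hbound (φ n))
      _ = ENNReal.ofReal E' := (hrhs.comp hφ.tendsto_atTop).liminf_eq

end Jensen

end KacReservoir

namespace KacReservoir

open Real InformationTheory Filter Topology ENNReal

/-! ### A single collision and its effect on linear functionals. -/

section Collision

variable {ι : Type} [Fintype ι] [DecidableEq ι] {d : ℕ}

/-- The collision as a linear map. -/
noncomputable def collideL (σ : Vel d) (i j : ι) : Config ι d →L[ℝ] Config ι d :=
  ContinuousLinearMap.id ℝ (Config ι d) -
    ((innerSL ℝ σ).comp (ContinuousLinearMap.proj (R := ℝ) (φ := fun _ : ι => Vel d) i -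
      ContinuousLinearMap.proj (R := ℝ) (φ := fun _ : ι => Vel d) j)).smulRight
      (Pi.single i σ - Pi.single j σ)

lemma collideL_apply (σ : Vel d) (i j : ι) (u : Config ι d) :
    collideL σ i j u = u - (inner ℝ σ (u i - u j)) • (Pi.single i σ - Pi.single j σ) := rfl

lemma collideL_eq_collide (σ : Vel d) (i j : ι) (u : Config ι d) :
    collideL σ i j u = collide σ i j u := by
  rw [collideL_apply]
  funext k
  unfold collide
  by_cases hij : i = j
  · subst hij
    by_cases hk : k = i
    · subst hk; simp
    · simp [hk]
  · by_cases hkj : k = j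
    · subst hkj
      simp [Ne.symm hij]
    · by_cases hki : k = i
      · subst hki
        simp [hkj]
      · simp [hki, hkj]

lemma collide_self (σ : Vel d) (i : ι) (u : Config ι d) : collide σ i i u = u := by
  rw [← collideL_eq_collide, collideL_apply]
  simp

lemma energySq_collideL {σ : Vel d} (hσ : ‖σ‖ = 1) (i j : ι) (u : Config ι d) :
    energySq (collideL σ i j u) = energySq u := by
  by_cases hij : i = j
  · subst hij; rw [collideL_eq_collide, collide_self]
  · rw [← sub_eq_zero, energySq, energySq, ← Finset.sum_sub_distrib,
      Fintype.sum_eq_add i j hij]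
    · simp only [collideL_apply, Pi.sub_apply, Pi.smul_apply, Pi.single_eq_same,
        Pi.single_eq_of_ne hij, Pi.single_eq_of_ne (Ne.symm hij), sub_zero, zero_sub, smul_neg,
        sub_neg_eq_add]
      rw [norm_sub_sq_real, norm_add_sq_real, norm_smul, hσ, inner_smul_right, inner_smul_right,
        real_inner_comm σ (u i), real_inner_comm σ (u j), inner_sub_right, mul_one, Real.norm_eq_abs,
        sq_abs]
      ring
    · rintro k ⟨h1, h2⟩
      simp [collideL_apply, Pi.single_eq_of_ne h1, Pi.single_eq_of_ne h2]

/-- The squared length of the part of a linear functional acting on the particle `k`. -/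
noncomputable def blockSq (ℓ : Config ι d →L[ℝ] ℝ) (k : ι) : ℝ :=
  ∑ a : Fin d, ℓ (unitVec k a) ^ 2

lemma blockSq_nonneg (ℓ : Config ι d →L[ℝ] ℝ) (k : ι) : 0 ≤ blockSq ℓ k :=
  Finset.sum_nonneg fun _ _ => sq_nonneg _

lemma map_single_eq_sum (ℓ : Config ι d →L[ℝ] ℝ) (k : ι) (x : Vel d) :
    ℓ (Pi.single k x) = ∑ a, x a * ℓ (unitVec k a) := by
  rw [map_eq_sum, Fintype.sum_prod_type, Finset.sum_eq_single k]
  · simp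
  · intro i _ hi; simp [Pi.single_eq_of_ne hi]
  · simp

/-- Let x and y be the components along σ of the blocks i and j of ℓ. The collision shifts block i
by -(x - y)σ and block j by (x - y)σ. As σ is a unit vector, this exchanges x and y, and so
transfers y² - x² from block j to block i. -/
lemma blockSq_comp_collideL {σ : Vel d} (hσ : ‖σ‖ = 1) (ℓ : Config ι d →L[ℝ] ℝ) (i j k : ι) :
    blockSq (ℓ.comp (collideL σ i j)) k = blockSq ℓ k +
      ((if k = i then 1 else 0) - (if k = j then 1 else 0)) *
        (ℓ (Pi.single j σ) ^ 2 - ℓ (Pi.single i σ) ^ 2) := by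
  have hσ2 : ∑ a, σ a ^ 2 = 1 := by
    rw [← EuclideanSpace.real_norm_sq_eq, hσ, one_pow]
  set p := ℓ (Pi.single i σ) - ℓ (Pi.single j σ) with hp
  have key : ∀ c : ℝ, ∑ a, (ℓ (unitVec k a) - c * σ a * p) ^ 2 =
      blockSq ℓ k - 2 * c * p * ℓ (Pi.single k σ) + c ^ 2 * p ^ 2 := fun c => by
    have h1 : ∀ a, (ℓ (unitVec k a) - c * σ a * p) ^ 2 = ℓ (unitVec k a) ^ 2 -
        2 * c * p * (σ a * ℓ (unitVec k a)) + c ^ 2 * p ^ 2 * σ a ^ 2 := fun a => by ring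
    simp_rw [h1]
    rw [Finset.sum_add_distrib, Finset.sum_sub_distrib, ← Finset.mul_sum, ← Finset.mul_sum, hσ2,
      ← map_single_eq_sum, mul_one, blockSq]
  have hval : ∀ a, (ℓ.comp (collideL σ i j)) (unitVec k a) = ℓ (unitVec k a) -
      ((if k = i then 1 else 0) - (if k = j then 1 else 0)) * σ a * p := fun a => by
    rw [ContinuousLinearMap.comp_apply, collideL_apply, map_sub, map_smul, map_sub, ← hp,
      smul_eq_mul, inner_sub_right]
    have h2 : ∀ m : ι, inner ℝ σ ((unitVec k a : Config ι d) m) =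
        (if k = m then 1 else 0) * σ a := fun m => by
      by_cases h : k = m
      · subst h; simp [unitVec, EuclideanSpace.inner_single_right]
      · simp [unitVec, h]
    rw [h2, h2]; ring
  rw [blockSq]
  simp_rw [hval]
  rw [key]
  by_cases hki : k = i
  · by_cases hkj : k = j
    · simp [hki ▸ hkj, hki]
    · subst hki
      simp only [if_true, hkj, if_false, hp]
      ring
  · by_cases hkj : k = j
    · subst hkj
      simp only [if_true, hki, if_false, hp]
      ring
    · simp [hki, hkj]

lemma integrable_coord_mul_coord (ρ : Measure (Angle d)) [IsProbabilityMeasure ρ] (a b : Fin d) :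
    Integrable (fun σ : Angle d => (σ : Vel d) a * (σ : Vel d) b) ρ := by
  refine (integrable_const (1 : ℝ)).mono' (Continuous.aestronglyMeasurable (by fun_prop))
    (ae_of_all _ fun σ => ?_)
  have hσ : ‖(σ : Vel d)‖ = 1 := by simp
  rw [norm_mul]
  exact mul_le_one₀ ((PiLp.norm_apply_le _ _).trans hσ.le) (norm_nonneg _)
    ((PiLp.norm_apply_le _ _).trans hσ.le)

/-- This is where the second moment condition on ρ enters: the mean square of the component along σ
is the squared length divided by d. -/
lemma integral_sq_single {ρ : Measure (Angle d)} [IsProbabilityMeasure ρ]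
    (hρ : IsSymmetricAngleLaw ρ) (ℓ : Config ι d →L[ℝ] ℝ) (k : ι) :
    Integrable (fun σ : Angle d => ℓ (Pi.single k (σ : Vel d)) ^ 2) ρ ∧
      ∫ σ : Angle d, ℓ (Pi.single k (σ : Vel d)) ^ 2 ∂ρ = blockSq ℓ k / d := by
  have h1 : ∀ σ : Angle d, ℓ (Pi.single k (σ : Vel d)) ^ 2 =
      ∑ a, ∑ b, ℓ (unitVec k a) * ℓ (unitVec k b) * ((σ : Vel d) a * (σ : Vel d) b) := fun σ => by
    rw [map_single_eq_sum, sq, Finset.sum_mul_sum]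
    exact Finset.sum_congr rfl fun a _ => Finset.sum_congr rfl fun b _ => by ring
  simp_rw [h1]
  have hi := fun a b => (integrable_coord_mul_coord ρ a b).const_mul
    (ℓ (unitVec k a) * ℓ (unitVec k b))
  refine ⟨integrable_finsetSum _ fun a _ => integrable_finsetSum _ fun b _ => hi a b, ?_⟩
  rw [integral_finsetSum _ fun a _ => integrable_finsetSum _ fun b _ => hi a b, blockSq,
    Finset.sum_div]
  refine Finset.sum_congr rfl fun a _ => ?_
  rw [integral_finsetSum _ fun b _ => hi a b]
  simp_rw [integral_const_mul, hρ a]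
  simp [sq, div_eq_mul_inv]

end Collision

/-! ### Random collisions and the recursion for the system part of a functional. -/

section Rates

variable {N M d : ℕ}

instance : MeasurableSingletonClass (Label N M) :=
  ⟨fun
    | Sum.inl i => by
      rw [← Set.image_singleton]; exact (measurableSet_singleton i).inl_image
    | Sum.inr j => by
      rw [← Set.image_singleton]; exact (measurableSet_singleton j).inr_image⟩

/-- The squared length of a linear functional. -/
noncomputable def totalSq (ℓ : Config (Label N M) d →L[ℝ] ℝ) : ℝ := ∑ k, blockSq ℓ k

/-- The squared length of the part of a linear functional acting on the Kac system. -/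
noncomputable def systemSq (ℓ : Config (Label N M) d →L[ℝ] ℝ) : ℝ :=
  ∑ i : Fin N, blockSq ℓ (Sum.inl i)

lemma systemSq_nonneg (ℓ : Config (Label N M) d →L[ℝ] ℝ) : 0 ≤ systemSq ℓ :=
  Finset.sum_nonneg fun _ _ => blockSq_nonneg _ _

lemma totalSq_eq (ℓ : Config (Label N M) d →L[ℝ] ℝ) :
    totalSq ℓ = systemSq ℓ + ∑ j : Fin M, blockSq ℓ (Sum.inr j) := by
  rw [totalSq, Fintype.sum_sum_type, systemSq]

lemma systemSq_le_totalSq (ℓ : Config (Label N M) d →L[ℝ] ℝ) : systemSq ℓ ≤ totalSq ℓ := by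
  rw [totalSq_eq]
  exact le_add_of_nonneg_right (Finset.sum_nonneg fun _ _ => blockSq_nonneg _ _)

/-- The indicator of the labels of the Kac system. -/
def systemInd : Label N M → ℝ
  | Sum.inl _ => 1
  | Sum.inr _ => 0

lemma totalSq_comp_collideL {σ : Vel d} (hσ : ‖σ‖ = 1) (ℓ : Config (Label N M) d →L[ℝ] ℝ)
    (i j : Label N M) : totalSq (ℓ.comp (collideL σ i j)) = totalSq ℓ := by
  unfold totalSq
  simp_rw [blockSq_comp_collideL hσ]
  rw [Finset.sum_add_distrib, ← Finset.sum_mul, Finset.sum_sub_distrib]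
  simp

/-- Collisions inside the system or inside the reservoir have equal indicators and change nothing,
which is why `lamS` and `lamR` do not enter the decay rate. -/
lemma systemSq_comp_collideL {σ : Vel d} (hσ : ‖σ‖ = 1) (ℓ : Config (Label N M) d →L[ℝ] ℝ)
    (i j : Label N M) : systemSq (ℓ.comp (collideL σ i j)) = systemSq ℓ +
      (systemInd i - systemInd j) * (ℓ (Pi.single j σ) ^ 2 - ℓ (Pi.single i σ) ^ 2) := by
  unfold systemSq
  simp_rw [blockSq_comp_collideL hσ]
  rw [Finset.sum_add_distrib, ← Finset.sum_mul, Finset.sum_sub_distrib]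
  rcases i with i | i <;> rcases j with j | j <;> simp [systemInd]

/-- The rates of the collisions, completed by unit rates on the diagonal. -/
noncomputable def rate (lamS lamR μ : ℝ) : Label N M × Label N M → ℝ
  | (Sum.inl i, Sum.inl j) => if i < j then lamS / ((N : ℝ) - 1) else if i = j then 1 else 0
  | (Sum.inl _, Sum.inr _) => μ / (M : ℝ)
  | (Sum.inr _, Sum.inl _) => 0
  | (Sum.inr i, Sum.inr j) => if i < j then lamR / ((M : ℝ) - 1) else if i = j then 1 else 0

variable {lamS lamR μ : ℝ}

lemma rate_nonneg (hN : 0 < N) (hM : 0 < M) (hlamS : 0 ≤ lamS) (hlamR : 0 ≤ lamR) (hμ : 0 ≤ μ)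
    (p : Label N M × Label N M) : 0 ≤ rate lamS lamR μ p := by
  have hN' : (0 : ℝ) ≤ (N : ℝ) - 1 := by
    rw [sub_nonneg]; exact_mod_cast hN
  have hM' : (0 : ℝ) ≤ (M : ℝ) - 1 := by
    rw [sub_nonneg]; exact_mod_cast hM
  rcases p with ⟨i | i, j | j⟩
  · simp only [rate]; split_ifs <;> positivity
  · simp only [rate]; positivity
  · simp [rate]
  · simp only [rate]; split_ifs <;> positivity

variable (N M lamS lamR μ) in
/-- The total collision rate. -/
noncomputable def totalRate : ℝ := ∑ p : Label N M × Label N M, rate lamS lamR μ p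

/-- The unit rates on the diagonal belong to collisions of a particle with itself, which do nothing.
They keep the total rate positive even if all physical rates vanish or no physical pair exists
inside a group. -/
lemma totalRate_pos (hN : 0 < N) (hM : 0 < M) (hlamS : 0 ≤ lamS) (hlamR : 0 ≤ lamR)
    (hμ : 0 ≤ μ) : 0 < totalRate N M lamS lamR μ := by
  refine Finset.sum_pos' (fun p _ => rate_nonneg hN hM hlamS hlamR hμ p)
    ⟨(Sum.inl ⟨0, hN⟩, Sum.inl ⟨0, hN⟩), Finset.mem_univ _, ?_⟩
  simp [rate]

lemma sum_rate_mul (g : Label N M × Label N M → ℝ) (hg : ∀ i, g (i, i) = 0) :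
    ∑ p, rate lamS lamR μ p * g p =
      lamS / ((N : ℝ) - 1) * ∑ i : Fin N, ∑ j ∈ Finset.Ioi i, g (Sum.inl i, Sum.inl j)
      + lamR / ((M : ℝ) - 1) * ∑ i : Fin M, ∑ j ∈ Finset.Ioi i, g (Sum.inr i, Sum.inr j)
      + μ / (M : ℝ) * ∑ i : Fin N, ∑ j : Fin M, g (Sum.inl i, Sum.inr j) := by
  have hite : ∀ {K : ℕ} (c : ℝ) (i : Fin K) (G : Fin K → ℝ), G i = 0 →
      ∑ j, (if i < j then c else if i = j then 1 else 0) * G j = c * ∑ j ∈ Finset.Ioi i, G j := by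
    intro K c i G hG
    rw [Finset.mul_sum, ← Finset.filter_lt_eq_Ioi, Finset.sum_filter]
    refine Finset.sum_congr rfl fun j _ => ?_
    by_cases h1 : i < j
    · simp [h1]
    · by_cases h2 : i = j
      · subst h2; simp [hG]
      · simp [h1, h2]
  rw [Fintype.sum_prod_type, Fintype.sum_sum_type]
  simp only [Fintype.sum_sum_type, rate, zero_mul, Finset.sum_const_zero, zero_add,
    Finset.sum_add_distrib]
  simp_rw [fun i : Fin N => hite (lamS / ((N : ℝ) - 1)) i
    (fun j => g (Sum.inl i, Sum.inl j)) (hg _), fun i : Fin M => hite (lamR / ((M : ℝ) - 1)) i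
    (fun j => g (Sum.inr i, Sum.inr j)) (hg _), ← Finset.mul_sum]
  ring

/-- The law of the pair of colliding particles. -/
noncomputable def pairLaw (lamS lamR μ : ℝ)
    (h0 : ∀ p : Label N M × Label N M, 0 ≤ rate lamS lamR μ p)
    (h1 : 0 < totalRate N M lamS lamR μ) : PMF (Label N M × Label N M) :=
  PMF.ofFintype (fun p => ENNReal.ofReal (rate lamS lamR μ p / totalRate N M lamS lamR μ)) (by
    rw [← ENNReal.ofReal_sum_of_nonneg fun p _ => div_nonneg (h0 p) h1.le, ← Finset.sum_div,
      ← totalRate, div_self h1.ne', ENNReal.ofReal_one])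

lemma integral_pairLaw (h0 : ∀ p : Label N M × Label N M, 0 ≤ rate lamS lamR μ p)
    (h1 : 0 < totalRate N M lamS lamR μ) (g : Label N M × Label N M → ℝ) :
    ∫ p, g p ∂(pairLaw lamS lamR μ h0 h1).toMeasure =
      (totalRate N M lamS lamR μ)⁻¹ * ∑ p, rate lamS lamR μ p * g p := by
  rw [PMF.integral_eq_sum, Finset.mul_sum]
  refine Finset.sum_congr rfl fun p _ => ?_
  rw [pairLaw, PMF.ofFintype_apply, ENNReal.toReal_ofReal (div_nonneg (h0 p) h1.le), smul_eq_mul]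
  ring

variable (N M d) in
/-- The collision with random pair and random scattering angle. -/
noncomputable def randomCollision (q : (Label N M × Label N M) × Angle d) :
    Config (Label N M) d →L[ℝ] Config (Label N M) d :=
  collideL (q.2 : Vel d) q.1.1 q.1.2

lemma norm_angle (σ : Angle d) : ‖(σ : Vel d)‖ = 1 := by simp

lemma isIsometryMixture_randomCollision : IsIsometryMixture (randomCollision N M d) := by
  refine ⟨fun u => ?_, fun q u => energySq_collideL (norm_angle q.2) _ _ u⟩
  refine measurable_from_prod_countable_right fun p => ?_
  refine Continuous.measurable ?_
  have h1 : ∀ k : Label N M, Continuous fun σ : Angle d =>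
      (Pi.single k (σ : Vel d) : Config (Label N M) d) := fun k =>
    (continuous_single k).comp continuous_subtype_val
  simp only [randomCollision, collideL_apply]
  have h2 : Continuous fun σ : Angle d => inner ℝ (σ : Vel d) (u p.1 - u p.2) := by fun_prop
  exact continuous_const.sub (h2.smul ((h1 _).sub (h1 _)))

lemma measurable_systemSq_comp {Ω : Type*} [MeasurableSpace Ω]
    {T : Ω → Config (Label N M) d →L[ℝ] Config (Label N M) d} (hT : IsIsometryMixture T)
    (ℓ : Config (Label N M) d →L[ℝ] ℝ) : Measurable fun ω => systemSq (ℓ.comp (T ω)) :=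
  Finset.measurable_fun_sum _ fun _ _ => Finset.measurable_fun_sum _ fun _ _ =>
    (ℓ.continuous.measurable.comp (hT.measurable _)).pow_const 2

lemma integrable_systemSq_comp {Ω : Type*} [MeasurableSpace Ω] {ν : Measure Ω}
    [IsProbabilityMeasure ν]
    {T : Ω → Config (Label N M) d →L[ℝ] Config (Label N M) d} (hT : IsIsometryMixture T)
    (ℓ : Config (Label N M) d →L[ℝ] ℝ)
    (htot : ∀ ω, totalSq (ℓ.comp (T ω)) = totalSq ℓ) :
    Integrable (fun ω => systemSq (ℓ.comp (T ω))) ν :=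
  (integrable_const (totalSq ℓ)).mono' (measurable_systemSq_comp hT ℓ).aestronglyMeasurable
    (ae_of_all _ fun ω => by
      rw [norm_of_nonneg (systemSq_nonneg _), ← htot ω]
      exact systemSq_le_totalSq _)

/-- Only pairs of a system and a reservoir particle contribute. For such a pair the mean transfer is
the difference of the two squared blocks divided by d. Summing over all NM pairs yields N times the
reservoir part minus M times the system part. -/
lemma integral_systemSq_randomCollision
    (h0 : ∀ p : Label N M × Label N M, 0 ≤ rate lamS lamR μ p)
    (h1 : 0 < totalRate N M lamS lamR μ) (hM : 0 < M)
    {ρ : Measure (Angle d)} [IsProbabilityMeasure ρ] (hρ : IsSymmetricAngleLaw ρ)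
    (ℓ : Config (Label N M) d →L[ℝ] ℝ) :
    ∫ q, systemSq (ℓ.comp (randomCollision N M d q))
        ∂((pairLaw lamS lamR μ h0 h1).toMeasure.prod ρ) =
      systemSq ℓ + μ / (M * d * totalRate N M lamS lamR μ) *
        (N * (totalSq ℓ - systemSq ℓ) - M * systemSq ℓ) := by
  rw [integral_prod _ (integrable_systemSq_comp isIsometryMixture_randomCollision ℓ
    fun q => totalSq_comp_collideL (norm_angle q.2) ℓ _ _)]
  have hin : ∀ p : Label N M × Label N M,
      ∫ σ, systemSq (ℓ.comp (randomCollision N M d (p, σ))) ∂ρ = systemSq ℓ +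
        (systemInd p.1 - systemInd p.2) * (blockSq ℓ p.2 / d - blockSq ℓ p.1 / d) := fun p => by
    simp_rw [randomCollision, fun σ : Angle d => systemSq_comp_collideL (norm_angle σ) ℓ p.1 p.2]
    have hi1 := integral_sq_single hρ ℓ p.1
    have hi2 := integral_sq_single hρ ℓ p.2
    have hi := (hi2.1.sub hi1.1).const_mul (systemInd p.1 - systemInd p.2)
    simp only [Pi.sub_apply] at hi
    rw [integral_add (integrable_const _) hi, integral_const_mul,
      integral_sub hi2.1 hi1.1, hi1.2, hi2.2]
    simp
  simp_rw [hin]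
  rw [integral_pairLaw]
  simp_rw [mul_add]
  rw [Finset.sum_add_distrib, ← Finset.sum_mul, ← totalRate,
    sum_rate_mul (fun p => (systemInd p.1 - systemInd p.2) *
      (blockSq ℓ p.2 / d - blockSq ℓ p.1 / d)) (fun i => by simp), mul_add,
    inv_mul_cancel_left₀ h1.ne']
  congr 1
  simp only [systemInd, sub_self, zero_mul, Finset.sum_const_zero, mul_zero, add_zero, zero_add,
    sub_zero, one_mul]
  have hsum : ∑ i : Fin N, ∑ j : Fin M,
      (blockSq ℓ (Sum.inr j) / d - blockSq ℓ (Sum.inl i) / d) =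
      (N * (totalSq ℓ - systemSq ℓ) - M * systemSq ℓ) / d := by
    simp_rw [Finset.sum_sub_distrib]
    rw [totalSq_eq, systemSq]
    simp only [Finset.sum_const, Finset.card_univ, Fintype.card_fin, nsmul_eq_mul,
      ← Finset.sum_div, ← Finset.mul_sum]
    ring
  rw [hsum]
  have hM' : (M : ℝ) ≠ 0 := by positivity
  ring

/-- The contraction factor of one collision. -/
noncomputable def stepFactor (N M d : ℕ) (lamS lamR μ : ℝ) : ℝ :=
  1 - μ / (M * d * totalRate N M lamS lamR μ) * (N + M)

/-- Powers of the collision operator are averages over energy preserving maps. -/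
lemma exists_average_eq_pow (hN : 0 < N)
    (h0 : ∀ p : Label N M × Label N M, 0 ≤ rate lamS lamR μ p)
    (h1 : 0 < totalRate N M lamS lamR μ) (hM : 0 < M)
    {ρ : Measure (Angle d)} [IsProbabilityMeasure ρ] (hρ : IsSymmetricAngleLaw ρ) (k : ℕ) :
    ∃ (Ω : Type) (_ : MeasurableSpace Ω) (ν : Measure Ω) (_ : IsProbabilityMeasure ν)
      (T : Ω → Config (Label N M) d →L[ℝ] Config (Label N M) d) (hT : IsIsometryMixture T),
      ((isIsometryMixture_randomCollision.averageL1
        ((pairLaw lamS lamR μ h0 h1).toMeasure.prod ρ)) ^ k = hT.averageL1 ν) ∧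
      (∀ ℓ ω, totalSq (ℓ.comp (T ω)) = totalSq ℓ) ∧
      ∀ ℓ, ∫ ω, systemSq (ℓ.comp (T ω)) ∂ν = stepFactor N M d lamS lamR μ ^ k * systemSq ℓ +
        (1 - stepFactor N M d lamS lamR μ ^ k) * (N / (N + M)) * totalSq ℓ := by
  set q := stepFactor N M d lamS lamR μ with hq
  set ν₁ := (pairLaw lamS lamR μ h0 h1).toMeasure.prod ρ
  induction k with
  | zero =>
    refine ⟨Unit, inferInstance, Measure.dirac (), inferInstance,
      fun _ => ContinuousLinearMap.id ℝ _, ⟨fun u => measurable_const, fun _ _ => rfl⟩, ?_,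
      fun ℓ ω => rfl, fun ℓ => ?_⟩
    · rw [pow_zero]
      ext1 F
      refine Lp.ext ?_
      refine Filter.EventuallyEq.trans ?_ (IsIsometryMixture.coeFn_averageL1 _ _ F).symm
      refine ae_of_all _ fun u => ?_
      simp
    · simp
  | succ k ih =>
    obtain ⟨Ω, _, ν, _, T, hT, hpow, htot, hsys⟩ := ih
    have hC := isIsometryMixture_randomCollision (N := N) (M := M) (d := d)
    have htot' : ∀ (ℓ : Config (Label N M) d →L[ℝ] ℝ)
        (r : Ω × ((Label N M × Label N M) × Angle d)),
        totalSq (ℓ.comp ((T r.1).comp (randomCollision N M d r.2))) = totalSq ℓ := fun ℓ r => by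
      rw [← ContinuousLinearMap.comp_assoc, randomCollision,
        totalSq_comp_collideL (norm_angle r.2.2), htot]
    refine ⟨Ω × ((Label N M × Label N M) × Angle d), inferInstance, ν.prod ν₁, inferInstance,
      _, hT.comp hC, ?_, htot', fun ℓ => ?_⟩
    · rw [pow_succ', hpow]
      ext1 F
      exact hT.averageL1_averageL1 ν ν₁ hC F
    · rw [integral_prod _ (integrable_systemSq_comp (hT.comp hC) ℓ (htot' ℓ))]
      -- The new collision acts to the right of T, so the formula for one collision applies to the
      -- functional ℓ ∘ T. The share N/(N+M) of the conserved total is the fixed point of the affine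
      -- recursion.
      have hstep : ∀ ω, ∫ r, systemSq (ℓ.comp ((T ω).comp (randomCollision N M d r))) ∂ν₁ =
          q * systemSq (ℓ.comp (T ω)) + (1 - q) * (N / (N + M)) * totalSq ℓ := fun ω => by
        simp_rw [← ContinuousLinearMap.comp_assoc]
        rw [integral_systemSq_randomCollision h0 h1 hM hρ (ℓ.comp (T ω)), htot, hq, stepFactor]
        have : (N : ℝ) + M ≠ 0 := by positivity
        field_simp
        ring
      simp_rw [hstep]
      rw [integral_add ((integrable_systemSq_comp hT ℓ (htot ℓ)).const_mul q)
        (integrable_const _), integral_const_mul, hsys]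
      simp only [integral_const, probReal_univ, one_smul]
      ring

end Rates

end KacReservoir

namespace KacReservoir

open Real InformationTheory Filter Topology ENNReal

/-! ### The generator as Λ (Q - 1). -/

section Generator

variable {N M d : ℕ} {lamS lamR μ : ℝ}

/-- Diagonal pairs satisfy R_ii F = F, so their artificial rates cancel between ΛQ and Λ. -/
lemma kacGenerator_ae_eq (h0 : ∀ p : Label N M × Label N M, 0 ≤ rate lamS lamR μ p)
    (h1 : 0 < totalRate N M lamS lamR μ) (ρ : Measure (Angle d)) [IsProbabilityMeasure ρ]
    (F : Lp ℝ 1 (volume : Measure (Config (Label N M) d))) :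
    kacGenerator ρ lamS lamR μ F =ᵐ[volume] fun u => totalRate N M lamS lamR μ *
      (isIsometryMixture_randomCollision.averageL1
        ((pairLaw lamS lamR μ h0 h1).toMeasure.prod ρ) F u - F u) := by
  set ν := (pairLaw lamS lamR μ h0 h1).toMeasure.prod ρ
  have hT := isIsometryMixture_randomCollision (N := N) (M := M) (d := d)
  filter_upwards [hT.coeFn_averageL1 ν F,
    (hT.integrable_prod ν (L1.integrable_coeFn F)).prod_right_ae] with u hu hi
  have e1 : ∀ p : Label N M × Label N M, ∫ σ, F (randomCollision N M d (p, σ) u) ∂ρ =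
      pairCollision ρ p.1 p.2 F u := fun p => by
    simp_rw [randomCollision, collideL_eq_collide]
    rfl
  rw [hu, integral_prod _ hi]
  simp_rw [e1]
  rw [integral_pairLaw, mul_sub, mul_inv_cancel_left₀ h1.ne', totalRate, Finset.sum_mul,
    ← Finset.sum_sub_distrib]
  simp_rw [← mul_sub]
  rw [sum_rate_mul (fun p => pairCollision ρ p.1 p.2 F u - F u)
    (fun i => by simp [pairCollision, collide_self])]
  rfl

end Generator

/-! ### Poisson series for equations with bounded generator. -/

section Semigroup

variable {E : Type*} [NormedAddCommGroup E] [NormedSpace ℝ E] [CompleteSpace E]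

/-- The weights of the Poisson distribution. -/
noncomputable def poissonWeight (x : ℝ) (k : ℕ) : ℝ := exp (-x) * ((k.factorial : ℝ)⁻¹ * x ^ k)

lemma poissonWeight_nonneg {x : ℝ} (hx : 0 ≤ x) (k : ℕ) : 0 ≤ poissonWeight x k := by
  unfold poissonWeight; positivity

lemma hasSum_poissonWeight_mul_pow (x q : ℝ) :
    HasSum (fun k => poissonWeight x k * q ^ k) (exp (-(x * (1 - q)))) := by
  have h := (NormedSpace.exp_series_hasSum_exp' (𝕂 := ℝ) (x * q)).mul_left (exp (-x))
  rw [← Real.exp_eq_exp_ℝ, ← Real.exp_add] at h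
  have e : (fun k => poissonWeight x k * q ^ k) =
      fun k : ℕ => exp (-x) * ((k.factorial : ℝ)⁻¹ • (x * q) ^ k) := funext fun k => by
    rw [poissonWeight, mul_pow, smul_eq_mul]; ring
  rw [e, show -(x * (1 - q)) = -x + x * q by ring]
  exact h

lemma hasSum_poissonWeight (x : ℝ) : HasSum (poissonWeight x) 1 := by
  simpa using hasSum_poissonWeight_mul_pow x 1

/-- The Poisson series of the solution of `F' = Λ (Q - 1) F`. -/
lemma hasSum_of_hasDerivWithinAt (Λ : ℝ) (Q : E →L[ℝ] E) {F : ℝ → E}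
    (hF : ∀ t, 0 ≤ t → HasDerivWithinAt F (Λ • (Q (F t) - F t)) (Set.Ici 0) t) {t : ℝ}
    (ht : 0 ≤ t) :
    HasSum (fun k => poissonWeight (Λ * t) k • (Q ^ k) (F 0)) (F t) := by
  set g : ℝ → E := fun s => exp (-(Λ * s)) • (NormedSpace.exp (s • (Λ • Q))) (F 0)
  have hg : ∀ s, HasDerivAt g (Λ • (Q (g s) - g s)) s := fun s => by
    have h1 : HasDerivAt (fun s => (NormedSpace.exp (s • (Λ • Q))) (F 0))
        ((Λ • Q) (NormedSpace.exp (s • (Λ • Q)) (F 0))) s := by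
      have := (hasDerivAt_exp_smul_const' (𝕂 := ℝ) (Λ • Q) s).clm_apply (hasDerivAt_const s (F 0))
      simpa using this
    have h2 : HasDerivAt (fun s : ℝ => exp (-(Λ * s))) (exp (-(Λ * s)) * (-(Λ * 1))) s :=
      ((hasDerivAt_id s).const_mul Λ).neg.exp
    refine (h2.smul h1).congr_deriv ?_
    simp only [g, map_smul, smul_apply]
    module
  have hL : ∀ s : ℝ, LipschitzWith (‖Λ • (Q - ContinuousLinearMap.id ℝ E)‖₊)
      (fun y => Λ • (Q y - y)) := fun _ => (Λ • (Q - ContinuousLinearMap.id ℝ E)).lipschitz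
  have hcont : ContinuousOn F (Set.Icc 0 t) := fun s hs =>
    ((hF s hs.1).continuousWithinAt).mono Set.Icc_subset_Ici_self
  have heq : Set.EqOn F g (Set.Icc 0 t) := by
    -- The right side is a bounded linear map, hence Lipschitz, so the given solution must agree
    -- with the exponential series.
    refine ODE_solution_unique (v := fun _ y => Λ • (Q y - y)) hL hcont
      (fun s hs => (hF s hs.1).mono (Set.Ici_subset_Ici.2 hs.1))
      (fun s _ => (hg s).continuousAt.continuousWithinAt)
      (fun s _ => (hg s).hasDerivWithinAt) ?_
    simp [g]
  rw [heq (Set.right_mem_Icc.2 ht)]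
  have h3 := (ContinuousLinearMap.apply ℝ E (F 0)).hasSum
    (NormedSpace.exp_series_hasSum_exp' (𝕂 := ℝ) (t • (Λ • Q)))
  have h4 := h3.const_smul (exp (-(Λ * t)))
  suffices e : (fun k => poissonWeight (Λ * t) k • (Q ^ k) (F 0)) = fun k : ℕ => exp (-(Λ * t)) •
      ContinuousLinearMap.apply ℝ E (F 0) ((k.factorial : ℝ)⁻¹ • (t • (Λ • Q)) ^ k) by
    rw [e]; exact h4
  funext k
  simp only [ContinuousLinearMap.apply_apply, smul_apply, smul_smul, smul_pow, poissonWeight]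
  congr 1
  ring

end Semigroup

end KacReservoir

namespace KacReservoir

open Real InformationTheory Filter Topology ENNReal

/-! ### The marginal after random collisions as a Maxwell mixture. -/

section SystemPart

variable {N M d : ℕ} {β : ℝ}

variable (N M d) in
/-- The velocities of the Kac system. -/
noncomputable def systemProj : Config (Label N M) d →L[ℝ] Config (Fin N) d :=
  ContinuousLinearMap.pi fun i =>
    ContinuousLinearMap.proj (R := ℝ) (φ := fun _ : Label N M => Vel d) (Sum.inl i)

variable (N M d) in
/-- The Kac system with reservoir at rest. -/
noncomputable def systemIncl : Config (Fin N) d →L[ℝ] Config (Label N M) d :=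
  ContinuousLinearMap.pi (Sum.rec (fun i =>
    ContinuousLinearMap.proj (R := ℝ) (φ := fun _ : Fin N => Vel d) i) fun _ => 0)

variable (N M d) in
/-- The reservoir with Kac system at rest. -/
noncomputable def reservoirIncl : Config (Fin M) d →L[ℝ] Config (Label N M) d :=
  ContinuousLinearMap.pi (Sum.rec (fun _ => 0) fun j =>
    ContinuousLinearMap.proj (R := ℝ) (φ := fun _ : Fin M => Vel d) j)

lemma systemProj_apply (u : Config (Label N M) d) (i : Fin N) :
    systemProj N M d u i = u (Sum.inl i) := rfl

lemma systemIncl_apply (v : Config (Fin N) d) : systemIncl N M d v = Sum.elim v 0 := by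
  funext k
  rcases k with i | j <;> rfl

lemma systemIncl_add_reservoirIncl (v : Config (Fin N) d) (w : Config (Fin M) d) :
    systemIncl N M d v + reservoirIncl N M d w = Sum.elim v w := by
  funext k
  rcases k with i | j
  · exact add_zero (v i)
  · exact zero_add (w j)

lemma systemIncl_unitVec (i : Fin N) (a : Fin d) :
    systemIncl N M d (unitVec i a) = unitVec (Sum.inl i) a := by
  rw [systemIncl_apply]
  funext k
  rcases k with j | j
  · by_cases h : j = i
    · subst h; simp [unitVec]
    · simp [unitVec, h]
  · simp [unitVec]

lemma systemProj_unitVec_inl (i : Fin N) (a : Fin d) :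
    systemProj N M d (unitVec (Sum.inl i) a) = unitVec i a := by
  rw [← systemIncl_unitVec, systemIncl_apply]
  rfl

lemma systemProj_unitVec_inr (j : Fin M) (a : Fin d) :
    systemProj N M d (unitVec (Sum.inr j) a) = 0 := by
  funext i
  simp [systemProj_apply, unitVec]

lemma norm_systemProj_le (u : Config (Label N M) d) : ‖systemProj N M d u‖ ≤ ‖u‖ :=
  (pi_norm_le_iff_of_nonneg (norm_nonneg _)).2 fun i => norm_le_pi_norm u (Sum.inl i)

lemma energySq_le_card_mul {ι : Type} [Fintype ι] (v : Config ι d) :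
    energySq v ≤ Fintype.card ι * ‖v‖ ^ 2 := by
  refine (Finset.sum_le_card_nsmul _ _ (‖v‖ ^ 2) fun i _ => ?_).trans_eq ?_
  · gcongr; exact norm_le_pi_norm v i
  · simp

variable {Ω : Type*} [MeasurableSpace Ω] {ν : Measure Ω} [IsProbabilityMeasure ν]
  {T : Ω → Config (Label N M) d →L[ℝ] Config (Label N M) d}

/-- The effect of a map on the Kac system, as a function of the state of the Kac system. -/
noncomputable def systemBlock (T : Ω → Config (Label N M) d →L[ℝ] Config (Label N M) d) (ω : Ω) :
    Config (Fin N) d →L[ℝ] Config (Fin N) d :=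
  (systemProj N M d).comp ((T ω).comp (systemIncl N M d))

/-- The effect of a map on the Kac system, as a function of the state of the reservoir. -/
noncomputable def reservoirBlock (T : Ω → Config (Label N M) d →L[ℝ] Config (Label N M) d)
    (ω : Ω) : Config (Fin M) d →L[ℝ] Config (Fin N) d :=
  (systemProj N M d).comp ((T ω).comp (reservoirIncl N M d))

lemma systemBlock_add_reservoirBlock (ω : Ω) (v : Config (Fin N) d) (w : Config (Fin M) d) :
    systemBlock T ω v + reservoirBlock T ω w = systemProj N M d (T ω (Sum.elim v w)) := by
  rw [← systemIncl_add_reservoirIncl, map_add, map_add]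
  rfl

lemma measurePreserving_systemProj [Fact (0 < β)] :
    MeasurePreserving (systemProj N M d) (maxwellMeasure (Label N M) d β)
      (maxwellMeasure (Fin N) d β) := by
  have h := measurePreserving_elim_maxwellMeasure (N := N) (M := M) (d := d) (β := β)
  refine ⟨(systemProj N M d).continuous.measurable, ?_⟩
  rw [← h.map_eq, Measure.map_map (systemProj N M d).continuous.measurable h.measurable]
  exact (measurePreserving_fst (μ := maxwellMeasure (Fin N) d β)
    (ν := maxwellMeasure (Fin M) d β)).map_eq

/-- The sum rule is `hsys` for functionals pulled back from the system. These have no reservoir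
part, so their total and system squares agree and the two coefficients add up. -/
lemma isMaxwellMixture_blocks [Fact (0 < β)] (hT : IsIsometryMixture T) {a b : ℝ}
    (hsys : ∀ ℓ : Config (Label N M) d →L[ℝ] ℝ,
      ∫ ω, systemSq (ℓ.comp (T ω)) ∂ν = a * systemSq ℓ + b * totalSq ℓ) :
    IsMaxwellMixture β (a + b) ν (systemBlock T) (reservoirBlock T) where
  measurable_left v := (systemProj N M d).continuous.measurable.comp (hT.measurable _)
  measurable_right w := (systemProj N M d).continuous.measurable.comp (hT.measurable _)
  exists_norm_le := by
    -- The maps preserve the Euclidean length while the norm on configurations is a maximum over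
    -- particles. Comparing the two on N particles costs √N.
    refine ⟨√N, fun ω => ContinuousLinearMap.opNorm_le_bound _ (sqrt_nonneg _) fun v => ?_⟩
    refine (norm_systemProj_le _).trans ?_
    refine abs_le_of_sq_le_sq' ?_ (by positivity) |>.2
    calc ‖T ω (systemIncl N M d v)‖ ^ 2 ≤ energySq (T ω (systemIncl N M d v)) :=
          norm_sq_le_energySq _
      _ = energySq v := by
          rw [hT.energySq, systemIncl_apply, energySq_elim]
          simp [energySq]
      _ ≤ N * ‖v‖ ^ 2 := by simpa using energySq_le_card_mul v
      _ = (√N * ‖v‖) ^ 2 := by rw [mul_pow, sq_sqrt (by positivity)]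
  measurePreserving ω := by
    have h := measurePreserving_systemProj.comp
      ((measurePreserving_maxwellMeasure_of_energySq (β := β)
        (measurePreserving_volume_of_energySq' (T ω) (hT.energySq ω)) (hT.energySq ω)).comp
        measurePreserving_elim_maxwellMeasure)
    have e : (fun p : Config (Fin N) d × Config (Fin M) d =>
        systemBlock T ω p.1 + reservoirBlock T ω p.2) =
        systemProj N M d ∘ T ω ∘ fun p => Sum.elim p.1 p.2 :=
      funext fun p => systemBlock_add_reservoirBlock ω p.1 p.2
    rw [e]
    exact h
  sum_rule ℓ := by
    have h := hsys (ℓ.comp (systemProj N M d))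
    have e1 : systemSq (ℓ.comp (systemProj N M d)) =
        ∑ p : Fin N × Fin d, ℓ (unitVec p.1 p.2) ^ 2 := by
      simp [systemSq, blockSq, Fintype.sum_prod_type, systemProj_unitVec_inl]
    have e2 : totalSq (ℓ.comp (systemProj N M d)) =
        ∑ p : Fin N × Fin d, ℓ (unitVec p.1 p.2) ^ 2 := by
      rw [totalSq_eq, e1]
      simp [blockSq, systemProj_unitVec_inr]
    rw [e1, e2, ← add_mul] at h
    rw [← h]
    refine integral_congr_ae (ae_of_all _ fun ω => ?_)
    simp [systemSq, blockSq, Fintype.sum_prod_type, systemBlock, systemIncl_unitVec]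

/-- The sum rule exhibits c as a ratio of an average of squares and a positive sum. This spares a
discussion of signs, since `stepFactor` can be negative. -/
lemma IsMaxwellMixture.nonneg {ι κ : Type} [Fintype ι] [Fintype κ] [DecidableEq ι] [Nonempty ι]
    (hd : 0 < d) {c : ℝ} {A : Ω → Config ι d →L[ℝ] Config ι d}
    {B : Ω → Config κ d →L[ℝ] Config ι d} (hK : IsMaxwellMixture β c ν A B) : 0 ≤ c := by
  obtain ⟨i⟩ := ‹Nonempty ι›
  set ℓ : Config ι d →L[ℝ] ℝ := (EuclideanSpace.proj (⟨0, hd⟩ : Fin d) : Vel d →L[ℝ] ℝ).comp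
    (ContinuousLinearMap.proj (R := ℝ) (φ := fun _ : ι => Vel d) i)
  have h1 : 0 < ∑ p : ι × Fin d, ℓ (unitVec p.1 p.2) ^ 2 :=
    Finset.sum_pos' (fun _ _ => sq_nonneg _) ⟨(i, ⟨0, hd⟩), Finset.mem_univ _, by
      simp [ℓ, unitVec]⟩
  refine nonneg_of_mul_nonneg_left ?_ h1
  rw [← hK.sum_rule ℓ]
  exact integral_nonneg fun ω => Finset.sum_nonneg fun _ _ => sq_nonneg _

/-- The Maxwellian of all particles is invariant under T and factorizes as γ(v) γ(w). The first
factor leaves the integral, and the second becomes the measure over which the reservoir is averaged.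
-/
lemma marginalL1_averageL1_ae_eq [Fact (0 < β)] (hT : IsIsometryMixture T) {c : ℝ}
    (hK : IsMaxwellMixture β c ν (systemBlock T) (reservoirBlock T))
    {F : Lp ℝ 1 (volume : Measure (Config (Label N M) d))} {h : Config (Fin N) d → ℝ}
    (hF : F =ᵐ[volume] fun u => maxwellian β u * h (systemProj N M d u))
    (hh : Integrable h (maxwellMeasure (Fin N) d β)) :
    marginalL1 N M d (hT.averageL1 ν F) =ᵐ[volume] fun v =>
      maxwellian β v * mixture β ν (systemBlock T) (reservoirBlock T) h v := by
  refine (coeFn_marginalL1 _).trans ((kacMarginal_congr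
    ((hT.coeFn_averageL1 ν F).trans (hT.average_congr ν hF))).trans ?_)
  have hi := absolutelyContinuous_maxwellMeasure.ae_le
    (hK.measurePreserving_affine.integrable_comp_of_integrable hh).prod_right_ae
  filter_upwards [hi] with v hv
  have e : ∀ (w : Config (Fin M) d) (ω : Ω),
      maxwellian β (T ω (Sum.elim v w)) * h (systemProj N M d (T ω (Sum.elim v w))) =
      maxwellian β v * (maxwellian β w * h (systemBlock T ω v + reservoirBlock T ω w)) :=
    fun w ω => by
      rw [systemBlock_add_reservoirBlock, ← mul_assoc, ← maxwellian_elim]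
      simp only [maxwellian, hT.energySq]
  unfold kacMarginal
  simp_rw [e, integral_const_mul]
  rw [← integral_maxwellMeasure, mixture]
  congr 1
  exact (integral_prod_symm _ hv).symm

end SystemPart

/-! ### Relative entropy in terms of `klFun`. -/

section Entropy

variable {ι : Type} [Fintype ι] {d : ℕ} {β : ℝ} [Fact (0 < β)]

/-- The relative entropy in terms of `x ln x + 1 - x`. -/
lemma relEntropy_eq_toReal {f : Config ι d → ℝ} (hf : IsProbDensity f)
    (hfin : ∫⁻ v, ENNReal.ofReal (klFun (f v / maxwellian β v)) ∂(maxwellMeasure ι d β) < ∞) :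
    Integrable (entropyIntegrand f (maxwellian β)) ∧
      relEntropy f (maxwellian β) =
        (∫⁻ v, ENNReal.ofReal (klFun (f v / maxwellian β v)) ∂(maxwellMeasure ι d β)).toReal := by
  have hm : AEMeasurable (fun v => f v / maxwellian β v) (maxwellMeasure ι d β) :=
    (hf.integrable.aemeasurable.div continuous_maxwellian.measurable.aemeasurable).mono_ac
      maxwellMeasure_absolutelyContinuous
  have hk0 : ∀ᵐ v ∂(maxwellMeasure ι d β), 0 ≤ klFun (f v / maxwellian β v) :=
    maxwellMeasure_absolutelyContinuous.ae_le (hf.nonneg.mono fun v hv =>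
      klFun_nonneg (div_nonneg hv (maxwellian_nonneg v)))
  have hkm : AEStronglyMeasurable (fun v => klFun (f v / maxwellian β v)) (maxwellMeasure ι d β) :=
    (measurable_klFun.comp_aemeasurable hm).aestronglyMeasurable
  have hki : Integrable (fun v => klFun (f v / maxwellian β v)) (maxwellMeasure ι d β) :=
    (lintegral_ofReal_ne_top_iff_integrable hkm hk0).1 hfin.ne
  have hki' := integrable_maxwellMeasure_iff.1 hki
  -- The integrands differ by f - γ, which integrates to 0 as both are probability densities.
  have e : entropyIntegrand f (maxwellian β) = fun v =>
      maxwellian β v * klFun (f v / maxwellian β v) - maxwellian β v + f v := funext fun v => by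
    have := (maxwellian_pos (β := β) v).ne'
    rw [entropyIntegrand, klFun]
    field_simp
    ring
  have hi : Integrable (fun v => maxwellian β v * klFun (f v / maxwellian β v) - maxwellian β v) :=
    hki'.sub integrable_maxwellian
  refine ⟨by rw [e]; exact hi.add hf.integrable, ?_⟩
  simp only [relEntropy, e]
  rw [integral_add hi hf.integrable, integral_sub hki' integrable_maxwellian,
    integral_maxwellian, hf.integral_eq_one, ← integral_maxwellMeasure,
    integral_eq_lintegral_of_nonneg_ae hk0 hkm]
  ring

end Entropy

end KacReservoir

namespace KacReservoir

open Real InformationTheory Filter Topology ENNReal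

/-! ### Assembly: initial data, k collisions, and the Poisson average. -/

section MainProof

variable {N M d : ℕ} {β lamS lamR μ : ℝ}

lemma integral_eq_one_of_hasSum {X : Type*} [MeasurableSpace X] {m : Measure X}
    {f : ℕ → Lp ℝ 1 m} {f' : Lp ℝ 1 m} {w : ℕ → ℝ} (hw1 : HasSum w 1)
    (hf : HasSum (fun k => w k • f k) f') (h1 : ∀ k, ∫ x, f k x ∂m = 1) : ∫ x, f' x ∂m = 1 := by
  have h := (L1.integralCLM (α := X) (E := ℝ) (μ := m)).hasSum hf
  simp only [map_smul, ← L1.integral_eq, L1.integral_eq_integral, h1, smul_eq_mul, mul_one] at h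
  exact h.unique hw1

lemma quasiMeasurePreserving_systemProj :
    Measure.QuasiMeasurePreserving (systemProj N M d) volume volume :=
  Measure.quasiMeasurePreserving_fst.comp measurePreserving_splitEquiv.quasiMeasurePreserving

lemma productState_ae_eq [Fact (0 < β)] {f f₁ : Config (Fin N) d → ℝ} (h : f =ᵐ[volume] f₁) :
    (productState β f : Config (Label N M) d → ℝ) =ᵐ[volume] fun u =>
      maxwellian β u * (f₁ (systemProj N M d u) / maxwellian β (systemProj N M d u)) := by
  filter_upwards [quasiMeasurePreserving_systemProj.ae h] with u hu
  have e : (Sum.elim (systemProj N M d u) fun j => u (Sum.inr j)) = u :=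
    Sum.elim_comp_inl_inr u
  have e2 := maxwellian_elim (β := β) (systemProj N M d u) fun j : Fin M => u (Sum.inr j)
  rw [e] at e2
  rw [e2, ← hu, productState]
  have := (maxwellian_pos (β := β) (systemProj N M d u)).ne'
  field_simp
  exact mul_comm _ _

/-- The energy of the system is part of the total energy, and the reservoir factor has mass one. -/
lemma lintegral_energySq_mul_lt_top [Fact (0 < β)] {f : Config (Fin N) d → ℝ}
    (hm : Measurable f) (h0 : ∀ v, 0 ≤ f v)
    (h : kineticEnergy (productState β f : Config (Label N M) d → ℝ) < ⊤) :
    ∫⁻ v, ENNReal.ofReal (energySq v * f v) < ∞ := by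
  have hγ : ∫⁻ w : Config (Fin M) d, ENNReal.ofReal (maxwellian β w) = 1 :=
    lintegral_ofReal_maxwellian
  have hE : Measurable fun v : Config (Fin N) d => ENNReal.ofReal (2⁻¹ * energySq v * f v) :=
    ((continuous_energySq.measurable.const_mul _).mul hm).ennreal_ofReal
  have h2 : ∫⁻ v, ENNReal.ofReal (2⁻¹ * energySq v * f v) < ∞ := by
    refine lt_of_le_of_lt ?_ h
    calc ∫⁻ v, ENNReal.ofReal (2⁻¹ * energySq v * f v)
        = ∫⁻ p : Config (Fin N) d × Config (Fin M) d,
            ENNReal.ofReal (2⁻¹ * energySq p.1 * f p.1) * ENNReal.ofReal (maxwellian β p.2)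
            ∂((volume : Measure (Config (Fin N) d)).prod volume) := by
          rw [lintegral_prod_mul hE.aemeasurable measurable_ofReal_maxwellian.aemeasurable, hγ,
            mul_one]
      _ ≤ ∫⁻ p : Config (Fin N) d × Config (Fin M) d, ENNReal.ofReal
            (2⁻¹ * energySq (Sum.elim p.1 p.2 : Config (Label N M) d) *
              productState β f (Sum.elim p.1 p.2 : Config (Label N M) d))
            ∂((volume : Measure (Config (Fin N) d)).prod volume) := by
          refine lintegral_mono fun p => ?_
          have h1 := energySq_nonneg p.1
          have h2 := energySq_nonneg p.2
          have h3 := h0 p.1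
          have h4 := maxwellian_nonneg (β := β) p.2
          rw [← ENNReal.ofReal_mul (by positivity), energySq_elim]
          refine ENNReal.ofReal_le_ofReal ?_
          change _ ≤ 2⁻¹ * (energySq p.1 + energySq p.2) * (f p.1 * maxwellian β p.2)
          rw [mul_assoc]
          gcongr
          linarith
      _ = kineticEnergy (productState β f : Config (Label N M) d → ℝ) := by
          refine measurePreserving_splitEquiv_symm.lintegral_comp (f := fun u => ENNReal.ofReal
            (2⁻¹ * energySq u * productState β f u)) ?_
          refine ((continuous_energySq.measurable.const_mul _).mul ?_).ennreal_ofReal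
          exact (hm.comp (systemProj N M d).continuous.measurable).mul
            (continuous_maxwellian.measurable.comp (by fun_prop))
  have e : ∀ v : Config (Fin N) d, ENNReal.ofReal (energySq v * f v) =
      2 * ENNReal.ofReal (2⁻¹ * energySq v * f v) := fun v => by
    rw [show (2 : ℝ≥0∞) = ENNReal.ofReal 2 by simp, ← ENNReal.ofReal_mul zero_le_two]
    congr 1; ring
  simp_rw [e]
  rw [lintegral_const_mul _ hE]
  exact ENNReal.mul_lt_top (by simp) h2

/-- The marginal after `k` collisions. -/
lemma exists_marginal_pow [Fact (0 < β)] (hd : 0 < d) (hN : 0 < N) (hM : 0 < M)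
    (h0 : ∀ p : Label N M × Label N M, 0 ≤ rate lamS lamR μ p)
    (h1 : 0 < totalRate N M lamS lamR μ)
    {ρ : Measure (Angle d)} [IsProbabilityMeasure ρ] (hρ : IsSymmetricAngleLaw ρ)
    {F : Lp ℝ 1 (volume : Measure (Config (Label N M) d))} {h : Config (Fin N) d → ℝ}
    (hF : F =ᵐ[volume] fun u => maxwellian β u * h (systemProj N M d u))
    (hm : Measurable h) (hh0 : ∀ v, 0 ≤ h v) (hi : Integrable h (maxwellMeasure (Fin N) d β))
    (hh1 : ∫ v, h v ∂(maxwellMeasure (Fin N) d β) = 1) (k : ℕ) :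
    0 ≤ stepFactor N M d lamS lamR μ ^ k +
      (1 - stepFactor N M d lamS lamR μ ^ k) * (N / (N + M) : ℝ) ∧
    ∃ g : Config (Fin N) d → ℝ, (∀ v, 0 ≤ g v) ∧ AEMeasurable g (maxwellMeasure (Fin N) d β) ∧
      ∫ v, g v ∂(maxwellMeasure (Fin N) d β) = 1 ∧
      marginalL1 N M d ((isIsometryMixture_randomCollision.averageL1
        ((pairLaw lamS lamR μ h0 h1).toMeasure.prod ρ) ^ k) F) =ᵐ[volume]
          (fun v => maxwellian β v * g v) ∧
      ∫⁻ v, ENNReal.ofReal (klFun (g v)) ∂(maxwellMeasure (Fin N) d β) ≤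
        ENNReal.ofReal (stepFactor N M d lamS lamR μ ^ k +
          (1 - stepFactor N M d lamS lamR μ ^ k) * (N / (N + M) : ℝ)) *
          ∫⁻ v, ENNReal.ofReal (klFun (h v)) ∂(maxwellMeasure (Fin N) d β) := by
  obtain ⟨Ω, _, ν, _, T, hT, hpow, -, hsys⟩ :=
    exists_average_eq_pow (lamS := lamS) (lamR := lamR) (μ := μ) hN h0 h1 hM hρ k
  have : Nonempty (Fin N) := ⟨⟨0, hN⟩⟩
  have hK := isMaxwellMixture_blocks (β := β) hT hsys
  have hc := hK.nonneg hd
  refine ⟨hc, mixture β ν (systemBlock T) (reservoirBlock T) h,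
    fun v => integral_nonneg fun _ => hh0 _, (hK.aestronglyMeasurable_mixture hm).aemeasurable,
    (hK.integral_mixture hi).trans hh1, ?_, hK.lintegral_klFun_mixture_le hc hm hh0 hi hh1⟩
  rw [hpow]
  exact marginalL1_averageL1_ae_eq hT hK hF hi

/-- The Poisson average of q^k is exp(-Λt(1 - q)), and Λ(1 - q) = μ(N+M)/(dM). Here Λ cancels, and
with it the artificial diagonal rates. -/
lemma hasSum_poissonWeight_mul_contraction (hM : 0 < M) (hd : 0 < d)
    (h1 : 0 < totalRate N M lamS lamR μ) (t s : ℝ) :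
    HasSum (fun k => poissonWeight (totalRate N M lamS lamR μ * t) k *
      ((stepFactor N M d lamS lamR μ ^ k +
        (1 - stepFactor N M d lamS lamR μ ^ k) * (N / (N + M) : ℝ)) * s))
      (((N : ℝ) / ((N : ℝ) + (M : ℝ)) + (M : ℝ) / ((N : ℝ) + (M : ℝ)) *
          exp (-(μ / (d : ℝ)) * (((N : ℝ) + (M : ℝ)) / (M : ℝ)) * t)) * s) := by
  have hM' : (0 : ℝ) < M := by positivity
  have hd' : (0 : ℝ) < d := by positivity
  have hNM : (0 : ℝ) < N + M := by positivity
  set Λ := totalRate N M lamS lamR μ with hΛ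
  set q := stepFactor N M d lamS lamR μ with hq
  have hexp : -(μ / (d : ℝ)) * (((N : ℝ) + (M : ℝ)) / (M : ℝ)) * t = -(Λ * t * (1 - q)) := by
    rw [hq, stepFactor, ← hΛ]
    field_simp
    ring
  have h := (((hasSum_poissonWeight (Λ * t)).mul_right ((N : ℝ) / (N + M))).add
    ((hasSum_poissonWeight_mul_pow (Λ * t) q).mul_right ((M : ℝ) / (N + M)))).mul_right s
  rw [hexp]
  have e : (M : ℝ) / (N + M) = 1 - N / (N + M) := by field_simp; ring
  rw [one_mul, mul_comm _ ((M : ℝ) / (N + M))] at h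
  have e2 : (fun k => poissonWeight (Λ * t) k * ((q ^ k + (1 - q ^ k) * (N / (N + M) : ℝ)) * s)) =
      fun k => (poissonWeight (Λ * t) k * ((N : ℝ) / (N + M)) +
        poissonWeight (Λ * t) k * q ^ k * ((M : ℝ) / (N + M))) * s := funext fun k => by
    rw [e]; ring
  rw [e2]
  exact h

end MainProof

end KacReservoir

theorem mainTheorem2 (d N M : ℕ) (hd : 0 < d) (hN : 0 < N) (hM : 0 < M)
    (β lamS lamR μ : ℝ) (hβ : 0 < β) (hlamS : 0 ≤ lamS) (hlamR : 0 ≤ lamR) (hμ : 0 ≤ μ)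
    (ρ : Measure (KacReservoir.Angle d)) [IsProbabilityMeasure ρ]
    (hρ : KacReservoir.IsSymmetricAngleLaw ρ)
    (f₀ : KacReservoir.Config (Fin N) d → ℝ)
    (hf₀ : KacReservoir.IsProbDensity f₀)
    (hH1 : KacReservoir.MemH1 (fun v => Real.sqrt (f₀ v)))
    (F : ℝ → Lp ℝ 1 (volume : Measure (KacReservoir.Config (KacReservoir.Label N M) d)))
    (hF : KacReservoir.IsMasterSolution ρ lamS lamR μ F)
    (hF₀ : (F 0 : KacReservoir.Config (KacReservoir.Label N M) d → ℝ) =ᵐ[volume]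
      KacReservoir.productState β f₀)
    (hE : KacReservoir.kineticEnergy (F 0) < ⊤)
    (t : ℝ) (ht : 0 ≤ t) :
    Integrable (KacReservoir.entropyIntegrand f₀ (KacReservoir.maxwellian β)) ∧
    Integrable (KacReservoir.entropyIntegrand (KacReservoir.kacMarginal (F t))
      (KacReservoir.maxwellian β)) ∧
    KacReservoir.relEntropy (KacReservoir.kacMarginal (F t)) (KacReservoir.maxwellian β) ≤
      ((N : ℝ) / ((N : ℝ) + (M : ℝ)) + (M : ℝ) / ((N : ℝ) + (M : ℝ)) *
          Real.exp (-(μ / (d : ℝ)) * (((N : ℝ) + (M : ℝ)) / (M : ℝ)) * t)) *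
        KacReservoir.relEntropy f₀ (KacReservoir.maxwellian β) := by
  open KacReservoir InformationTheory in
  have : Fact (0 < β) := ⟨hβ⟩
  have : Nonempty (Fin N) := ⟨⟨0, hN⟩⟩
  have h0 := rate_nonneg (lamS := lamS) (lamR := lamR) (μ := μ) hN hM hlamS hlamR hμ
  have h1 := totalRate_pos hN hM hlamS hlamR hμ
  set Λ := totalRate N M lamS lamR μ with hΛ
  set γ := maxwellMeasure (Fin N) d β with hγ
  -- a measurable nonnegative version of the density
  have hm₀ := hf₀.integrable.aestronglyMeasurable.aemeasurable
  set f₁ : Config (Fin N) d → ℝ := fun v => max (hm₀.mk f₀ v) 0 with hf₁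
  have hm₁ : Measurable f₁ := hm₀.measurable_mk.max measurable_const
  have hf₁0 : ∀ v, 0 ≤ f₁ v := fun v => le_max_right _ _
  have hf₀₁ : f₀ =ᵐ[volume] f₁ := by
    filter_upwards [hm₀.ae_eq_mk, hf₀.nonneg] with v hv hv0
    simp only [hf₁]
    rw [← hv, max_eq_left hv0]
  set h : Config (Fin N) d → ℝ := fun v => f₁ v / maxwellian β v with hh
  have hhm : Measurable h := hm₁.div continuous_maxwellian.measurable
  have hh0 : ∀ v, 0 ≤ h v := fun v => div_nonneg (hf₁0 v) (maxwellian_nonneg v)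
  have hmul : ∀ v, maxwellian β v * h v = f₁ v := fun v =>
    mul_div_cancel₀ _ (maxwellian_pos v).ne'
  have hhi : Integrable h γ := integrable_maxwellMeasure_iff.2 (by
    simp_rw [hmul]; exact hf₀.integrable.congr hf₀₁)
  have hh1 : ∫ v, h v ∂γ = 1 := by
    rw [hγ, integral_maxwellMeasure]
    simp_rw [hmul]
    rw [← integral_congr_ae hf₀₁, hf₀.integral_eq_one]
  have hFh : F 0 =ᵐ[volume] fun u => maxwellian β u * h (systemProj N M d u) :=
    hF₀.trans (productState_ae_eq hf₀₁)
  -- the initial entropy is finite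
  have hE' : ∫⁻ v, ENNReal.ofReal (energySq v * f₀ v) < ⊤ := by
    rw [lintegral_congr_ae (hf₀₁.mono fun v hv => by simp only [hv] :
      (fun v => ENNReal.ofReal (energySq v * f₀ v)) =ᵐ[volume]
        fun v => ENNReal.ofReal (energySq v * f₁ v))]
    refine lintegral_energySq_mul_lt_top (M := M) (β := β) hm₁ hf₁0 ?_
    have e : F 0 =ᵐ[volume] productState β f₁ :=
      hFh.trans (productState_ae_eq (Filter.EventuallyEq.refl _ f₁)).symm
    refine lt_of_eq_of_lt (lintegral_congr_ae (e.mono fun u hu => ?_)) hE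
    simp only [hu]
  have hfin := lintegral_klFun_div_maxwellian_lt_top (β := β) hd hf₀.nonneg hf₀.integrable hH1 hE'
  obtain ⟨hint₀, hrel₀⟩ := relEntropy_eq_toReal (β := β) hf₀ hfin
  set I := ∫⁻ v, ENNReal.ofReal (klFun (f₀ v / maxwellian β v)) ∂γ with hI
  have hIh : ∫⁻ v, ENNReal.ofReal (klFun (h v)) ∂γ = I :=
    lintegral_congr_ae ((maxwellMeasure_absolutelyContinuous.ae_eq hf₀₁).mono
      fun v hv => by simp only [hh, hv])
  -- the Poisson series of the solution
  set Q := isIsometryMixture_randomCollision.averageL1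
    ((pairLaw lamS lamR μ h0 h1).toMeasure.prod ρ) with hQ
  have hsol : ∀ s, 0 ≤ s → HasDerivWithinAt F (Λ • (Q (F s) - F s)) (Set.Ici 0) s := fun s hs => by
    obtain ⟨G, hG, hG'⟩ := hF s hs
    have e : G = Λ • (Q (F s) - F s) := by
      refine Lp.ext (hG.trans ((kacGenerator_ae_eq h0 h1 ρ (F s)).trans ?_))
      filter_upwards [Lp.coeFn_smul Λ (Q (F s) - F s), Lp.coeFn_sub (Q (F s)) (F s)] with u h1 h2
      rw [h1, Pi.smul_apply, h2, Pi.sub_apply, smul_eq_mul]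
    exact e ▸ hG'
  -- The marginal is a bounded operator on L¹, so it may be taken term by term in the Poisson
  -- series.
  have hsum := (marginalL1 N M d).hasSum (hasSum_of_hasDerivWithinAt Λ Q hsol ht)
  simp only [map_smul] at hsum
  choose ha g hg0 hgm hg1 hgF hgI using
    exists_marginal_pow (β := β) hd hN hM h0 h1 hρ hFh hhm hh0 hhi hh1
  have hw := poissonWeight_nonneg (mul_nonneg h1.le ht)
  have hw1 := hasSum_poissonWeight (Λ * t)
  have hcon := hasSum_poissonWeight_mul_contraction hM hd h1 t I.toReal
  obtain ⟨hpos, hle⟩ := lintegral_klFun_le_of_hasSum hw hw1 hsum hgF hg0 hgm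
    (fun k => mul_nonneg (ha k) ENNReal.toReal_nonneg)
    (fun k => by
      rw [ENNReal.ofReal_mul (ha k), ENNReal.ofReal_toReal hfin.ne, ← hIh]
      exact hgI k) hcon
  have hmass := integral_eq_one_of_hasSum hw1 hsum fun k => by
    rw [integral_congr_ae (hgF k), ← integral_maxwellMeasure, hg1 k]
  have hmarg := coeFn_marginalL1 (F t)
  have hdens : IsProbDensity (kacMarginal (F t)) :=
    ⟨by filter_upwards [hmarg, hpos] with v h1 h2; rwa [← h1],
      integrable_kacMarginal (L1.integrable_coeFn _), by rw [← integral_congr_ae hmarg, hmass]⟩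
  have hle' : ∫⁻ v, ENNReal.ofReal (klFun (kacMarginal (F t) v / maxwellian β v)) ∂γ ≤ _ :=
    (lintegral_congr_ae ((maxwellMeasure_absolutelyContinuous.ae_eq hmarg).mono
      fun v hv => by simp only [hv])).trans_le hle
  obtain ⟨hint, hrel⟩ := relEntropy_eq_toReal hdens (hle'.trans_lt ENNReal.ofReal_lt_top)
  refine ⟨hint₀, hint, ?_⟩
  rw [hrel, hrel₀]
  refine ENNReal.toReal_le_of_le_ofReal ?_ hle'
  exact mul_nonneg (by positivity) ENNReal.toReal_nonneg
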